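/- Let $N\in\mathbb N$ and $[N]=\{1,\dots,N\}$. For $K\in\mathbb R^{N\times N}$ and $S\subseteq[N]$ write $\Delta_S(K)=\det\,(K_{i,j})_{i,j\in S}$ for the principal minor on $S$ (with $\Delta_\emptyset(K)=1$). Let $\mathcal K$ be the set of matrices $K\in\mathbb R^{N\times N}$ such that $|K_{i,j}|=|K_{j,i}|$ for all $i,j\in[N]$ and such that, whenever $i,j,k,\ell\in[N]$ are distinct and $K_{i,j}K_{j,k}K_{k,\ell}K_{\ell,i}\neq 0$, (i) $|K_{i,j}K_{k,\ell}|\neq|K_{j,k}K_{\ell,i}|$, and (ii) for all $\phi_1,\phi_2,\phi_3\in\{-1,1\}$, $$\phi_1K_{i,j}K_{j,k}K_{k,\ell}K_{\ell,i}+\phi_2K_{i,j}K_{j,\ell}K_{\ell,k}K_{k,i}+\phi_3K_{i,k}K_{k,j}K_{j,\ell}K_{\ell,i}\neq 0.$$ The sparsity graph of $K\in\mathcal K$ is the simple graph on $[N]$ in which distinct $i,j$ are adjacent if and only if $K_{i,j}\neq 0$. A block of a graph is a maximal two-connected subgraph, where a graph is called two-connected if it is connected, has at least two vertices, and remains connected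 after the removal of any one vertex (so a single edge is two-connected). **Proposition.** Let $K\in\mathcal K$ have sparsity graph $G$. Then the set of all $K'\in\mathcal K$ with $\Delta_S(K')=\Delta_S(K)$ for every $S\subseteq[N]$ is exactly the set of matrices that can be obtained from $K$ by finitely many (possibly zero) applications, in any order, of the following two operations: - *$\mathcal D_N$-similarity:* $A\mapsto DAD$, where $D$ is an arbitrary diagonal matrix with diagonal entries $\pm1$; - *block transpose:* $A\mapsto A'$, where for some block $H$ of $G$ we have $A'_{i,j}=A_{j,i}$ for all $i,j\in V(H)$, and $A'_{i,j}=A_{i,j}$ otherwise. -/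

import Mathlib

/-- Magnitude-symmetric real matrices: `|K i j| = |K j i|` for all `i, j`. -/
def IsMagnitudeSymmetric {N : ℕ} (K : Matrix (Fin N) (Fin N) ℝ) : Prop :=
  ∀ i j, |K i j| = |K j i|

/-- The genericity (no-cancellation) condition on the four-cycles of a matrix. -/
def IsGeneric {N : ℕ} (K : Matrix (Fin N) (Fin N) ℝ) : Prop :=
  ∀ i j k l : Fin N, i ≠ j → i ≠ k → i ≠ l → j ≠ k → j ≠ l → k ≠ l →
    K i j * K j k * K k l * K l i ≠ 0 →
      |K i j * K k l| ≠ |K j k * K l i| ∧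
      ∀ φ₁ φ₂ φ₃ : ℝ, (φ₁ = -1 ∨ φ₁ = 1) → (φ₂ = -1 ∨ φ₂ = 1) → (φ₃ = -1 ∨ φ₃ = 1) →
        φ₁ * (K i j * K j k * K k l * K l i) + φ₂ * (K i j * K j l * K l k * K k i) +
          φ₃ * (K i k * K k j * K j l * K l i) ≠ 0

/-- The class `𝒦_N` of generic magnitude-symmetric `N × N` real matrices. -/
def genericClass (N : ℕ) : Set (Matrix (Fin N) (Fin N) ℝ) :=
  {K | IsMagnitudeSymmetric K ∧ IsGeneric K}

/-- The principal minor `Δ_S(K) = det (K i j)_{i, j ∈ S}`; it equals `1` for `S = ∅`. -/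
def principalMinor {N : ℕ} (K : Matrix (Fin N) (Fin N) ℝ) (S : Finset (Fin N)) : ℝ :=
  (K.submatrix (fun i : S => (i : Fin N)) (fun j : S => (j : Fin N))).det

/-- The sparsity graph of a matrix: `i ≠ j` are adjacent when `K i j ≠ 0` or `K j i ≠ 0`
(the two are equivalent for magnitude-symmetric matrices). -/
def sparsityGraph {N : ℕ} (K : Matrix (Fin N) (Fin N) ℝ) : SimpleGraph (Fin N) :=
  SimpleGraph.fromRel fun i j => K i j ≠ 0

theorem sparsityGraph_adj {N : ℕ} {K : Matrix (Fin N) (Fin N) ℝ}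
    (hK : IsMagnitudeSymmetric K) (i j : Fin N) :
    (sparsityGraph K).Adj i j ↔ i ≠ j ∧ |K i j| ≠ 0 := by
  have h := hK i j
  simp only [sparsityGraph, SimpleGraph.fromRel_adj]
  rw [← abs_ne_zero (a := K j i), ← h, abs_ne_zero, or_self]

/-- A subgraph is two-connected if it is connected, has at least two vertices, and has no
articulation point, i.e. removing any one of its vertices leaves it connected. -/
def IsTwoConnected {V : Type*} {G : SimpleGraph V} (H : G.Subgraph) : Prop :=
  H.Connected ∧ H.verts.Nontrivial ∧ ∀ v ∈ H.verts, (H.deleteVerts {v}).Connected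

/-- A block of `G` is a maximal two-connected subgraph of `G`. -/
def IsBlock {V : Type*} {G : SimpleGraph V} (H : G.Subgraph) : Prop :=
  Maximal IsTwoConnected H

/-- `A` with the submatrix on the index set `U` transposed: the result has entries `A j i` for
`i, j ∈ U`, and `A i j` otherwise. -/
noncomputable def transposeOn {N : ℕ} (U : Set (Fin N)) (A : Matrix (Fin N) (Fin N) ℝ) :
    Matrix (Fin N) (Fin N) ℝ :=
  open Classical in Matrix.of fun i j => if i ∈ U ∧ j ∈ U then A j i else A i j

/-- One operation: `A → D A D` for a diagonal matrix `D` with diagonal entries `1` or `-1`. -/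
def SignSimilarityStep {N : ℕ} (A B : Matrix (Fin N) (Fin N) ℝ) : Prop :=
  ∃ d : Fin N → ℝ, (∀ i, d i = 1 ∨ d i = -1) ∧ B = Matrix.diagonal d * A * Matrix.diagonal d

/-- One operation: transpose the submatrix of `A` on the vertex set of a block of `G`. -/
def BlockTransposeStep {N : ℕ} (G : SimpleGraph (Fin N)) (A B : Matrix (Fin N) (Fin N) ℝ) :
    Prop :=
  ∃ H : G.Subgraph, IsBlock H ∧ B = transposeOn H.verts A

/-- The set generated by `K`: all matrices obtained from `K` by finitely many (possibly zero)
sign similarities and block transposes with respect to the blocks of the sparsity graph of `K`. -/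
def generatedSet {N : ℕ} (K : Matrix (Fin N) (Fin N) ℝ) : Set (Matrix (Fin N) (Fin N) ℝ) :=
  {K' | Relation.ReflTransGen
    (fun A B => SignSimilarityStep A B ∨ BlockTransposeStep (sparsityGraph K) A B) K K'}

/-! The minors of sizes one and two determine the diagonal and the products `K i j * K j i`. So a
`K'` with the minors of `K` is `K` multiplied entrywise by a symmetric sign pattern `s`. Let `ε i j`
be the sign relating `K j i` to `K i j`, and call the product of `ε` along a path its charge. A sign
similarity multiplies `s` by a coboundary, and transposing a block multiplies `s` by `ε` inside that
block. Hence everything depends on the products of `s` around cycles of the sparsity graph.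

The heart is that `s` multiplies to 1 around every cycle of charge 1 (`IsCyc.pathProd_eq_one`). In a
shortest counterexample, restrict to the vertices of the cycle and normalise it to `0, …, n - 1`
with `ε = 1` along it and `s = 1` except on the closing edge. Minimality forces `ε = -1` on every
chord and links the signs of any two chords. In particular two chords can cross only if they form a
four-cycle with two edges of the cycle. An uncrossed chord, or such a crossing pair, cuts the matrix
into two sides, and up to transposition and sign conjugation the change `s` transposes one side with
a twist of signs. By Schur complements, deleting the chords multiplies the difference of the two
determinants by a factor that is nonzero by genericity of four-cycles. Without chords the difference
is, up to sign, four times the product of the entries around the cycle. So the two determinants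
differ (`HasCriticalCycle.det_ne`), against the equality of minors.

If every cycle has `s`-product 1, then `s` is a coboundary and one sign similarity suffices.
Otherwise some cycle has both `s`-product and charge -1. On its block, `s * ε` is trivial on that
cycle and on all cycles of charge 1; growing the cycle by ears, while keeping flat paths of both
charges between any two vertices, makes `s * ε` a coboundary on the block
(`exists_potential_of_twoConnectedIn`). Transposing the block repairs all its cycles and leaves the
others alone, so iteration ends in the first case.

Conversely, block transposes preserve minors because in the Leibniz expansion each orbit using an
edge of a block stays in that block and can be inverted (`det_eq_of_transposed_within`). -/

/-- The product of `F` over the consecutive pairs of a list. -/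
def pathProd {V M : Type*} [Monoid M] (F : V → V → M) : List V → M
  | [] => 1
  | [_] => 1
  | x :: y :: l => F x y * pathProd F (y :: l)

/-! ### Products along lists of vertices. -/

section pathProd

variable {V W M : Type*} [CommMonoid M]

@[simp] theorem pathProd_nil (F : V → V → M) : pathProd F [] = 1 := rfl

@[simp] theorem pathProd_singleton (F : V → V → M) (x : V) : pathProd F [x] = 1 := rfl

@[simp] theorem pathProd_cons_cons (F : V → V → M) (x y : V) (l : List V) :
    pathProd F (x :: y :: l) = F x y * pathProd F (y :: l) := rfl

theorem pathProd_append_cons (F : V → V → M) (l : List V) (x : V) (r : List V) :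
    pathProd F (l ++ x :: r) = pathProd F (l ++ [x]) * pathProd F (x :: r) := by
  induction l with
  | nil => simp
  | cons a l ih =>
    cases l with
    | nil => simp
    | cons b l => simpa [mul_assoc] using congrArg (F a b * ·) ih

theorem pathProd_append_cons_cons (F : V → V → M) (l : List V) (x y : V) (r : List V) :
    pathProd F (l ++ x :: y :: r) = pathProd F (l ++ [x]) * F x y * pathProd F (y :: r) := by
  rw [pathProd_append_cons, pathProd_cons_cons, mul_assoc]

theorem pathProd_reverse {F : V → V → M} (hF : ∀ x y, F x y = F y x) (l : List V) :
    pathProd F l.reverse = pathProd F l := by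
  induction l with
  | nil => rfl
  | cons a l ih =>
    cases l with
    | nil => rfl
    | cons b l =>
      rw [List.reverse_cons, List.reverse_cons, List.append_assoc, List.singleton_append,
        pathProd_append_cons, ← List.reverse_cons, ih]
      simp [hF b a, mul_comm]

theorem pathProd_map (F : W → W → M) (f : V → W) (l : List V) :
    pathProd F (l.map f) = pathProd (fun x y => F (f x) (f y)) l := by
  induction l with
  | nil => rfl
  | cons a l ih =>
    cases l with
    | nil => rfl
    | cons b l => simpa using congrArg _ ih

theorem pathProd_mul (F G : V → V → M) (l : List V) :
    pathProd (fun x y => F x y * G x y) l = pathProd F l * pathProd G l := by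
  induction l with
  | nil => simp
  | cons a l ih =>
    cases l with
    | nil => simp
    | cons b l => simp [ih, mul_mul_mul_comm]

theorem pathProd_congr {F G : V → V → M} {l : List V}
    (h : l.IsChain fun x y => F x y = G x y) : pathProd F l = pathProd G l := by
  induction l with
  | nil => rfl
  | cons a l ih =>
    cases l with
    | nil => rfl
    | cons b l =>
      rw [List.isChain_cons_cons] at h
      rw [pathProd_cons_cons, pathProd_cons_cons, h.1, ih h.2]

theorem pathProd_eq_one {F : V → V → M} {l : List V}
    (h : l.IsChain fun x y => F x y = 1) : pathProd F l = 1 := by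
  induction l with
  | nil => rfl
  | cons a l ih =>
    cases l with
    | nil => rfl
    | cons b l =>
      rw [List.isChain_cons_cons] at h
      rw [pathProd_cons_cons, h.1, ih h.2, one_mul]

/-- The product telescopes, each inner vertex contributing the square of a sign. -/
theorem pathProd_coboundary {F : V → V → ℤˣ} {h : V → ℤˣ} (x : V) (l : List V) (y : V)
    (hl : (x :: (l ++ [y])).IsChain fun a b => F a b = h a * h b) :
    pathProd F (x :: (l ++ [y])) = h x * h y := by
  induction l generalizing x with
  | nil => simpa using hl
  | cons a l ih =>
    rw [List.cons_append, List.isChain_cons_cons] at hl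
    rw [List.cons_append, pathProd_cons_cons, hl.1, ih a hl.2, mul_assoc, ← mul_assoc (h a),
      Int.units_mul_self, one_mul]

end pathProd

/-- `x :: t` is a simple cycle, of length at least three, for the relation `R`. -/
def IsCyc {V : Type*} (R : V → V → Prop) (x : V) (t : List V) : Prop :=
  (x :: t).Nodup ∧ 2 ≤ t.length ∧ (x :: (t ++ [x])).IsChain R

/-! ### Determinants of matrices separated by a small core. -/

section Separation

open Matrix

variable {κ X Y : Type*} [Fintype κ] [Fintype X] [Fintype Y] [DecidableEq κ] [DecidableEq X]
  [DecidableEq Y]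

/-- A matrix for which the index sets `X` and `Y` only interact through the core `κ`. -/
def sepMatrix (Z : Matrix κ κ ℝ) (U : Matrix κ X ℝ) (U' : Matrix X κ ℝ) (A : Matrix X X ℝ)
    (V : Matrix κ Y ℝ) (V' : Matrix Y κ ℝ) (D : Matrix Y Y ℝ) :
    Matrix (κ ⊕ (X ⊕ Y)) (κ ⊕ (X ⊕ Y)) ℝ :=
  fromBlocks Z (fromCols U V) (fromRows U' V') (fromBlocks A 0 0 D)

/-- Schur complement onto the core. Since the remaining block is block diagonal, each side
contributes its own summand, which allows one side to be altered independently of the other. -/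
theorem det_sepMatrix (Z : Matrix κ κ ℝ) (U : Matrix κ X ℝ) (U' : Matrix X κ ℝ) (A : Matrix X X ℝ)
    (V : Matrix κ Y ℝ) (V' : Matrix Y κ ℝ) (D : Matrix Y Y ℝ) (hA : A.det ≠ 0) (hD : D.det ≠ 0) :
    (sepMatrix Z U U' A V V' D).det =
      A.det * D.det * (Z - (U * A⁻¹ * U' + V * D⁻¹ * V')).det := by
  have hA' := isUnit_iff_ne_zero.2 hA
  have hD' := isUnit_iff_ne_zero.2 hD
  let E : Matrix (X ⊕ Y) (X ⊕ Y) ℝ := fromBlocks A 0 0 D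
  have hE : E.det = A.det * D.det := det_fromBlocks_zero₂₁ A 0 D
  have hinv : E⁻¹ = fromBlocks A⁻¹ 0 0 D⁻¹ := by
    apply Matrix.inv_eq_left_inv
    simp [E, fromBlocks_multiply, nonsing_inv_mul _ hA', nonsing_inv_mul _ hD']
  have : Invertible E := E.invertibleOfIsUnitDet (by rw [hE]; exact hA'.mul hD')
  rw [sepMatrix, det_fromBlocks₂₂, hE, invOf_eq_nonsing_inv, hinv, fromCols_mul_fromBlocks,
    fromCols_mul_fromRows]
  simp

theorem finite_det_add_smul_one_eq_zero (A : Matrix X X ℝ) :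
    {x : ℝ | (A + x • (1 : Matrix X X ℝ)).det = 0}.Finite := by
  refine ((-A).charpoly.roots.toFinset.finite_toSet).subset fun x hx => ?_
  have h0 : (-A).charpoly ≠ 0 := (Matrix.charpoly_monic _).ne_zero
  have : (-A).charpoly.eval x = 0 := by
    rw [Matrix.eval_charpoly, sub_neg_eq_add, add_comm, scalar_apply, ← smul_one_eq_diagonal]
    exact hx
  simpa [h0] using this

theorem dense_det_add_smul_one (A : Matrix X X ℝ) (D : Matrix Y Y ℝ) :
    Dense {x : ℝ | (A + x • (1 : Matrix X X ℝ)).det ≠ 0 ∧ (D + x • (1 : Matrix Y Y ℝ)).det ≠ 0} := by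
  convert (((finite_det_add_smul_one_eq_zero A).union
    (finite_det_add_smul_one_eq_zero D)).countable).dense_compl ℝ using 1
  ext x
  simp

/-- A linear relation between core determinants extends to the whole matrices. -/
theorem det_sepMatrix_relation (c₁ c₂ : ℝ) (Z₁ Z₁' Z₂ Z₂' : Matrix κ κ ℝ) (U : Matrix κ X ℝ)
    (U' : Matrix X κ ℝ) (A : Matrix X X ℝ) (V W : Matrix κ Y ℝ) (V' W' : Matrix Y κ ℝ)
    (D : Matrix Y Y ℝ)
    (h : ∀ (A' : Matrix X X ℝ) (D' : Matrix Y Y ℝ),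
      let P := U * A'⁻¹ * U'
      let Q := V * D'⁻¹ * V'
      let Q' := W * D'ᵀ⁻¹ * W'
      c₁ * ((Z₁ - (P + Q)).det - (Z₁' - (P + Q')).det) =
        c₂ * ((Z₂ - (P + Q)).det - (Z₂' - (P + Q')).det)) :
    c₁ * ((sepMatrix Z₁ U U' A V V' D).det - (sepMatrix Z₁' U U' A W W' Dᵀ).det) =
      c₂ * ((sepMatrix Z₂ U U' A V V' D).det - (sepMatrix Z₂' U U' A W W' Dᵀ).det) := by
  let Ax : ℝ → Matrix X X ℝ := fun x => A + x • 1
  let Dx : ℝ → Matrix Y Y ℝ := fun x => D + x • 1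
  let F : Matrix κ κ ℝ → Matrix κ κ ℝ → ℝ → ℝ := fun Z Z' x =>
    (sepMatrix Z U U' (Ax x) V V' (Dx x)).det - (sepMatrix Z' U U' (Ax x) W W' (Dx x)ᵀ).det
  have hcont : ∀ Z Z', Continuous (F Z Z') := by
    intro Z Z'
    have hAx : Continuous Ax := by fun_prop
    have hDx : Continuous Dx := by fun_prop
    have hS : ∀ (Z : Matrix κ κ ℝ) (V : Matrix κ Y ℝ) (V' : Matrix Y κ ℝ)
        (E : ℝ → Matrix Y Y ℝ), Continuous E →
        Continuous fun x => (sepMatrix Z U U' (Ax x) V V' (E x)).det := by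
      intro Z V V' E hE
      refine Continuous.matrix_det ?_
      unfold sepMatrix
      exact Continuous.matrix_fromBlocks continuous_const continuous_const continuous_const
        (Continuous.matrix_fromBlocks hAx continuous_const continuous_const hE)
    exact (hS Z V V' Dx hDx).sub (hS Z' W W' _ hDx.matrix_transpose)
  -- `A` and `D` may be singular. Shifting both by `x` makes them invertible off a finite set, and
  -- continuity carries the identity to `x = 0`.
  have heq : (fun x => c₁ * F Z₁ Z₁' x) = fun x => c₂ * F Z₂ Z₂' x := by
    refine Continuous.ext_on (dense_det_add_smul_one A D) (by fun_prop) (by fun_prop) ?_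
    rintro x ⟨hA, hD⟩
    have hDt : (Dx x)ᵀ.det ≠ 0 := by rwa [det_transpose]
    have := h (Ax x) (Dx x)
    simp only [F]
    rw [det_sepMatrix _ _ _ _ _ _ _ hA hD, det_sepMatrix _ _ _ _ _ _ _ hA hD,
      det_sepMatrix _ _ _ _ _ _ _ hA hDt, det_sepMatrix _ _ _ _ _ _ _ hA hDt, det_transpose]
    linear_combination (Ax x).det * (Dx x).det * this
  have := congrFun heq 0
  simpa [F, Ax, Dx] using this

/-- Transposing a side and twisting its attachment to the core by `σ` has the effect on the core of
transposing its Schur summand and conjugating it by `σ`. -/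
theorem twisted_schur_apply (σ : κ → ℝ) (V : Matrix κ Y ℝ) (V' : Matrix Y κ ℝ) (D : Matrix Y Y ℝ)
    (i j : κ) :
    ((Matrix.of fun i y => σ i * V' y i) * Dᵀ⁻¹ * (Matrix.of fun y i => σ i * V i y)) i j =
      σ i * σ j * (V * D⁻¹ * V') j i := by
  have h1 : (Matrix.of fun i y => σ i * V' y i) = diagonal σ * V'ᵀ := by
    ext i y; simp [diagonal_mul]
  have h2 : (Matrix.of fun y i => σ i * V i y) = Vᵀ * diagonal σ := by
    ext i y; simp [mul_diagonal, mul_comm]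
  rw [h1, h2, ← Matrix.transpose_nonsing_inv]
  have : diagonal σ * V'ᵀ * D⁻¹ᵀ * (Vᵀ * diagonal σ) =
      diagonal σ * (V * D⁻¹ * V')ᵀ * diagonal σ := by
    simp only [Matrix.transpose_mul, Matrix.mul_assoc]
  rw [this, mul_diagonal, diagonal_mul, transpose_apply]
  ring

/-- Twisted transposition across a two-vertex separation: the change of the determinant does not
depend on the antisymmetric entry joining the two vertices. -/
theorem det_sepMatrix_two (z₁ z₂ t : ℝ) (U : Matrix (Fin 2) X ℝ)
    (U' : Matrix X (Fin 2) ℝ) (A : Matrix X X ℝ) (V : Matrix (Fin 2) Y ℝ) (V' : Matrix Y (Fin 2) ℝ)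
    (D : Matrix Y Y ℝ) (σ : Fin 2 → ℝ) (hσ : σ = ![-1, 1]) :
    (sepMatrix !![z₁, t; -t, z₂] U U' A V V' D).det -
      (sepMatrix !![z₁, t; -t, z₂] U U' A (Matrix.of fun i y => σ i * V' y i)
        (Matrix.of fun y i => σ i * V i y) Dᵀ).det =
    (sepMatrix !![z₁, 0; 0, z₂] U U' A V V' D).det -
      (sepMatrix !![z₁, 0; 0, z₂] U U' A (Matrix.of fun i y => σ i * V' y i)
        (Matrix.of fun y i => σ i * V i y) Dᵀ).det := by
  have := det_sepMatrix_relation 1 1 !![z₁, t; -t, z₂] !![z₁, t; -t, z₂] !![z₁, 0; 0, z₂]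
    !![z₁, 0; 0, z₂] U U' A V (Matrix.of fun i y => σ i * V' y i) V'
    (Matrix.of fun y i => σ i * V i y) D ?_
  · simpa using this
  · intro A' D' P Q Q'
    have hQ : ∀ i j, Q' i j = σ i * σ j * Q j i := twisted_schur_apply σ V V' D'
    -- Besides `t ^ 2`, the entry `t` occurs only multiplied by the difference of the off-diagonal
    -- entries of `P + Q`. The twist replaces `Q 0 1` by `-Q 1 0` and `Q 1 0` by `-Q 0 1`, which
    -- preserves this difference.
    simp only [det_fin_two, Matrix.sub_apply, Matrix.add_apply, hQ, hσ]
    simp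
    ring

/-- Twisted transposition across a separation by a four-cycle. -/
theorem det_sepMatrix_four (a₁₁ a₁₂ a₂₁ a₂₂ d₁₁ d₁₂ d₂₁ d₂₂ p q t u : ℝ) (U : Matrix (Fin 4) X ℝ)
    (U' : Matrix X (Fin 4) ℝ) (A : Matrix X X ℝ) (V : Matrix (Fin 4) Y ℝ) (V' : Matrix Y (Fin 4) ℝ)
    (D : Matrix Y Y ℝ) (hU : ∀ x, U 2 x = 0 ∧ U 3 x = 0 ∧ U' x 2 = 0 ∧ U' x 3 = 0)
    (hV : ∀ y, V 0 y = 0 ∧ V 1 y = 0 ∧ V' y 0 = 0 ∧ V' y 1 = 0)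
    (σ : Fin 4 → ℝ) (hσ : σ = ![1, 1, -1, 1]) :
    p * q * ((sepMatrix !![a₁₁, a₁₂, p, u; a₂₁, a₂₂, t, q; p, -t, d₁₁, d₁₂; -u, q, d₂₁, d₂₂]
        U U' A V V' D).det -
      (sepMatrix !![a₁₁, a₁₂, p, u; a₂₁, a₂₂, t, q; p, -t, d₁₁, -d₂₁; -u, q, -d₁₂, d₂₂]
        U U' A (Matrix.of fun i y => σ i * V' y i) (Matrix.of fun y i => σ i * V i y) Dᵀ).det) =
    (p * q - t * u) *
      ((sepMatrix !![a₁₁, a₁₂, p, 0; a₂₁, a₂₂, 0, q; p, 0, d₁₁, d₁₂; 0, q, d₂₁, d₂₂]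
        U U' A V V' D).det -
      (sepMatrix !![a₁₁, a₁₂, p, 0; a₂₁, a₂₂, 0, q; p, 0, d₁₁, -d₂₁; 0, q, -d₁₂, d₂₂]
        U U' A (Matrix.of fun i y => σ i * V' y i) (Matrix.of fun y i => σ i * V i y) Dᵀ).det) := by
  apply det_sepMatrix_relation
  intro A' D' P Q Q'
  have hQ : ∀ i j, Q' i j = σ i * σ j * Q j i := twisted_schur_apply σ V V' D'
  have hP1 : ∀ i j, (i = 2 ∨ i = 3) → P i j = 0 := by
    intro i j hi
    have : ∀ x, U i x = 0 := by rcases hi with rfl | rfl <;> simp [hU]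
    simp [P, Matrix.mul_assoc, Matrix.mul_apply, this]
  have hP2 : ∀ i j, (j = 2 ∨ j = 3) → P i j = 0 := by
    intro i j hi
    have : ∀ x, U' x j = 0 := by rcases hi with rfl | rfl <;> simp [hU]
    simp [P, Matrix.mul_apply, this]
  have hQ1 : ∀ i j, (i = 0 ∨ i = 1) → Q i j = 0 := by
    intro i j hi
    have : ∀ x, V i x = 0 := by rcases hi with rfl | rfl <;> simp [hV]
    simp [Q, Matrix.mul_assoc, Matrix.mul_apply, this]
  have hQ2 : ∀ i j, (j = 0 ∨ j = 1) → Q i j = 0 := by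
    intro i j hi
    have : ∀ x, V' x j = 0 := by rcases hi with rfl | rfl <;> simp [hV]
    simp [Q, Matrix.mul_apply, this]
  have eP : P = !![P 0 0, P 0 1, 0, 0; P 1 0, P 1 1, 0, 0; 0, 0, 0, 0; 0, 0, 0, 0] := by
    ext i j; fin_cases i <;> fin_cases j <;> simp [hP1, hP2]
  have eQ : Q = !![0, 0, 0, 0; 0, 0, 0, 0; 0, 0, Q 2 2, Q 2 3; 0, 0, Q 3 2, Q 3 3] := by
    ext i j; fin_cases i <;> fin_cases j <;> simp [hQ1, hQ2]
  have eQ' : Q' = !![0, 0, 0, 0; 0, 0, 0, 0; 0, 0, Q 2 2, -Q 3 2; 0, 0, -Q 2 3, Q 3 3] := by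
    ext i j; fin_cases i <;> fin_cases j <;> simp [hQ, hσ, hQ1, hQ2]
  rw [eP, eQ, eQ']
  generalize P 0 0 = p1, P 0 1 = p2, P 1 0 = p3, P 1 1 = p4, Q 2 2 = q1, Q 2 3 = q2,
    Q 3 2 = q3, Q 3 3 = q4
  -- Let `α` and `δ` be the diagonal 2×2 blocks of the reduced core. The twist fixes `δ₁₂ - δ₂₁` and
  -- negates `δ₁₂ + δ₂₁`, and the change of the determinant is `-(p * q - t * u) * (α₁₂ + α₂₁) *
  -- (δ₁₂ + δ₂₁)`. Setting `t = u = 0` only alters the first factor.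
  simp [det_succ_row_zero, Fin.sum_univ_succ, Fin.succAbove]
  ring

end Separation

/-! ### The chordless case: a symmetric matrix supported on a cycle. -/

section CyclicTridiagonal

open Matrix

/-- Multilinearity in the rows `a` and `b`. What matters is that only the cofactor term is odd in
`y`. -/
theorem det_updateRow_corners {ι : Type*} [Fintype ι] [DecidableEq ι] (N : Matrix ι ι ℝ) {a b : ι}
    (hab : a ≠ b) (y : ℝ) :
    ((N.updateRow a (N a + y • Pi.single b 1)).updateRow b (N b + y • Pi.single a 1)).det =
      N.det + y * (N.adjugate b a + N.adjugate a b) +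
        y ^ 2 * ((N.updateRow a (Pi.single b 1)).updateRow b (Pi.single a 1)).det := by
  have h : (N.updateRow b (Pi.single a 1)).updateRow a (N a) = N.updateRow b (Pi.single a 1) := by
    conv_rhs => rw [← updateRow_eq_self (N.updateRow b (Pi.single a 1)) a]
    rw [updateRow_ne hab]
  have h' : (N.updateRow a (N a + y • Pi.single b 1)).updateRow b (N b) =
      N.updateRow a (N a + y • Pi.single b 1) := by
    conv_rhs => rw [← updateRow_eq_self (N.updateRow a (N a + y • Pi.single b 1)) b]
    rw [updateRow_ne hab.symm]
  rw [det_updateRow_add, det_updateRow_smul, h', det_updateRow_add, det_updateRow_smul,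
    updateRow_eq_self, updateRow_comm _ hab, det_updateRow_add, det_updateRow_smul, h,
    updateRow_comm _ hab (Pi.single b 1), adjugate_apply, adjugate_apply]
  ring

/-- Removing row `0` and the last column leaves an upper triangular matrix whose diagonal is the
subdiagonal of `N`. -/
theorem adjugate_last_zero_of_tridiagonal {m : ℕ} (N : Matrix (Fin (m + 1)) (Fin (m + 1)) ℝ)
    (hN : ∀ i j : Fin (m + 1), (j : ℕ) + 1 < i → N i j = 0) :
    N.adjugate (Fin.last m) 0 = (-1) ^ m * ∏ i : Fin m, N i.succ i.castSucc := by
  rw [adjugate_fin_succ_eq_det_submatrix, det_of_isUpperTriangular]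
  · simp
  · intro i j hij
    simp only [submatrix_apply, Fin.succAbove_zero, Fin.succAbove_last]
    apply hN
    simpa using hij

/-- Changing the sign of one edge of a Hamiltonian cycle changes the determinant of a symmetric
matrix supported on this cycle. -/
theorem det_ne_of_cyclic_tridiagonal {m : ℕ} (hm : 2 ≤ m)
    (M M' : Matrix (Fin (m + 1)) (Fin (m + 1)) ℝ) (hsymm : ∀ i j, M i j = M j i)
    (hzero : ∀ i j : Fin (m + 1), (j : ℕ) + 1 < i → ¬((j : ℕ) = 0 ∧ (i : ℕ) = m) → M i j = 0)
    (hne : ∀ i : Fin m, M i.succ i.castSucc ≠ 0) (hcorner : M (Fin.last m) 0 ≠ 0)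
    (h1 : M' 0 (Fin.last m) = -M 0 (Fin.last m)) (h2 : M' (Fin.last m) 0 = -M (Fin.last m) 0)
    (h3 : ∀ i j, ¬(i = 0 ∧ j = Fin.last m) → ¬(i = Fin.last m ∧ j = 0) → M' i j = M i j) :
    M.det ≠ M'.det := by
  have h0l : (0 : Fin (m + 1)) ≠ Fin.last m := by
    intro h
    have := congrArg Fin.val h
    simp at this
    omega
  -- `N` is `M` without its two corner entries; `M` and `M'` arise from it by inserting `y` and `-y`
  -- there.
  let N : Matrix (Fin (m + 1)) (Fin (m + 1)) ℝ := Matrix.of fun i j =>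
    if (i = 0 ∧ j = Fin.last m) ∨ (i = Fin.last m ∧ j = 0) then 0 else M i j
  have hform : ∀ (y : ℝ) (P : Matrix (Fin (m + 1)) (Fin (m + 1)) ℝ),
      P 0 (Fin.last m) = y → P (Fin.last m) 0 = y →
      (∀ i j, ¬(i = 0 ∧ j = Fin.last m) → ¬(i = Fin.last m ∧ j = 0) → P i j = M i j) →
      P = (N.updateRow 0 (N 0 + y • Pi.single (Fin.last m) 1)).updateRow (Fin.last m)
        (N (Fin.last m) + y • Pi.single 0 1) := by
    intro y P hP1 hP2 hP3
    ext i j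
    by_cases hi : i = Fin.last m
    · subst hi
      rw [updateRow_self]
      by_cases hj : j = 0
      · subst hj; simp [N, hP2]
      · simp [N, hj, h0l.symm, hP3]
    · rw [updateRow_ne hi]
      by_cases hi0 : i = 0
      · subst hi0
        rw [updateRow_self]
        by_cases hj : j = Fin.last m
        · subst hj; simp [N, hP1]
        · simp [N, hj, h0l, hP3]
      · rw [updateRow_ne hi0]
        simp [N, hi, hi0, hP3]
  have hsN : ∀ i j, N i j = N j i := by
    intro i j
    simp only [N, of_apply, hsymm i j]
    congr 1
    simp only [eq_iff_iff]
    tauto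
  have hadj : N.adjugate 0 (Fin.last m) = N.adjugate (Fin.last m) 0 := by
    have hT : Nᵀ = N := by ext i j; exact hsN j i
    rw [← transpose_apply N.adjugate, adjugate_transpose, hT]
  have hval : N.adjugate (Fin.last m) 0 ≠ 0 := by
    rw [adjugate_last_zero_of_tridiagonal]
    · refine mul_ne_zero (by simp) (Finset.prod_ne_zero_iff.2 fun i _ => ?_)
      have h4 : ¬(i.succ = Fin.last m ∧ i.castSucc = 0) := by
        rintro ⟨h5, h6⟩
        have h5 := congrArg Fin.val h5
        have h6 := congrArg Fin.val h6
        simp at h5 h6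
        omega
      have h7 : i.succ ≠ 0 := Fin.succ_ne_zero i
      simp only [N, of_apply]
      rw [if_neg (by tauto)]
      exact hne i
    · intro i j hij
      simp only [N, of_apply]
      split_ifs with h
      · rfl
      · apply hzero i j hij
        rintro ⟨h5, h6⟩
        exact h (Or.inr ⟨Fin.ext (by simpa using h6), Fin.ext (by simpa using h5)⟩)
  have e1 := hform (M (Fin.last m) 0) M (hsymm _ _) rfl (fun _ _ _ _ => rfl)
  have e2 := hform (-M (Fin.last m) 0) M' (by rw [h1, hsymm]) h2 h3
  intro heq
  rw [e1, e2, det_updateRow_corners _ h0l, det_updateRow_corners _ h0l, hadj] at heq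
  generalize M (Fin.last m) 0 = y at *
  -- The terms even in `y` cancel, and by symmetry the two cofactors agree, whence the factor 4.
  have : y * N.adjugate (Fin.last m) 0 = 0 := by linear_combination heq / 4
  exact (mul_ne_zero hcorner hval) this

end CyclicTridiagonal

/-! ### Paths of charge 1 with a prescribed sign. -/

section Segments

variable {V M : Type*} [CommMonoid M]

theorem pathProd_append (F : V → V → M) {l₁ l₂ : List V} {a b : V} (h₁ : l₁.getLast? = some a)
    (h₂ : l₂.head? = some b) :
    pathProd F (l₁ ++ l₂) = pathProd F l₁ * F a b * pathProd F l₂ := by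
  obtain ⟨l, rfl⟩ := List.getLast?_eq_some_iff.1 h₁
  obtain ⟨r, rfl⟩ := List.head?_eq_some_iff.1 h₂
  rw [List.append_assoc, List.singleton_append, pathProd_append_cons_cons]

/-- A path for `R` from `a` to `b` along which `ε` multiplies to `1` and `s` multiplies to `σ`. -/
structure IsSegment (R : V → V → Prop) (ε s : V → V → ℤˣ) (l : List V) (a b : V) (σ : ℤˣ) :
    Prop where
  head : l.head? = some a
  last : l.getLast? = some b
  chain : l.IsChain R
  eps : pathProd ε l = 1
  sgn : pathProd s l = σ

variable {R : V → V → Prop} {ε s : V → V → ℤˣ}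

theorem IsSegment.reverse {l : List V} {a b : V} {σ : ℤˣ} (h : IsSegment R ε s l a b σ)
    (hR : ∀ x y, R x y → R y x) (hε : ∀ x y, ε x y = ε y x) (hs : ∀ x y, s x y = s y x) :
    IsSegment R ε s l.reverse b a σ where
  head := by rw [List.head?_reverse, h.last]
  last := by rw [List.getLast?_reverse, h.head]
  chain := by
    rw [List.isChain_reverse]
    exact h.chain.imp fun x y hxy => hR x y hxy
  eps := by rw [pathProd_reverse hε, h.eps]
  sgn := by rw [pathProd_reverse hs, h.sgn]

theorem IsSegment.append {l₁ l₂ : List V} {a b c d : V} {σ₁ σ₂ : ℤˣ}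
    (h₁ : IsSegment R ε s l₁ a b σ₁) (h₂ : IsSegment R ε s l₂ c d σ₂) (hR : R b c)
    (hε : ε b c = 1) : IsSegment R ε s (l₁ ++ l₂) a d (σ₁ * s b c * σ₂) where
  head := by simp [h₁.head]
  last := by simp [h₂.last]
  chain := by
    rw [List.isChain_append]
    refine ⟨h₁.chain, h₂.chain, ?_⟩
    simp [h₁.last, h₂.head, hR]
  eps := by rw [pathProd_append ε h₁.last h₂.head, h₁.eps, h₂.eps, hε]; rfl
  sgn := by rw [pathProd_append s h₁.last h₂.head, h₁.sgn, h₂.sgn]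

end Segments

/-! ### Critical cycles and the signs of their chords. -/

/-- The matrix `K` has the Hamiltonian cycle `0, 1, …, n - 1` with trivial charges `ε`, on which
the sign change `s` is nontrivial, while `s` is trivial on all shorter cycles of trivial charge. -/
structure HasCriticalCycle (n : ℕ) (K : ℕ → ℕ → ℝ) (ε s : ℕ → ℕ → ℤˣ) : Prop where
  three_le : 3 ≤ n
  eps_symm : ∀ i j, ε i j = ε j i
  sgn_symm : ∀ i j, s i j = s j i
  eps_diag : ∀ i, ε i i = 1
  sgn_diag : ∀ i, s i i = 1
  mag : ∀ i j, i < n → j < n → K j i = ((ε i j : ℤ) : ℝ) * K i j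
  edge : ∀ i, i + 1 < n → K i (i + 1) ≠ 0 ∧ ε i (i + 1) = 1 ∧ s i (i + 1) = 1
  last : K (n - 1) 0 ≠ 0 ∧ ε (n - 1) 0 = 1 ∧ s (n - 1) 0 = -1
  cyc : ∀ x t, IsCyc (fun a b => a < n ∧ b < n ∧ K a b ≠ 0) x t → t.length + 1 < n →
    pathProd ε (x :: (t ++ [x])) = 1 → pathProd s (x :: (t ++ [x])) = 1
  generic : ∀ i j k l, i < n → j < n → k < n → l < n → i ≠ j → i ≠ k → i ≠ l → j ≠ k → j ≠ l →
    k ≠ l → K i j * K j k * K k l * K l i ≠ 0 → |K i j * K k l| ≠ |K j k * K l i|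

/-- The pair `i < j` is a chord of the Hamiltonian cycle `0, 1, …, n - 1` with `K i j ≠ 0`. -/
structure IsChord (n : ℕ) (K : ℕ → ℕ → ℝ) (i j : ℕ) : Prop where
  lt : i + 2 ≤ j
  lt_n : j < n
  ne_last : ¬(i = 0 ∧ j = n - 1)
  ne_zero : K i j ≠ 0

/-- The list `i, i + 1, …, j`. -/
def arc (i j : ℕ) : List ℕ := List.range' i (j + 1 - i)

theorem mem_arc {i j x : ℕ} : x ∈ arc i j ↔ i ≤ x ∧ x ≤ j := by
  rw [arc, List.mem_range'_1]; omega

@[simp] theorem length_arc (i j : ℕ) : (arc i j).length = j + 1 - i := by simp [arc]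

theorem nodup_arc (i j : ℕ) : (arc i j).Nodup := List.nodup_range'

namespace HasCriticalCycle

variable {n : ℕ} {K : ℕ → ℕ → ℝ} {ε s : ℕ → ℕ → ℤˣ}

theorem ne_zero_symm (h : HasCriticalCycle n K ε s) {i j : ℕ} (hi : i < n) (hj : j < n)
    (hK : K i j ≠ 0) : K j i ≠ 0 := by
  rw [h.mag i j hi hj]
  rcases Int.units_eq_one_or (ε i j) with h1 | h1 <;> simpa [h1] using hK

theorem isSegment_arc (h : HasCriticalCycle n K ε s) {i j : ℕ} (hij : i ≤ j) (hj : j < n) :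
    IsSegment (fun a b => a < n ∧ b < n ∧ K a b ≠ 0) ε s (arc i j) i j 1 := by
  have hc : (arc i j).IsChain fun a b => b = a + 1 ∧ a + 1 < n := by
    have h1 : (arc i j).IsChain fun a b => b = a + 1 := by
      simpa [arc] using List.isChain_range' i (j + 1 - i) 1
    refine h1.imp_of_mem_imp fun a b _ hb hab => ⟨hab, ?_⟩
    have := (mem_arc.1 hb).2
    omega
  refine ⟨?_, ?_, hc.imp ?_, pathProd_eq_one (hc.imp ?_), pathProd_eq_one (hc.imp ?_)⟩
  · rw [arc, List.head?_range', if_neg (by omega)]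
  · rw [arc, List.getLast?_range', if_neg (by omega)]
    congr 1; omega
  · rintro a b ⟨rfl, h1⟩
    exact ⟨by omega, h1, (h.edge a h1).1⟩
  · rintro a b ⟨rfl, h1⟩
    exact (h.edge a h1).2.1
  · rintro a b ⟨rfl, h1⟩
    exact (h.edge a h1).2.2

/-- The sign -1 comes from the closing edge from `n - 1` to `0`, the only edge of the Hamiltonian
cycle where `s` is nontrivial. -/
theorem isSegment_wrap (h : HasCriticalCycle n K ε s) {i j : ℕ} (hi : i < n) (hj : j < n) :
    IsSegment (fun a b => a < n ∧ b < n ∧ K a b ≠ 0) ε s (arc j (n - 1) ++ arc 0 i) j i (-1) := by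
  have := (h.isSegment_arc (i := j) (j := n - 1) (by omega) (by omega)).append
    (h.isSegment_arc (i := 0) (Nat.zero_le i) hi) ⟨by omega, by omega, h.last.1⟩ h.last.2.1
  simpa [h.last.2.2] using this

theorem IsSegment.reverse' (h : HasCriticalCycle n K ε s) {l : List ℕ} {a b : ℕ} {σ : ℤˣ}
    (hl : IsSegment (fun a b => a < n ∧ b < n ∧ K a b ≠ 0) ε s l a b σ) :
    IsSegment (fun a b => a < n ∧ b < n ∧ K a b ≠ 0) ε s l.reverse b a σ :=
  hl.reverse (fun _ _ hxy => ⟨hxy.2.1, hxy.1, h.ne_zero_symm hxy.1 hxy.2.1 hxy.2.2⟩)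
    h.eps_symm h.sgn_symm

/-- The condition on short cycles for a path closed up by one edge. -/
theorem cyc_one (h : HasCriticalCycle n K ε s) {l : List ℕ} {a b : ℕ} {σ e : ℤˣ}
    (hd : l.head? = some a) (hb : l.getLast? = some b)
    (hc : l.IsChain (fun a b => a < n ∧ b < n ∧ K a b ≠ 0)) (he : pathProd ε l = e)
    (hs : pathProd s l = σ) (hnd : l.Nodup) (hlen : 3 ≤ l.length) (hlen' : l.length < n)
    (ha : a < n) (hbn : b < n) (hK : K b a ≠ 0) (hε : e * ε b a = 1) : σ * s b a = 1 := by
  obtain ⟨t, rfl⟩ := List.head?_eq_some_iff.1 hd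
  have h1 : ∀ F : ℕ → ℕ → ℤˣ, pathProd F (a :: (t ++ [a])) = pathProd F (a :: t) * F b a := by
    intro F
    have := pathProd_append F hb (l₂ := [a]) (b := a) rfl
    simpa using this
  have := h.cyc a t ⟨hnd, by simpa using hlen, ?_⟩ (by simpa using hlen') (by rw [h1, he, hε])
  · rwa [h1, hs] at this
  · rw [← List.cons_append, List.isChain_append]
    refine ⟨hc, List.isChain_singleton _, ?_⟩
    simp only [hb]
    simp [ha, hbn, hK]

/-- The condition on short cycles for a cycle consisting of two segments and two further edges. -/
theorem cyc_two (h : HasCriticalCycle n K ε s) {l₁ l₂ : List ℕ} {a b c d : ℕ} {σ₁ σ₂ : ℤˣ}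
    (h₁ : IsSegment (fun a b => a < n ∧ b < n ∧ K a b ≠ 0) ε s l₁ a b σ₁)
    (h₂ : IsSegment (fun a b => a < n ∧ b < n ∧ K a b ≠ 0) ε s l₂ c d σ₂)
    (hnd : (l₁ ++ l₂).Nodup) (hlen : 3 ≤ l₁.length + l₂.length)
    (hlen' : l₁.length + l₂.length < n) (ha : a < n) (hb : b < n) (hc : c < n) (hd : d < n)
    (hK : K b c ≠ 0) (hK' : K d a ≠ 0) (hε : ε b c = -1) (hε' : ε d a = -1) :
    s b c * s d a = σ₁ * σ₂ := by
  have := h.cyc_one (l := l₁ ++ l₂) (a := a) (b := d) (e := -1) (σ := σ₁ * s b c * σ₂)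
    (by simp [h₁.head]) (by simp [h₂.last])
    (by
      rw [List.isChain_append]
      refine ⟨h₁.chain, h₂.chain, ?_⟩
      simp [h₁.last, h₂.head, hb, hc, hK])
    (by rw [pathProd_append ε h₁.last h₂.head, h₁.eps, h₂.eps, hε]; rfl)
    (by rw [pathProd_append s h₁.last h₂.head, h₁.sgn, h₂.sgn])
    hnd (by simpa using hlen) (by simpa using hlen') ha hd hK' (by rw [hε']; rfl)
  rcases Int.units_eq_one_or (s b c) with h3 | h3 <;>
    rcases Int.units_eq_one_or (s d a) with h4 | h4 <;>
    rcases Int.units_eq_one_or σ₁ with h5 | h5 <;>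
    rcases Int.units_eq_one_or σ₂ with h6 | h6 <;> simp_all

/-- A chord of charge 1 would split the Hamiltonian cycle into two shorter cycles of charge 1, both
with `s`-product 1. The chord occurs in both and cancels, so the whole cycle would have `s`-product
1 rather than -1. -/
theorem chord_eps (h : HasCriticalCycle n K ε s) {i j : ℕ} (hc : IsChord n K i j) :
    ε i j = -1 := by
  rcases Int.units_eq_one_or (ε i j) with h1 | h1
  swap
  · exact h1
  exfalso
  obtain ⟨h2, h3, h4, h5⟩ := hc
  have s1 := h.isSegment_arc (i := i) (j := j) (by omega) h3
  have e1 := h.cyc_one s1.head s1.last s1.chain s1.eps s1.sgn (nodup_arc i j)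
    (by simp; omega) (by simp; omega) (by omega) h3 (h.ne_zero_symm (by omega) h3 h5)
    (by rw [h.eps_symm, h1]; rfl)
  have s2 := h.isSegment_wrap (i := i) (j := j) (by omega) h3
  have e2 := h.cyc_one s2.head s2.last s2.chain s2.eps s2.sgn
    (by
      rw [List.nodup_append]
      refine ⟨nodup_arc _ _, nodup_arc _ _, ?_⟩
      intro a ha b hb
      rw [mem_arc] at ha hb
      omega)
    (by simp; omega) (by simp; omega) h3 (by omega) h5 (by rw [h1]; rfl)
  rw [h.sgn_symm, one_mul] at e1
  rw [e1] at e2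
  revert e2
  decide

/-- Crossing chords, first cycle. -/
theorem chord_cross (h : HasCriticalCycle n K ε s) {i j k l : ℕ} (hc : IsChord n K i j)
    (hc' : IsChord n K k l) (h1 : i < k) (h2 : k < j) (h3 : j < l)
    (hne : ¬(i = 0 ∧ k + 1 = j ∧ l = n - 1)) : s i j = s k l := by
  have e1 := h.chord_eps hc
  have e2 := h.chord_eps hc'
  obtain ⟨c1, c2, c3, c4⟩ := hc
  obtain ⟨d1, d2, d3, d4⟩ := hc'
  -- The cycle runs from `i` to `k`, over a chord to `l`, down to `j`, and over the other chord to
  -- `i`. It avoids the closing edge, and `hne` says that it misses a vertex.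
  have := h.cyc_two (h.isSegment_arc (i := i) (j := k) h1.le (by omega))
    (IsSegment.reverse' h (h.isSegment_arc (i := j) (j := l) h3.le d2))
    (by
      rw [List.nodup_append, List.nodup_reverse]
      refine ⟨nodup_arc _ _, nodup_arc _ _, ?_⟩
      intro a ha b hb
      rw [List.mem_reverse] at hb
      rw [mem_arc] at ha hb
      omega)
    (by simp; omega) (by simp; omega) (by omega) (by omega) d2 c2 d4
    (h.ne_zero_symm (by omega) c2 c4) e2 (by rw [h.eps_symm, e1])
  rw [h.sgn_symm j i] at this
  rcases Int.units_eq_one_or (s i j) with h3 | h3 <;>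
    rcases Int.units_eq_one_or (s k l) with h4 | h4 <;> simp_all

/-- Crossing chords, second cycle. -/
theorem chord_cross' (h : HasCriticalCycle n K ε s) {i j k l : ℕ} (hc : IsChord n K i j)
    (hc' : IsChord n K k l) (h1 : i < k) (h2 : k < j) (h3 : j < l)
    (hne : ¬(k = i + 1 ∧ l = j + 1)) : s i j = -s k l := by
  have e1 := h.chord_eps hc
  have e2 := h.chord_eps hc'
  obtain ⟨c1, c2, c3, c4⟩ := hc
  obtain ⟨d1, d2, d3, d4⟩ := hc'
  -- The complementary cycle joins the arc from `k` to `j` with the arc through the closing edge,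
  -- hence the opposite sign. It misses the vertices strictly between `i` and `k` and between `j`
  -- and `l`; `hne` provides one.
  have := h.cyc_two (h.isSegment_arc (i := k) (j := j) h2.le (by omega))
    (IsSegment.reverse' h (h.isSegment_wrap (i := i) (j := l) (by omega) d2))
    (by
      rw [List.nodup_append, List.nodup_reverse, List.nodup_append]
      refine ⟨nodup_arc _ _, ⟨nodup_arc _ _, nodup_arc _ _, ?_⟩, ?_⟩
      · intro a ha b hb
        rw [mem_arc] at ha hb
        omega
      · intro a ha b hb
        rw [List.mem_reverse, List.mem_append] at hb
        rw [mem_arc] at ha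
        simp only [mem_arc] at hb
        omega)
    (by simp; omega) (by simp; omega) (by omega) (by omega) (by omega) d2
    (h.ne_zero_symm (by omega) c2 c4) (h.ne_zero_symm (by omega) d2 d4)
    (by rw [h.eps_symm, e1]) (by rw [h.eps_symm, e2])
  rw [h.sgn_symm j i, h.sgn_symm l k] at this
  rcases Int.units_eq_one_or (s i j) with h3 | h3 <;>
    rcases Int.units_eq_one_or (s k l) with h4 | h4 <;> simp_all

/-- Nested chords. -/
theorem chord_nested (h : HasCriticalCycle n K ε s) {i j k l : ℕ} (hc : IsChord n K i j)
    (hc' : IsChord n K k l) (h1 : i ≤ k) (h2 : l ≤ j) : s i j = s k l := by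
  by_cases hne : i = k ∧ j = l
  · rw [hne.1, hne.2]
  have e1 := h.chord_eps hc
  have e2 := h.chord_eps hc'
  obtain ⟨c1, c2, c3, c4⟩ := hc
  obtain ⟨d1, d2, d3, d4⟩ := hc'
  -- The cycle uses the arcs from `i` to `k` and from `l` to `j`. It skips the interior of the inner
  -- chord's arc, which is never empty, and avoids the closing edge.
  have := h.cyc_two (h.isSegment_arc (i := i) (j := k) h1 (by omega))
    (h.isSegment_arc (i := l) (j := j) h2 c2)
    (by
      rw [List.nodup_append]
      refine ⟨nodup_arc _ _, nodup_arc _ _, ?_⟩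
      intro a ha b hb
      rw [mem_arc] at ha hb
      omega)
    (by simp; omega) (by simp; omega) (by omega) (by omega) d2 c2 d4
    (h.ne_zero_symm (by omega) c2 c4) e2 (by rw [h.eps_symm, e1])
  rw [h.sgn_symm j i] at this
  rcases Int.units_eq_one_or (s i j) with h3 | h3 <;>
    rcases Int.units_eq_one_or (s k l) with h4 | h4 <;> simp_all

/-- Chords spanning disjoint arcs. -/
theorem chord_disjoint (h : HasCriticalCycle n K ε s) {i j k l : ℕ} (hc : IsChord n K i j)
    (hc' : IsChord n K k l) (h1 : j ≤ k) : s i j = -s k l := by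
  have e1 := h.chord_eps hc
  have e2 := h.chord_eps hc'
  obtain ⟨c1, c2, c3, c4⟩ := hc
  obtain ⟨d1, d2, d3, d4⟩ := hc'
  -- The second arc of this cycle passes through the closing edge, which makes the two signs
  -- opposite.
  have := h.cyc_two (h.isSegment_arc (i := j) (j := k) h1 (by omega))
    (h.isSegment_wrap (i := i) (j := l) (by omega) d2)
    (by
      rw [List.nodup_append, List.nodup_append]
      refine ⟨nodup_arc _ _, ⟨nodup_arc _ _, nodup_arc _ _, ?_⟩, ?_⟩
      · intro a ha b hb
        rw [mem_arc] at ha hb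
        omega
      · intro a ha b hb
        rw [List.mem_append] at hb
        rw [mem_arc] at ha
        simp only [mem_arc] at hb
        omega)
    (by simp; omega) (by simp; omega) (by omega) (by omega) d2 (by omega) d4 c4 e2 e1
  rcases Int.units_eq_one_or (s i j) with h3 | h3 <;>
    rcases Int.units_eq_one_or (s k l) with h4 | h4 <;> simp_all

end HasCriticalCycle

/-! ### Separation by the two ends of an uncrossed chord. -/

section UncrossedChord

open Matrix

/-- The leading `n × n` matrix of a function on pairs of natural numbers. -/
def toMat (n : ℕ) (P : ℕ → ℕ → ℝ) : Matrix (Fin n) (Fin n) ℝ := Matrix.of fun i j => P i j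

/-- Delete the entries at `(a, b)` and `(b, a)`. -/
def deletePair (P : ℕ → ℕ → ℝ) (a b : ℕ) : ℕ → ℕ → ℝ :=
  fun i j => if (i = a ∧ j = b) ∨ (i = b ∧ j = a) then 0 else P i j

theorem deletePair_of_ne {P : ℕ → ℕ → ℝ} {a b i j : ℕ}
    (h : ¬((i = a ∧ j = b) ∨ (i = b ∧ j = a))) : deletePair P a b i j = P i j := if_neg h

theorem deletePair_left (P : ℕ → ℕ → ℝ) (a b : ℕ) : deletePair P a b a b = 0 :=
  if_pos (Or.inl ⟨rfl, rfl⟩)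

theorem deletePair_right (P : ℕ → ℕ → ℝ) (a b : ℕ) : deletePair P a b b a = 0 :=
  if_pos (Or.inr ⟨rfl, rfl⟩)

/-- The indices `< n` listed as a core `c` followed by two intervals. -/
def splitIndex {k a b : ℕ} (n : ℕ) (c : Fin k → ℕ) (p q : ℕ)
    (hc : ∀ i, c i < n) (ha : a + p ≤ n) (hb : b + q ≤ n) : Fin k ⊕ (Fin a ⊕ Fin b) → Fin n
  | Sum.inl i => ⟨c i, hc i⟩
  | Sum.inr (Sum.inl i) => ⟨i + p, by omega⟩
  | Sum.inr (Sum.inr i) => ⟨i + q, by omega⟩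

theorem det_toMat_eq {k a b n : ℕ} (c : Fin k → ℕ) (p q : ℕ) (hc : ∀ i, c i < n) (ha : a + p ≤ n)
    (hb : b + q ≤ n) (hcard : k + (a + b) = n)
    (hinj : Function.Injective (splitIndex n c p q hc ha hb))
    (P : ℕ → ℕ → ℝ) (M : Matrix (Fin k ⊕ (Fin a ⊕ Fin b)) (Fin k ⊕ (Fin a ⊕ Fin b)) ℝ)
    (hM : ∀ i j, M i j = P (splitIndex n c p q hc ha hb i) (splitIndex n c p q hc ha hb j)) :
    (toMat n P).det = M.det := by
  have hbij : Function.Bijective (splitIndex n c p q hc ha hb) :=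
    (Fintype.bijective_iff_injective_and_card _).2 ⟨hinj, by simp [hcard]⟩
  rw [← det_submatrix_equiv_self (Equiv.ofBijective _ hbij)]
  congr 1
  ext i j
  simp [toMat, hM]

/-- Instance of `det_sepMatrix_two` with core `0, m` and sides the open intervals `(0, m)` and `(m,
n)`. The second side is transposed, with the twist -1 at vertex `0`. -/
theorem det_uncross {n m : ℕ} (hm : 2 ≤ m) (hmn : m + 2 ≤ n) (P P' : ℕ → ℕ → ℝ)
    (hsep : ∀ x y, 0 < x → x < m → m < y → y < n → P x y = 0 ∧ P y x = 0)
    (hsep' : ∀ x y, 0 < x → x < m → m < y → y < n → P' x y = 0 ∧ P' y x = 0)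
    (hanti : P m 0 = -P 0 m)
    (h1 : ∀ i j, i ≤ m → j ≤ m → P' i j = P i j)
    (h2 : ∀ i j, m ≤ i → i < n → m ≤ j → j < n → P' i j = P j i)
    (h3 : ∀ y, m < y → y < n → P' 0 y = -P y 0 ∧ P' y 0 = -P 0 y) :
    (toMat n P).det - (toMat n P').det =
      (toMat n (deletePair P 0 m)).det - (toMat n (deletePair P' 0 m)).det := by
  let c : Fin 2 → ℕ := ![0, m]
  have hc : ∀ i, c i < n := by
    intro i; fin_cases i
    · simp [c]; omega
    · simp [c]; omega
  have ha : m - 1 + 1 ≤ n := by omega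
  have hb : n - m - 1 + (m + 1) ≤ n := by omega
  have hcard : 2 + (m - 1 + (n - m - 1)) = n := by omega
  have hinj : Function.Injective (splitIndex n c 1 (m + 1) hc ha hb) := by
    rintro (i | i | i) (j | j | j) hij
    · fin_cases i <;> fin_cases j <;> simp [splitIndex, c] at hij ⊢ <;> omega
    · fin_cases i <;> simp [splitIndex, c] at hij <;> omega
    · fin_cases i <;> simp [splitIndex, c] at hij; omega
    · fin_cases j <;> simp [splitIndex, c] at hij; omega
    · simpa [splitIndex, Fin.ext_iff] using hij
    · simp [splitIndex] at hij; omega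
    · fin_cases j <;> simp [splitIndex, c] at hij; omega
    · simp [splitIndex] at hij; omega
    · simpa [splitIndex, Fin.ext_iff] using hij
  let U : Matrix (Fin 2) (Fin (m - 1)) ℝ := Matrix.of fun i x => P (c i) (x + 1)
  let U' : Matrix (Fin (m - 1)) (Fin 2) ℝ := Matrix.of fun x i => P (x + 1) (c i)
  let A : Matrix (Fin (m - 1)) (Fin (m - 1)) ℝ := Matrix.of fun x x' => P (x + 1) (x' + 1)
  let V : Matrix (Fin 2) (Fin (n - m - 1)) ℝ := Matrix.of fun i y => P (c i) (y + (m + 1))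
  let V' : Matrix (Fin (n - m - 1)) (Fin 2) ℝ := Matrix.of fun y i => P (y + (m + 1)) (c i)
  let D : Matrix (Fin (n - m - 1)) (Fin (n - m - 1)) ℝ :=
    Matrix.of fun y y' => P (y + (m + 1)) (y' + (m + 1))
  let σ : Fin 2 → ℝ := ![-1, 1]
  have main := det_sepMatrix_two (P 0 0) (P m m) (P 0 m) U U' A V V' D σ rfl
  have e1 : ∀ (Q : ℕ → ℕ → ℝ) (t : ℝ), Q 0 m = t → Q m 0 = -t →
      (∀ i j, ¬((i = 0 ∧ j = m) ∨ (i = m ∧ j = 0)) → Q i j = P i j) →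
      (toMat n Q).det = (sepMatrix !![P 0 0, t; -t, P m m] U U' A V V' D).det := by
    intro Q t q1 q2 q3
    apply det_toMat_eq c 1 (m + 1) hc ha hb hcard hinj
    rintro (i | i | i) (j | j | j)
    · fin_cases i <;> fin_cases j <;> simp [sepMatrix, splitIndex, c, q1, q2]
      · rw [q3 _ _ (by omega)]
      · rw [q3 _ _ (by omega)]
    · have : ¬((c i = 0 ∧ (j : ℕ) + 1 = m) ∨ (c i = m ∧ (j : ℕ) + 1 = 0)) := by omega
      simp [sepMatrix, splitIndex, U, q3 _ _ this]
    · have : ¬((c i = 0 ∧ (j : ℕ) + (m + 1) = m) ∨ (c i = m ∧ (j : ℕ) + (m + 1) = 0)) := by omega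
      simp [sepMatrix, splitIndex, V, q3 _ _ this]
    · have : ¬(((i : ℕ) + 1 = 0 ∧ c j = m) ∨ ((i : ℕ) + 1 = m ∧ c j = 0)) := by omega
      simp [sepMatrix, splitIndex, U', q3 _ _ this]
    · simp [sepMatrix, splitIndex, A]
      rw [q3 _ _ (by omega)]
    · simp [sepMatrix, splitIndex]
      rw [q3 _ _ (by omega), (hsep _ _ (by omega) (by omega) (by omega) (by omega)).1]
    · have : ¬(((i : ℕ) + (m + 1) = 0 ∧ c j = m) ∨ ((i : ℕ) + (m + 1) = m ∧ c j = 0)) := by omega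
      simp [sepMatrix, splitIndex, V', q3 _ _ this]
    · simp [sepMatrix, splitIndex]
      rw [q3 _ _ (by omega), (hsep _ _ (by omega) (by omega) (by omega) (by omega)).2]
    · simp [sepMatrix, splitIndex, D]
      rw [q3 _ _ (by omega)]
  have e2 : ∀ (Q : ℕ → ℕ → ℝ) (t : ℝ), Q 0 m = t → Q m 0 = -t →
      (∀ i j, ¬((i = 0 ∧ j = m) ∨ (i = m ∧ j = 0)) → Q i j = P' i j) →
      (toMat n Q).det = (sepMatrix !![P 0 0, t; -t, P m m] U U' A
        (Matrix.of fun i y => σ i * V' y i) (Matrix.of fun y i => σ i * V i y) Dᵀ).det := by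
    intro Q t q1 q2 q3
    apply det_toMat_eq c 1 (m + 1) hc ha hb hcard hinj
    have hcm : ∀ i, c i ≤ m := by intro i; fin_cases i <;> simp [c]
    rintro (i | i | i) (j | j | j)
    · fin_cases i <;> fin_cases j <;> simp [sepMatrix, splitIndex, c, q1, q2]
      · rw [q3 _ _ (by omega), h1 _ _ (by omega) (by omega)]
      · rw [q3 _ _ (by omega), h1 _ _ (by omega) (by omega)]
    · have : ¬((c i = 0 ∧ (j : ℕ) + 1 = m) ∨ (c i = m ∧ (j : ℕ) + 1 = 0)) := by omega
      simp [sepMatrix, splitIndex, U, q3 _ _ this, h1 _ _ (hcm i) (show (j : ℕ) + 1 ≤ m by omega)]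
    · rw [splitIndex, splitIndex, q3 _ _ (by simp; omega)]
      fin_cases i
      · simp [sepMatrix, V', c, σ]
        rw [(h3 _ (by omega) (by omega)).1]
      · simp [sepMatrix, V', c, σ]
        rw [h2 _ _ (by omega) (by omega) (by omega) (by omega)]
    · have : ¬(((i : ℕ) + 1 = 0 ∧ c j = m) ∨ ((i : ℕ) + 1 = m ∧ c j = 0)) := by omega
      simp [sepMatrix, splitIndex, U', q3 _ _ this, h1 _ _ (show (i : ℕ) + 1 ≤ m by omega) (hcm j)]
    · simp [sepMatrix, splitIndex, A]
      rw [q3 _ _ (by omega), h1 _ _ (by omega) (by omega)]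
    · simp [sepMatrix, splitIndex]
      rw [q3 _ _ (by omega), (hsep' _ _ (by omega) (by omega) (by omega) (by omega)).1]
    · rw [splitIndex, splitIndex, q3 _ _ (by simp; omega)]
      fin_cases j
      · simp [sepMatrix, V, c, σ]
        rw [(h3 _ (by omega) (by omega)).2]
      · simp [sepMatrix, V, c, σ]
        rw [h2 _ _ (by omega) (by omega) (by omega) (by omega)]
    · simp [sepMatrix, splitIndex]
      rw [q3 _ _ (by omega), (hsep' _ _ (by omega) (by omega) (by omega) (by omega)).2]
    · simp [sepMatrix, splitIndex, D]
      rw [q3 _ _ (by omega), h2 _ _ (by omega) (by omega) (by omega) (by omega)]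
  have hanti' : P' m 0 = -P 0 m := by rw [h1 _ _ le_rfl (by omega), hanti]
  rw [e1 P (P 0 m) rfl hanti (fun _ _ _ => rfl),
    e2 P' (P 0 m) (h1 _ _ (by omega) le_rfl) hanti' (fun _ _ _ => rfl),
    e1 (deletePair P 0 m) 0 (deletePair_left _ _ _) (by simp [deletePair_right])
      (fun i j hij => deletePair_of_ne hij),
    e2 (deletePair P' 0 m) 0 (deletePair_left _ _ _) (by simp [deletePair_right])
      (fun i j hij => deletePair_of_ne hij)]
  simpa using main

theorem det_sign_conj {ι : Type*} [Fintype ι] [DecidableEq ι] (M : Matrix ι ι ℝ) (d : ι → ℝ)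
    (hd : ∀ i, d i * d i = 1) : (Matrix.of fun i j => d i * M i j * d j).det = M.det := by
  have : (Matrix.of fun i j => d i * M i j * d j) = diagonal d * M * diagonal d := by
    ext i j; simp [mul_diagonal, diagonal_mul]
  rw [this, det_mul, det_mul, det_diagonal, mul_right_comm, ← Finset.prod_mul_distrib]
  simp [hd]

end UncrossedChord

/-! ### Separation by the four-cycle of a crossing pair. -/

section CrossedChords

open Matrix

/-- Instance of `det_sepMatrix_four` with core `0, m, n - 1, m + 1` in this order, so that the twist
-1 sits at `n - 1`. The symmetric pairs `p`, `q` are edges of the Hamiltonian cycle, the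
antisymmetric pairs `t`, `u` are the crossing chords. -/
theorem det_cross {n m : ℕ} (hm : 1 ≤ m) (hmn : m + 3 ≤ n) (P P' : ℕ → ℕ → ℝ)
    (hsep : ∀ x y, x ≤ m → m < y → y < n →
      ¬((x = 0 ∨ x = m) ∧ (y = n - 1 ∨ y = m + 1)) → P x y = 0 ∧ P y x = 0)
    (hp : P (n - 1) 0 = P 0 (n - 1)) (hq : P (m + 1) m = P m (m + 1))
    (ht : P (n - 1) m = -P m (n - 1)) (hu : P (m + 1) 0 = -P 0 (m + 1))
    (hx : ∀ x y, x ≤ m → m < y → y < n → P' x y = P x y ∧ P' y x = P y x)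
    (h1 : ∀ i j, i ≤ m → j ≤ m → P' i j = P i j)
    (h2 : ∀ i j, m < i → i + 1 < n → m < j → j + 1 < n → P' i j = P j i)
    (h3 : ∀ y, m < y → y + 1 < n → P' (n - 1) y = -P y (n - 1) ∧ P' y (n - 1) = -P (n - 1) y)
    (h4 : P' (n - 1) (n - 1) = P (n - 1) (n - 1)) :
    P 0 (n - 1) * P m (m + 1) * ((toMat n P).det - (toMat n P').det) =
      (P 0 (n - 1) * P m (m + 1) - P m (n - 1) * P 0 (m + 1)) *
      ((toMat n (deletePair (deletePair P 0 (m + 1)) m (n - 1))).det -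
        (toMat n (deletePair (deletePair P' 0 (m + 1)) m (n - 1))).det) := by
  let c : Fin 4 → ℕ := ![0, m, n - 1, m + 1]
  have hc : ∀ i, c i < n := by
    intro i; fin_cases i <;> simp [c] <;> omega
  have ha : m - 1 + 1 ≤ n := by omega
  have hb : n - m - 3 + (m + 2) ≤ n := by omega
  have hcard : 4 + (m - 1 + (n - m - 3)) = n := by omega
  have hinj : Function.Injective (splitIndex n c 1 (m + 2) hc ha hb) := by
    rintro (i | i | i) (j | j | j) hij
    · fin_cases i <;> fin_cases j <;> simp [splitIndex, c] at hij ⊢ <;> omega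
    · fin_cases i <;> simp [splitIndex, c] at hij <;> omega
    · fin_cases i <;> simp [splitIndex, c] at hij <;> omega
    · fin_cases j <;> simp [splitIndex, c] at hij <;> omega
    · simpa [splitIndex, Fin.ext_iff] using hij
    · simp [splitIndex] at hij; omega
    · fin_cases j <;> simp [splitIndex, c] at hij <;> omega
    · simp [splitIndex] at hij; omega
    · simpa [splitIndex, Fin.ext_iff] using hij
  let U : Matrix (Fin 4) (Fin (m - 1)) ℝ := Matrix.of fun i x => P (c i) (x + 1)
  let U' : Matrix (Fin (m - 1)) (Fin 4) ℝ := Matrix.of fun x i => P (x + 1) (c i)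
  let A : Matrix (Fin (m - 1)) (Fin (m - 1)) ℝ := Matrix.of fun x x' => P (x + 1) (x' + 1)
  let V : Matrix (Fin 4) (Fin (n - m - 3)) ℝ := Matrix.of fun i y => P (c i) (y + (m + 2))
  let V' : Matrix (Fin (n - m - 3)) (Fin 4) ℝ := Matrix.of fun y i => P (y + (m + 2)) (c i)
  let D : Matrix (Fin (n - m - 3)) (Fin (n - m - 3)) ℝ :=
    Matrix.of fun y y' => P (y + (m + 2)) (y' + (m + 2))
  let σ : Fin 4 → ℝ := ![1, 1, -1, 1]
  have main := det_sepMatrix_four (P 0 0) (P 0 m) (P m 0) (P m m) (P (n - 1) (n - 1))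
    (P (n - 1) (m + 1)) (P (m + 1) (n - 1)) (P (m + 1) (m + 1)) (P 0 (n - 1)) (P m (m + 1))
    (P m (n - 1)) (P 0 (m + 1)) U U' A V V' D
    (by
      intro x
      have s1 := hsep (x + 1) (n - 1) (by omega) (by omega) (by omega) (by omega)
      have s2 := hsep (x + 1) (m + 1) (by omega) (by omega) (by omega) (by omega)
      exact ⟨s1.2, s2.2, s1.1, s2.1⟩)
    (by
      intro y
      have s1 := hsep 0 (y + (m + 2)) (by omega) (by omega) (by omega) (by omega)
      have s2 := hsep m (y + (m + 2)) (by omega) (by omega) (by omega) (by omega)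
      exact ⟨s1.1, s2.1, s1.2, s2.2⟩) σ rfl
  have e1 : ∀ (Q : ℕ → ℕ → ℝ) (t u : ℝ), Q 0 (m + 1) = u → Q (m + 1) 0 = -u →
      Q m (n - 1) = t → Q (n - 1) m = -t →
      (∀ i j, ¬((i = 0 ∧ j = m + 1) ∨ (i = m + 1 ∧ j = 0)) →
        ¬((i = m ∧ j = n - 1) ∨ (i = n - 1 ∧ j = m)) → Q i j = P i j) →
      (toMat n Q).det = (sepMatrix !![P 0 0, P 0 m, P 0 (n - 1), u; P m 0, P m m, t, P m (m + 1);
        P 0 (n - 1), -t, P (n - 1) (n - 1), P (n - 1) (m + 1);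
        -u, P m (m + 1), P (m + 1) (n - 1), P (m + 1) (m + 1)] U U' A V V' D).det := by
    intro Q t u q1 q2 q3 q4 q5
    apply det_toMat_eq c 1 (m + 2) hc ha hb hcard hinj
    rintro (i | i | i) (j | j | j)
    · fin_cases i <;> fin_cases j <;> simp [sepMatrix, splitIndex, c, q1, q2, q3, q4] <;>
        rw [q5 _ _ (by omega) (by omega)]
      · exact hp.symm
      · exact hq.symm
    · simp only [splitIndex]
      rw [q5 _ _ (by omega) (by omega)]
      rfl
    · simp only [splitIndex]
      rw [q5 _ _ (by omega) (by omega)]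
      rfl
    · simp only [splitIndex]
      rw [q5 _ _ (by omega) (by omega)]
      rfl
    · simp only [splitIndex]
      rw [q5 _ _ (by omega) (by omega)]
      rfl
    · simp only [splitIndex]
      rw [q5 _ _ (by omega) (by omega), (hsep (i + 1) (j + (m + 2)) (by omega) (by omega) (by omega) (by omega)).1]
      rfl
    · simp only [splitIndex]
      rw [q5 _ _ (by omega) (by omega)]
      rfl
    · simp only [splitIndex]
      rw [q5 _ _ (by omega) (by omega), (hsep (j + 1) (i + (m + 2)) (by omega) (by omega) (by omega) (by omega)).2]
      rfl
    · simp only [splitIndex]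
      rw [q5 _ _ (by omega) (by omega)]
      rfl
  have e2 : ∀ (Q : ℕ → ℕ → ℝ) (t u : ℝ), Q 0 (m + 1) = u → Q (m + 1) 0 = -u →
      Q m (n - 1) = t → Q (n - 1) m = -t →
      (∀ i j, ¬((i = 0 ∧ j = m + 1) ∨ (i = m + 1 ∧ j = 0)) →
        ¬((i = m ∧ j = n - 1) ∨ (i = n - 1 ∧ j = m)) → Q i j = P' i j) →
      (toMat n Q).det = (sepMatrix !![P 0 0, P 0 m, P 0 (n - 1), u; P m 0, P m m, t, P m (m + 1);
        P 0 (n - 1), -t, P (n - 1) (n - 1), -P (m + 1) (n - 1);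
        -u, P m (m + 1), -P (n - 1) (m + 1), P (m + 1) (m + 1)] U U' A
        (Matrix.of fun i y => σ i * V' y i) (Matrix.of fun y i => σ i * V i y) Dᵀ).det := by
    intro Q t u q1 q2 q3 q4 q5
    apply det_toMat_eq c 1 (m + 2) hc ha hb hcard hinj
    rintro (i | i | i) (j | j | j)
    · fin_cases i <;> fin_cases j <;> simp [sepMatrix, splitIndex, c, q1, q2, q3, q4] <;>
        rw [q5 _ _ (by omega) (by omega)]
      · rw [h1 _ _ (by omega) (by omega)]
      · rw [h1 _ _ (by omega) (by omega)]
      · rw [(hx _ _ (by omega) (by omega) (by omega)).1]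
      · rw [h1 _ _ (by omega) (by omega)]
      · rw [h1 _ _ (by omega) (by omega)]
      · rw [(hx _ _ (by omega) (by omega) (by omega)).1]
      · rw [(hx _ _ (by omega) (by omega) (by omega)).2, hp]
      · rw [h4]
      · rw [(h3 _ (by omega) (by omega)).1]
      · rw [(hx _ _ (by omega) (by omega) (by omega)).2, hq]
      · rw [(h3 _ (by omega) (by omega)).2]
      · rw [h2 _ _ (by omega) (by omega) (by omega) (by omega)]
    · simp only [splitIndex]
      rw [q5 _ _ (by omega) (by omega)]
      by_cases him : c i ≤ m
      · rw [h1 _ _ him (by omega)]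
        rfl
      · rw [(hx _ _ (by omega) (by omega) (hc i)).2]
        rfl
    · simp only [splitIndex]
      rw [q5 _ _ (by omega) (by omega)]
      fin_cases i <;> simp [sepMatrix, V', c, σ]
      · rw [(hx _ _ (by omega) (by omega) (by omega)).1]
        have := hsep 0 (j + (m + 2)) (by omega) (by omega) (by omega) (by omega)
        rw [this.1, this.2]
      · rw [(hx _ _ (by omega) (by omega) (by omega)).1]
        have := hsep m (j + (m + 2)) (by omega) (by omega) (by omega) (by omega)
        rw [this.1, this.2]
      · rw [(h3 _ (by omega) (by omega)).1]
      · rw [h2 _ _ (by omega) (by omega) (by omega) (by omega)]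
    · simp only [splitIndex]
      rw [q5 _ _ (by omega) (by omega)]
      by_cases him : c j ≤ m
      · rw [h1 _ _ (by omega) him]
        rfl
      · rw [(hx _ _ (by omega) (by omega) (hc j)).1]
        rfl
    · simp only [splitIndex]
      rw [q5 _ _ (by omega) (by omega), h1 _ _ (by omega) (by omega)]
      rfl
    · simp only [splitIndex]
      rw [q5 _ _ (by omega) (by omega), (hx _ _ (by omega) (by omega) (by omega)).1,
        (hsep (i + 1) (j + (m + 2)) (by omega) (by omega) (by omega) (by omega)).1]
      rfl
    · simp only [splitIndex]
      rw [q5 _ _ (by omega) (by omega)]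
      fin_cases j <;> simp [sepMatrix, V, c, σ]
      · rw [(hx _ _ (by omega) (by omega) (by omega)).2]
        have := hsep 0 (i + (m + 2)) (by omega) (by omega) (by omega) (by omega)
        rw [this.1, this.2]
      · rw [(hx _ _ (by omega) (by omega) (by omega)).2]
        have := hsep m (i + (m + 2)) (by omega) (by omega) (by omega) (by omega)
        rw [this.1, this.2]
      · rw [(h3 _ (by omega) (by omega)).2]
      · rw [h2 _ _ (by omega) (by omega) (by omega) (by omega)]
    · simp only [splitIndex]
      rw [q5 _ _ (by omega) (by omega), (hx _ _ (by omega) (by omega) (by omega)).2,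
        (hsep (j + 1) (i + (m + 2)) (by omega) (by omega) (by omega) (by omega)).2]
      rfl
    · simp only [splitIndex]
      rw [q5 _ _ (by omega) (by omega), h2 _ _ (by omega) (by omega) (by omega) (by omega)]
      rfl
  have hd : ∀ (Q : ℕ → ℕ → ℝ), 
      deletePair (deletePair Q 0 (m + 1)) m (n - 1) 0 (m + 1) = 0 ∧
      deletePair (deletePair Q 0 (m + 1)) m (n - 1) (m + 1) 0 = 0 := by
    intro Q
    have h1 : ¬((0 = m ∧ m + 1 = n - 1) ∨ (0 = n - 1 ∧ m + 1 = m)) := by omega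
    have h2 : ¬((m + 1 = m ∧ 0 = n - 1) ∨ (m + 1 = n - 1 ∧ 0 = m)) := by omega
    rw [deletePair_of_ne h1, deletePair_of_ne h2]
    exact ⟨deletePair_left _ _ _, deletePair_right _ _ _⟩
  have x1 := hx 0 (m + 1) (by omega) (by omega) (by omega)
  have x2 := hx m (n - 1) (by omega) (by omega) (by omega)
  rw [e1 P (P m (n - 1)) (P 0 (m + 1)) rfl hu rfl ht (fun _ _ _ _ => rfl),
    e2 P' (P m (n - 1)) (P 0 (m + 1)) x1.1 (x1.2.trans hu) x2.1 (x2.2.trans ht)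
      (fun _ _ _ _ => rfl),
    e1 (deletePair (deletePair P 0 (m + 1)) m (n - 1)) 0 0 (hd P).1 (by simp [(hd P).2])
      (deletePair_left _ _ _) (by simp [deletePair_right])
      (fun i j hij hij' => by rw [deletePair_of_ne hij', deletePair_of_ne hij]),
    e2 (deletePair (deletePair P' 0 (m + 1)) m (n - 1)) 0 0 (hd P').1 (by simp [(hd P').2])
      (deletePair_left _ _ _) (by simp [deletePair_right])
      (fun i j hij hij' => by rw [deletePair_of_ne hij', deletePair_of_ne hij])]
  simpa using main

end CrossedChords

/-! ### Symmetries of critical cycles. -/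

section CriticalCycle

open Matrix

/-- The entrywise product of a matrix with a sign pattern. -/
def signMul {V : Type*} (s : V → V → ℤˣ) (K : V → V → ℝ) : V → V → ℝ :=
  fun i j => ((s i j : ℤ) : ℝ) * K i j

theorem unit_cast_mul_self (u : ℤˣ) : (((u : ℤ) : ℝ)) * ((u : ℤ) : ℝ) = 1 := by
  rcases Int.units_eq_one_or u with h | h <;> simp [h]

theorem signMul_deletePair (s : ℕ → ℕ → ℤˣ) (K : ℕ → ℕ → ℝ) (a b : ℕ) :
    signMul s (deletePair K a b) = deletePair (signMul s K) a b := by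
  funext i j
  simp only [signMul, deletePair]
  split_ifs <;> simp

theorem IsCyc.mono {V : Type*} {R R' : V → V → Prop} (h : ∀ x y, R x y → R' x y) {x : V}
    {t : List V} (hc : IsCyc R x t) : IsCyc R' x t :=
  ⟨hc.1, hc.2.1, hc.2.2.imp h⟩

theorem pathProd_eq_one_of_coboundary {V : Type*} (d : V → ℤˣ) (x : V) (t : List V) :
    pathProd (fun a b => d a * d b) (x :: (t ++ [x])) = 1 := by
  rw [pathProd_coboundary x t x (h := d), Int.units_mul_self]
  rw [List.isChain_iff_forall_rel_of_append_cons_cons]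
  intros; rfl

namespace HasCriticalCycle

variable {n : ℕ} {K : ℕ → ℕ → ℝ} {ε s : ℕ → ℕ → ℤˣ}

/-- Replacing `s` by `s * ε` amounts to transposing the second matrix. As chords have `ε = -1`, it
flips the signs of all chords at once, which halves the case analysis. -/
theorem mul_eps (h : HasCriticalCycle n K ε s) :
    HasCriticalCycle n K ε (fun i j => s i j * ε i j) where
  three_le := h.three_le
  eps_symm := h.eps_symm
  sgn_symm i j := by rw [h.sgn_symm, h.eps_symm]
  eps_diag := h.eps_diag
  sgn_diag i := by rw [h.sgn_diag, h.eps_diag]; rfl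
  mag := h.mag
  edge i hi := ⟨(h.edge i hi).1, (h.edge i hi).2.1, by
    rw [(h.edge i hi).2.1, (h.edge i hi).2.2]; rfl⟩
  last := ⟨h.last.1, h.last.2.1, by rw [h.last.2.1, h.last.2.2]; rfl⟩
  cyc x t hc hl he := by rw [pathProd_mul, h.cyc x t hc hl he, he]; rfl
  generic := h.generic

theorem det_mul_eps (h : HasCriticalCycle n K ε s) :
    (toMat n (signMul (fun i j => s i j * ε i j) K)).det = (toMat n (signMul s K)).det := by
  rw [← det_transpose (toMat n (signMul s K))]
  congr 1
  ext i j
  simp only [toMat, signMul, of_apply, transpose_apply, h.mag i j i.2 j.2, h.sgn_symm j i]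
  push_cast
  ring

/-- Deleting a chord keeps the Hamiltonian cycle and creates no new cycles, so the conditions on
short cycles and four-cycles are inherited. -/
theorem deletePair (h : HasCriticalCycle n K ε s) {a b : ℕ} (hab : a + 2 ≤ b) (hb : b < n)
    (hne : ¬(a = 0 ∧ b = n - 1)) : HasCriticalCycle n (deletePair K a b) ε s where
  three_le := h.three_le
  eps_symm := h.eps_symm
  sgn_symm := h.sgn_symm
  eps_diag := h.eps_diag
  sgn_diag := h.sgn_diag
  mag i j hi hj := by
    by_cases hij : (i = a ∧ j = b) ∨ (i = b ∧ j = a)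
    · rcases hij with ⟨rfl, rfl⟩ | ⟨rfl, rfl⟩ <;> simp [deletePair_left, deletePair_right]
    · have hij' : ¬((j = a ∧ i = b) ∨ (j = b ∧ i = a)) := by omega
      rw [deletePair_of_ne hij, deletePair_of_ne hij', h.mag i j hi hj]
  edge i hi := by
    rw [deletePair_of_ne (by omega)]
    exact h.edge i hi
  last := by
    have := h.three_le
    rw [deletePair_of_ne (by omega)]
    exact h.last
  cyc x t hc := by
    refine h.cyc x t (hc.mono fun i j hij => ⟨hij.1, hij.2.1, fun h0 => hij.2.2 ?_⟩)
    simp [_root_.deletePair, h0]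
  generic i j k l hi hj hk hl h1 h2 h3 h4 h5 h6 h7 := by
    have key : ∀ x y, _root_.deletePair K a b x y ≠ 0 → _root_.deletePair K a b x y = K x y := by
      intro x y hxy
      apply deletePair_of_ne
      intro hc
      exact hxy (if_pos hc)
    have h8 := h7
    simp only [ne_eq, mul_eq_zero, not_or] at h8
    rw [key _ _ h8.1.1.1, key _ _ h8.1.1.2, key _ _ h8.1.2, key _ _ h8.2] at h7 ⊢
    exact h.generic i j k l hi hj hk hl h1 h2 h3 h4 h5 h6 h7

/-- The rotation by `r` of the cycle `0, 1, …, n - 1`. -/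
def rot (n r x : ℕ) : ℕ := if x + r < n then x + r else x + r - n

/-- The sign change accompanying the rotation by `r`. -/
def rotSign (n r x : ℕ) : ℤˣ := if x + r < n then -1 else 1

theorem rot_lt {r x : ℕ} (hr : r < n) (hx : x < n) : rot n r x < n := by
  unfold rot; split_ifs <;> omega

theorem rot_inj {r x y : ℕ} (hx : x < n) (hy : y < n) (h : rot n r x = rot n r y) :
    x = y := by
  unfold rot at h; split_ifs at h <;> omega

/-- For `r > 0`, rotation moves the edge with `s = -1` to the pair `n - 1 - r`, `n - r`. The
coboundary of `rotSign` changes sign along the Hamiltonian cycle exactly there and at the new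
closing edge, so it moves the -1 back to the end. -/
theorem rotate (h : HasCriticalCycle n K ε s) {r : ℕ} (hr : r < n) :
    HasCriticalCycle n (fun i j => K (rot n r i) (rot n r j))
      (fun i j => ε (rot n r i) (rot n r j))
      (fun i j => s (rot n r i) (rot n r j) * (rotSign n r i * rotSign n r j)) where
  three_le := h.three_le
  eps_symm i j := h.eps_symm _ _
  sgn_symm i j := by rw [h.sgn_symm, mul_comm (rotSign n r i)]
  eps_diag i := h.eps_diag _
  sgn_diag i := by rw [h.sgn_diag, Int.units_mul_self]; rfl
  mag i j hi hj := h.mag _ _ (rot_lt hr hi) (rot_lt hr hj)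
  edge i hi := by
    rcases lt_trichotomy (i + 1 + r) n with h1 | h1 | h1
    · have e1 : rot n r i = i + r := if_pos (by omega)
      have e2 : rot n r (i + 1) = i + r + 1 := by rw [rot, if_pos h1]; omega
      have e3 : rotSign n r i = -1 := if_pos (by omega)
      have e4 : rotSign n r (i + 1) = -1 := if_pos h1
      have := h.edge (i + r) (by omega)
      rw [e1, e2, e3, e4, this.2.2]
      exact ⟨this.1, this.2.1, rfl⟩
    · have e1 : rot n r i = n - 1 := by rw [rot, if_pos (by omega)]; omega
      have e2 : rot n r (i + 1) = 0 := by rw [rot, if_neg (by omega)]; omega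
      have e3 : rotSign n r i = -1 := if_pos (by omega)
      have e4 : rotSign n r (i + 1) = 1 := if_neg (by omega)
      rw [e1, e2, e3, e4, h.last.2.2]
      exact ⟨h.last.1, h.last.2.1, rfl⟩
    · have e1 : rot n r i = i + r - n := if_neg (by omega)
      have e2 : rot n r (i + 1) = i + r - n + 1 := by rw [rot, if_neg (by omega)]; omega
      have e3 : rotSign n r i = 1 := if_neg (by omega)
      have e4 : rotSign n r (i + 1) = 1 := if_neg (by omega)
      have := h.edge (i + r - n) (by omega)
      rw [e1, e2, e3, e4, this.2.2]
      exact ⟨this.1, this.2.1, rfl⟩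
  last := by
    have h3 := h.three_le
    rcases Nat.eq_zero_or_pos r with rfl | h0
    · have e1 : rot n 0 (n - 1) = n - 1 := if_pos (by omega)
      have e2 : rot n 0 0 = 0 := if_pos (by omega)
      have e3 : rotSign n 0 (n - 1) = -1 := if_pos (by omega)
      have e4 : rotSign n 0 0 = -1 := if_pos (by omega)
      rw [e1, e2, e3, e4, h.last.2.2]
      exact ⟨h.last.1, h.last.2.1, rfl⟩
    · have e1 : rot n r (n - 1) = r - 1 := by rw [rot, if_neg (by omega)]; omega
      have e2 : rot n r 0 = r - 1 + 1 := by rw [rot, if_pos (by omega)]; omega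
      have e3 : rotSign n r (n - 1) = 1 := if_neg (by omega)
      have e4 : rotSign n r 0 = -1 := if_pos (by omega)
      have := h.edge (r - 1) (by omega)
      rw [e1, e2, e3, e4, this.2.2]
      exact ⟨this.1, this.2.1, rfl⟩
  cyc x t hc hl he := by
    have hmap : ∀ F : ℕ → ℕ → ℤˣ, pathProd (fun i j => F (rot n r i) (rot n r j))
        (x :: (t ++ [x])) = pathProd F (rot n r x :: (t.map (rot n r) ++ [rot n r x])) := by
      intro F
      rw [← pathProd_map]
      simp
    have hlt : ∀ y ∈ x :: t, y < n := by
      intro y hy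
      have h1 := hc.2.2
      rw [← List.cons_append, List.isChain_iff_forall_rel_of_append_cons_cons] at h1
      obtain ⟨l₁, l₂, h2⟩ := List.append_of_mem hy
      cases l₂ with
      | nil => exact (h1 (a := y) (b := x) (l₁ := l₁) (l₂ := []) (by rw [h2]; simp)).1
      | cons z l₂ => exact (h1 (a := y) (b := z) (l₁ := l₁) (l₂ := l₂ ++ [x]) (by rw [h2]; simp)).1
    rw [pathProd_mul, pathProd_eq_one_of_coboundary, mul_one, hmap]
    refine h.cyc _ _ ⟨?_, by simpa using hc.2.1, ?_⟩ (by simpa using hl) (by rwa [hmap] at he)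
    · rw [← List.map_cons]
      exact hc.1.map_on fun a ha b hb hab => rot_inj (hlt a ha) (hlt b hb) hab
    · have := hc.2.2
      rw [show rot n r x :: (t.map (rot n r) ++ [rot n r x]) = (x :: (t ++ [x])).map (rot n r) by
        simp, List.isChain_map]
      exact this.imp fun a b hab => ⟨rot_lt hr hab.1, rot_lt hr hab.2.1, hab.2.2⟩
  generic i j k l hi hj hk hl h1 h2 h3 h4 h5 h6 :=
    h.generic _ _ _ _ (rot_lt hr hi) (rot_lt hr hj) (rot_lt hr hk) (rot_lt hr hl)
      (fun e => h1 (rot_inj hi hj e)) (fun e => h2 (rot_inj hi hk e))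
      (fun e => h3 (rot_inj hi hl e)) (fun e => h4 (rot_inj hj hk e))
      (fun e => h5 (rot_inj hj hl e)) (fun e => h6 (rot_inj hk hl e))

theorem bijective_rot {r : ℕ} (hr : r < n) :
    Function.Bijective fun x : Fin n => (⟨rot n r x, rot_lt hr x.2⟩ : Fin n) :=
  Finite.injective_iff_bijective.1 fun x y h => Fin.ext (rot_inj x.2 y.2 (congrArg Fin.val h))

theorem det_rot (K : ℕ → ℕ → ℝ) {r : ℕ} (hr : r < n) :
    (toMat n fun i j => K (rot n r i) (rot n r j)).det = (toMat n K).det := by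
  rw [← det_submatrix_equiv_self (Equiv.ofBijective _ (bijective_rot hr)) (toMat n K)]
  congr 1

theorem det_rot_sgn (K : ℕ → ℕ → ℝ) (s : ℕ → ℕ → ℤˣ) {r : ℕ} (hr : r < n) :
    (toMat n (signMul (fun i j => s (rot n r i) (rot n r j) * (rotSign n r i * rotSign n r j))
      fun i j => K (rot n r i) (rot n r j))).det = (toMat n (signMul s K)).det := by
  rw [← det_rot (signMul s K) hr, ← det_sign_conj (toMat n fun i j =>
    signMul s K (rot n r i) (rot n r j)) (fun i => ((rotSign n r i : ℤ) : ℝ))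
    (fun i => unit_cast_mul_self _)]
  congr 1
  ext i j
  simp only [toMat, signMul, of_apply]
  push_cast
  ring

theorem signMul_eq_self (h : HasCriticalCycle n K ε s) {i j : ℕ} (hi : i < n) (hj : j < n)
    (hs : K i j ≠ 0 → s i j = 1) :
    signMul s K i j = K i j ∧ signMul s K j i = K j i := by
  by_cases h0 : K i j = 0
  · simp [signMul, h.mag i j hi hj, h0]
  · simp [signMul, h.sgn_symm j i, hs h0]

theorem signMul_eq_transpose (h : HasCriticalCycle n K ε s) {i j : ℕ} (hi : i < n) (hj : j < n)
    (hs : K i j ≠ 0 → s i j = ε i j) :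
    signMul s K i j = K j i ∧ signMul s K j i = K i j := by
  by_cases h0 : K i j = 0
  · simp [signMul, h.mag i j hi hj, h0]
  · simp only [signMul, h.sgn_symm j i, hs h0, h.mag i j hi hj, ← mul_assoc, unit_cast_mul_self,
      one_mul, and_self]

theorem signMul_eq_neg_transpose (h : HasCriticalCycle n K ε s) {i j : ℕ} (hi : i < n)
    (hj : j < n) (hs : K i j ≠ 0 → s i j = -ε i j) :
    signMul s K i j = -K j i ∧ signMul s K j i = -K i j := by
  by_cases h0 : K i j = 0
  · simp [signMul, h.mag i j hi hj, h0]
  · simp [signMul, h.sgn_symm j i, hs h0, h.mag i j hi hj, ← mul_assoc, unit_cast_mul_self]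

end HasCriticalCycle

end CriticalCycle

/-! ### A critical cycle changes the determinant: deletion of chords. -/

section CriticalCycle

open Matrix

namespace HasCriticalCycle

variable {n : ℕ} {K : ℕ → ℕ → ℝ} {ε s : ℕ → ℕ → ℤˣ}

theorem apply_symm_of_eps (h : HasCriticalCycle n K ε s) {i j : ℕ} (hi : i < n) (hj : j < n)
    (he : ε i j = 1) : K j i = K i j := by simp [h.mag i j hi hj, he]

theorem apply_antisymm_of_chord (h : HasCriticalCycle n K ε s) {i j : ℕ}
    (hc : IsChord n K i j) : K j i = -K i j := by
  have := hc.lt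
  have := hc.lt_n
  simp [h.mag i j (by omega) (by omega), h.chord_eps hc]

theorem signMul_eq_of_nested (h : HasCriticalCycle n K ε s) {m : ℕ} (hm : IsChord n K 0 m)
    (hs : s 0 m = 1) (i j : ℕ) (hi : i ≤ m) (hj : j ≤ m) : signMul s K i j = K i j := by
  have := hm.lt_n
  have := hm.ne_last
  have key : ∀ i j, i < j → j ≤ m → K i j ≠ 0 → s i j = 1 := by
    intro i j hij hjm hK
    rcases Nat.lt_or_ge (i + 1) j with h1 | h1
    · rw [← h.chord_nested hm ⟨h1, by omega, by omega, hK⟩ (Nat.zero_le _) hjm, hs]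
    · obtain rfl : j = i + 1 := by omega
      exact (h.edge i (by omega)).2.2
  rcases lt_trichotomy i j with h1 | rfl | h1
  · exact (h.signMul_eq_self (by omega) (by omega) (key i j h1 hj)).1
  · exact (h.signMul_eq_self (by omega) (by omega) fun _ => h.sgn_diag i).1
  · exact (h.signMul_eq_self (by omega) (by omega) (key j i h1 hi)).2

/-- Deleting a chord that no other chord crosses. -/
theorem det_sub_det_of_uncrossed (h : HasCriticalCycle n K ε s) {m : ℕ} (hm : IsChord n K 0 m)
    (hs : s 0 m = 1) (hno : ∀ x y, 0 < x → x < m → m < y → y < n → K x y = 0) :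
    (toMat n K).det - (toMat n (signMul s K)).det =
      (toMat n (_root_.deletePair K 0 m)).det -
        (toMat n (signMul s (_root_.deletePair K 0 m))).det := by
  obtain ⟨a1, a2, a3, a4⟩ := id hm
  have hno' : ∀ x y, 0 < x → x < m → m < y → y < n → K y x = 0 := by
    intro x y h1 h2 h3 h4
    rw [h.mag x y (by omega) h4, hno x y h1 h2 h3 h4, mul_zero]
  rw [signMul_deletePair]
  apply det_uncross (by omega) (by omega)
  · exact fun x y h1 h2 h3 h4 => ⟨hno x y h1 h2 h3 h4, hno' x y h1 h2 h3 h4⟩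
  · intro x y h1 h2 h3 h4
    simp [signMul, hno x y h1 h2 h3 h4, hno' x y h1 h2 h3 h4]
  · exact h.apply_antisymm_of_chord hm
  · exact h.signMul_eq_of_nested hm hs
  -- Chords beyond `m` span an arc disjoint from that of `0, m`, so they have `s = -1 = ε`; cycle
  -- edges have `s = 1 = ε`. Multiplying by `ε` is transposing.
  · have key : ∀ i j, m ≤ i → i < j → j < n → K i j ≠ 0 → s i j = ε i j := by
      intro i j hmi hij hjn hK
      rcases Nat.lt_or_ge (i + 1) j with h1 | h1
      · have hc : IsChord n K i j := ⟨h1, hjn, by omega, hK⟩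
        have := h.chord_disjoint hm hc hmi
        rw [hs] at this
        rw [h.chord_eps hc, this, neg_neg]
      · obtain rfl : j = i + 1 := by omega
        rw [(h.edge i hjn).2.1, (h.edge i hjn).2.2]
    intro i j hmi hi hmj hj
    rcases lt_trichotomy i j with h1 | rfl | h1
    · exact (h.signMul_eq_transpose hi hj (key i j hmi h1 hj)).1
    · exact (h.signMul_eq_self hi hi fun _ => h.sgn_diag i).1
    · exact (h.signMul_eq_transpose hj hi (key j i hmj h1 hi)).2
  -- At vertex `0` the relation is `s = -ε`: the closing edge has `s = -1`, `ε = 1`, while a chord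
  -- `0, y` encloses `0, m` and has `s = 1`, `ε = -1`. This is the twist at `0`.
  · intro y hmy hy
    apply h.signMul_eq_neg_transpose (by omega) hy
    intro hK
    by_cases hyn : y = n - 1
    · subst hyn
      rw [h.sgn_symm, h.eps_symm, h.last.2.1, h.last.2.2]
    · have hc : IsChord n K 0 y := ⟨by omega, hy, by omega, hK⟩
      rw [h.chord_eps hc, neg_neg, h.chord_nested hc hm le_rfl hmy.le, hs]

/-- Any further chord between the two arcs would be nested with, or cross, each of the given chords
in a way that gives it the sign of both; but these signs are opposite. -/
theorem eq_zero_of_crossed (h : HasCriticalCycle n K ε s) {m : ℕ} (hf : IsChord n K 0 (m + 1))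
    (he : IsChord n K m (n - 1)) (hsf : s 0 (m + 1) = 1) (hse : s m (n - 1) = -1) {x y : ℕ}
    (hx : x ≤ m) (hy : m < y) (hyn : y < n)
    (hxy : ¬((x = 0 ∨ x = m) ∧ (y = n - 1 ∨ y = m + 1))) : K x y = 0 := by
  have hne : (1 : ℤˣ) ≠ -1 := by decide
  by_contra hK
  have := he.lt
  have := hf.lt
  have hc : IsChord n K x y := ⟨by omega, hyn, by omega, hK⟩
  rcases Nat.eq_zero_or_pos x with rfl | hx0
  · have e1 := h.chord_nested hc hf le_rfl (by omega)
    have e2 := h.chord_cross hc he (by omega) (by omega) (by omega) (by omega)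
    rw [e1, hsf, hse] at e2
    exact hne e2
  rcases hx.lt_or_eq with hxm | rfl
  swap
  · have e1 := h.chord_nested he hc le_rfl (by omega)
    have e2 := h.chord_cross hf hc (by omega) (by omega) (by omega) (by omega)
    rw [← e1, hsf, hse] at e2
    exact hne e2
  by_cases h1 : y = m + 1
  · subst h1
    have e1 := h.chord_nested hf hc (by omega) le_rfl
    have e2 := h.chord_cross hc he hxm (by omega) (by omega) (by omega)
    rw [← e1, hsf, hse] at e2
    exact hne e2
  have e2 := h.chord_cross hf hc (by omega) (by omega) (by omega) (by omega)
  by_cases h2 : y = n - 1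
  · subst h2
    have e1 := h.chord_nested hc he (by omega) le_rfl
    rw [e1, hsf, hse] at e2
    exact hne e2
  · have e1 := h.chord_cross hc he hxm (by omega) (by omega) (by omega)
    rw [e1, hsf, hse] at e2
    exact hne e2

/-- Deleting a pair of crossing chords. -/
theorem det_sub_det_of_crossed (h : HasCriticalCycle n K ε s) {m : ℕ}
    (hf : IsChord n K 0 (m + 1)) (he : IsChord n K m (n - 1)) (hsf : s 0 (m + 1) = 1)
    (hse : s m (n - 1) = -1) :
    K 0 (n - 1) * K m (m + 1) * ((toMat n K).det - (toMat n (signMul s K)).det) =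
      (K 0 (n - 1) * K m (m + 1) - K m (n - 1) * K 0 (m + 1)) *
      ((toMat n (_root_.deletePair (_root_.deletePair K 0 (m + 1)) m (n - 1))).det -
        (toMat n (signMul s
          (_root_.deletePair (_root_.deletePair K 0 (m + 1)) m (n - 1)))).det) := by
  obtain ⟨a1, a2, a3, a4⟩ := id hf
  obtain ⟨b1, b2, b3, b4⟩ := id he
  -- Among the edges between the arcs, exactly those at `n - 1` have `s = -1`: the closing edge and
  -- the chord from `m`. Conjugating by -1 at `n - 1` restores them and yields the form required by
  -- `det_cross`.
  let d : ℕ → ℝ := fun i => if i = n - 1 then -1 else 1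
  have hd : ∀ i, d i * d i = 1 := by intro i; simp only [d]; split_ifs <;> norm_num
  have hdl : d (n - 1) = -1 := if_pos rfl
  have hdn : ∀ i, i ≠ n - 1 → d i = 1 := fun i hi => if_neg hi
  have hconj : ∀ P : ℕ → ℕ → ℝ, (toMat n P).det = (toMat n fun i j => d i * P i j * d j).det :=
    fun P => (det_sign_conj (toMat n P) (fun i => d i) fun i => hd i).symm
  have hdel : ∀ (P : ℕ → ℕ → ℝ) (a b : ℕ), (fun i j => d i * _root_.deletePair P a b i j * d j) =
      _root_.deletePair (fun i j => d i * P i j * d j) a b := by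
    intro P a b
    funext i j
    simp only [_root_.deletePair]
    split_ifs <;> simp
  rw [signMul_deletePair, signMul_deletePair, hconj (signMul s K),
    hconj (_root_.deletePair (_root_.deletePair (signMul s K) 0 (m + 1)) m (n - 1)), hdel, hdel]
  have hzero : ∀ x y, x ≤ m → m < y → y < n →
      ¬((x = 0 ∨ x = m) ∧ (y = n - 1 ∨ y = m + 1)) → K x y = 0 ∧ K y x = 0 := by
    intro x y h1 h2 h3 h4
    have := h.eq_zero_of_crossed hf he hsf hse h1 h2 h3 h4
    exact ⟨this, by rw [h.mag x y (by omega) h3, this, mul_zero]⟩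
  have edge_m := h.edge m (by omega)
  -- Chords within the second arc are nested in the chord `m, n - 1`, so they share its sign -1.
  have key : ∀ i j, m < i → i < j → j < n → K i j ≠ 0 → s i j = ε i j := by
    intro i j hmi hij hjn hK
    rcases Nat.lt_or_ge (i + 1) j with h1 | h1
    · have hc : IsChord n K i j := ⟨h1, hjn, by omega, hK⟩
      rw [h.chord_eps hc, ← h.chord_nested he hc hmi.le (by omega), hse]
    · obtain rfl : j = i + 1 := by omega
      rw [(h.edge i hjn).2.1, (h.edge i hjn).2.2]
  apply det_cross (by omega) (by omega)
  · exact hzero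
  · exact (h.apply_symm_of_eps (i := n - 1) (j := 0) (by omega) (by omega) h.last.2.1).symm
  · exact h.apply_symm_of_eps (by omega) (by omega) edge_m.2.1
  · exact h.apply_antisymm_of_chord he
  · exact h.apply_antisymm_of_chord hf
  · intro x y hx hy hyn
    by_cases hxy : ((x = 0 ∨ x = m) ∧ (y = n - 1 ∨ y = m + 1))
    · obtain ⟨rfl | rfl, rfl | rfl⟩ := hxy
      · simp only [hdl, hdn 0 (by omega), signMul, h.sgn_symm 0, h.last.2.2]
        simp
      · simp only [hdn (m + 1) (by omega), hdn 0 (by omega), signMul, h.sgn_symm (m + 1), hsf]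
        simp
      · simp only [hdl, hdn x (by omega), signMul, h.sgn_symm (n - 1), hse]
        simp
      · simp only [hdn (x + 1) (by omega), hdn x (by omega), signMul, h.sgn_symm (x + 1),
          edge_m.2.2]
        simp
    · simp [signMul, hzero x y hx hy hyn hxy]
  · intro i j hi hj
    simp only [hdn i (by omega), hdn j (by omega), one_mul, mul_one]
    exact h.signMul_eq_of_nested hf hsf i j (by omega) (by omega)
  · intro i j hmi hi hmj hj
    simp only [hdn i (by omega), hdn j (by omega), one_mul, mul_one]
    rcases lt_trichotomy i j with h1 | rfl | h1
    · exact (h.signMul_eq_transpose (by omega) (by omega) (key i j hmi h1 (by omega))).1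
    · exact (h.signMul_eq_self (by omega) (by omega) fun _ => h.sgn_diag i).1
    · exact (h.signMul_eq_transpose (by omega) (by omega) (key j i hmj h1 (by omega))).2
  · intro y hmy hy
    have := h.signMul_eq_transpose (by omega) (by omega)
      (key y (n - 1) hmy (by omega) (by omega))
    simp only [hdn y (by omega), hdl, this.1, this.2]
    constructor <;> ring
  · simp [hdl, (h.signMul_eq_self (i := n - 1) (j := n - 1) (by omega) (by omega)
      fun _ => h.sgn_diag _).1]

/-- The number of nonzero entries. -/
noncomputable def numNonzero (n : ℕ) (K : ℕ → ℕ → ℝ) : ℕ :=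
  (Finset.univ.filter fun p : Fin n × Fin n => K p.1 p.2 ≠ 0).card

theorem numNonzero_deletePair_lt {a b : ℕ} (ha : a < n) (hb : b < n) (hK : K a b ≠ 0) :
    numNonzero n (_root_.deletePair K a b) < numNonzero n K := by
  apply Finset.card_lt_card
  rw [Finset.ssubset_iff_of_subset]
  · refine ⟨(⟨a, ha⟩, ⟨b, hb⟩), by simpa using hK, ?_⟩
    simp [deletePair_left]
  · intro p hp
    rw [Finset.mem_filter] at hp ⊢
    exact ⟨hp.1, fun h0 => hp.2 (by simp [_root_.deletePair, h0])⟩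

theorem numNonzero_deletePair_le {a b : ℕ} :
    numNonzero n (_root_.deletePair K a b) ≤ numNonzero n K := by
  apply Finset.card_le_card
  intro p hp
  rw [Finset.mem_filter] at hp ⊢
  exact ⟨hp.1, fun h0 => hp.2 (by simp [_root_.deletePair, h0])⟩

theorem numNonzero_rot (K : ℕ → ℕ → ℝ) {r : ℕ} (hr : r < n) :
    numNonzero n (fun i j => K (rot n r i) (rot n r j)) = numNonzero n K := by
  let e := Equiv.ofBijective _ (bijective_rot hr)
  apply Finset.card_equiv (e.prodCongr e)
  intro p
  simp [e]

/-- Only cycle edges, of charge 1, remain off the diagonal, so `K` is symmetric and `s` alters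
nothing but the two corners. -/
theorem det_ne_of_no_chord (h : HasCriticalCycle n K ε s) (hno : ∀ i j, ¬IsChord n K i j) :
    (toMat n K).det ≠ (toMat n (signMul s K)).det := by
  obtain ⟨m, rfl⟩ : ∃ m, n = m + 1 := ⟨n - 1, by have := h.three_le; omega⟩
  have h3 := h.three_le
  have hlast : K m 0 ≠ 0 ∧ ε m 0 = 1 ∧ s m 0 = -1 := h.last
  have hz : ∀ i j, i + 1 < j → j < m + 1 → ¬(i = 0 ∧ j = m) → K i j = 0 := by
    intro i j h1 h2 h4
    by_contra hK
    exact hno i j ⟨h1, h2, h4, hK⟩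
  have key : ∀ i j, i < j → j < m + 1 → K j i = K i j := by
    intro i j hij hj
    by_cases h1 : i + 1 < j
    · by_cases h2 : i = 0 ∧ j = m
      · obtain ⟨rfl, rfl⟩ := h2
        exact (h.apply_symm_of_eps (by omega) (by omega) hlast.2.1).symm
      · rw [h.mag i j (by omega) hj, hz i j h1 hj h2, mul_zero]
    · obtain rfl : j = i + 1 := by omega
      exact h.apply_symm_of_eps (by omega) (by omega) (h.edge i hj).2.1
  have hsgn : ∀ i j, i < j → j < m + 1 → ¬(i = 0 ∧ j = m) →
      signMul s K i j = K i j ∧ signMul s K j i = K j i := by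
    intro i j hij hj h2
    apply h.signMul_eq_self (by omega) hj
    intro hK
    by_cases h1 : i + 1 < j
    · exact absurd (hz i j h1 hj h2) hK
    · obtain rfl : j = i + 1 := by omega
      exact (h.edge i hj).2.2
  apply det_ne_of_cyclic_tridiagonal (by omega)
  · intro i j
    simp only [toMat, of_apply]
    rcases lt_trichotomy (i : ℕ) j with h1 | h1 | h1
    · exact (key _ _ h1 j.2).symm
    · rw [h1]
    · exact key _ _ h1 i.2
  · intro i j h1 h2
    simp only [toMat, of_apply]
    rw [key j i (by omega) i.2, hz j i h1 i.2 h2]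
  · intro i
    simp only [toMat, of_apply, Fin.val_succ, Fin.val_castSucc]
    exact h.ne_zero_symm (by omega) (by omega) (h.edge i (by omega)).1
  · simpa [toMat] using hlast.1
  · simp [toMat, signMul, h.sgn_symm 0, hlast.2.2]
  · simp [toMat, signMul, hlast.2.2]
  · intro i j h1 h2
    simp only [toMat, of_apply]
    rcases lt_trichotomy (i : ℕ) j with h4 | h4 | h4
    · refine (hsgn _ _ h4 j.2 ?_).1
      rintro ⟨h5, h6⟩
      exact h1 ⟨Fin.ext (by simpa using h5), Fin.ext (by simpa using h6)⟩
    · rw [h4]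
      exact (h.signMul_eq_self j.2 j.2 fun _ => h.sgn_diag _).1
    · refine (hsgn _ _ h4 i.2 ?_).2
      rintro ⟨h5, h6⟩
      exact h2 ⟨Fin.ext (by simpa using h6), Fin.ext (by simpa using h5)⟩

/-- The sign change of a critical cycle changes the determinant. -/
theorem det_ne (h : HasCriticalCycle n K ε s) :
    (toMat n K).det ≠ (toMat n (signMul s K)).det := by
  induction hN : numNonzero n K using Nat.strong_induction_on generalizing K ε s with
  | _ N ih =>
  subst hN
  have uncross : ∀ {K : ℕ → ℕ → ℝ} {ε s : ℕ → ℕ → ℤˣ} (h : HasCriticalCycle n K ε s) {m : ℕ}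
      (hm : IsChord n K 0 m) (hs : s 0 m = 1)
      (hno : ∀ x y, 0 < x → x < m → m < y → y < n → K x y = 0)
      (ih : ∀ k < numNonzero n K, ∀ {K : ℕ → ℕ → ℝ} {ε s : ℕ → ℕ → ℤˣ},
        HasCriticalCycle n K ε s → numNonzero n K = k →
          (toMat n K).det ≠ (toMat n (signMul s K)).det),
      (toMat n K).det ≠ (toMat n (signMul s K)).det := by
    intro K ε s h m hm hs hno ih
    have hlt := numNonzero_deletePair_lt (n := n) (a := 0) (b := m)
      (by have := hm.lt_n; omega) hm.lt_n hm.ne_zero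
    have h1 := ih _ hlt (h.deletePair hm.lt hm.lt_n hm.ne_last) rfl
    have h2 := h.det_sub_det_of_uncrossed hm hs hno
    intro h3
    rw [h3, sub_self] at h2
    exact h1 (sub_eq_zero.1 h2.symm)
  have cross : ∀ {K : ℕ → ℕ → ℝ} {ε s : ℕ → ℕ → ℤˣ} (h : HasCriticalCycle n K ε s) {m : ℕ}
      (hf : IsChord n K 0 (m + 1)) (he : IsChord n K m (n - 1)) (hsf : s 0 (m + 1) = 1)
      (hse : s m (n - 1) = -1)
      (ih : ∀ k < numNonzero n K, ∀ {K : ℕ → ℕ → ℝ} {ε s : ℕ → ℕ → ℤˣ},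
        HasCriticalCycle n K ε s → numNonzero n K = k →
          (toMat n K).det ≠ (toMat n (signMul s K)).det),
      (toMat n K).det ≠ (toMat n (signMul s K)).det := by
    intro K ε s h m hf he hsf hse ih
    obtain ⟨a1, a2, a3, a4⟩ := id hf
    obtain ⟨b1, b2, b3, b4⟩ := id he
    have hlt := numNonzero_deletePair_lt (n := n) (a := 0) (b := m + 1) (by omega) a2 a4
    have hlt' := (numNonzero_deletePair_le (n := n) (K := _root_.deletePair K 0 (m + 1))
      (a := m) (b := n - 1)).trans_lt hlt
    have h1 := ih _ hlt' ((h.deletePair hf.lt hf.lt_n hf.ne_last).deletePair he.lt he.lt_n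
      he.ne_last) rfl
    have h2 := h.det_sub_det_of_crossed hf he hsf hse
    intro h3
    rw [h3, sub_self, mul_zero] at h2
    rcases mul_eq_zero.1 h2.symm with h4 | h4
    · have hp := h.apply_symm_of_eps (i := n - 1) (j := 0) (by omega) (by omega) h.last.2.1
      have em := h.edge m (by omega)
      have hq := h.apply_symm_of_eps (i := m) (j := m + 1) (by omega) (by omega) em.2.1
      have hu := h.apply_antisymm_of_chord hf
      -- The factor in front of the reduced difference vanishes only if opposite edges of the
      -- four-cycle `n - 1, 0, m + 1, m` have equal products, which genericity excludes.
      have := h.generic (n - 1) 0 (m + 1) m (by omega) (by omega) (by omega) (by omega) (by omega)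
        (by omega) (by omega) (by omega) (by omega) (by omega)
        (mul_ne_zero (mul_ne_zero (mul_ne_zero h.last.1 a4) (hq ▸ em.1)) b4)
      apply this
      rw [← hp, hq]
      congr 1
      linarith
    · exact h1 (sub_eq_zero.1 h4)
  have uncross' : ∀ {K : ℕ → ℕ → ℝ} {ε s : ℕ → ℕ → ℤˣ} (h : HasCriticalCycle n K ε s) {m : ℕ}
      (hm : IsChord n K 0 m)
      (hno : ∀ x y, 0 < x → x < m → m < y → y < n → K x y = 0)
      (ih : ∀ k < numNonzero n K, ∀ {K : ℕ → ℕ → ℝ} {ε s : ℕ → ℕ → ℤˣ},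
        HasCriticalCycle n K ε s → numNonzero n K = k →
          (toMat n K).det ≠ (toMat n (signMul s K)).det),
      (toMat n K).det ≠ (toMat n (signMul s K)).det := by
    intro K ε s h m hm hno ih
    rcases Int.units_eq_one_or (s 0 m) with hs | hs
    · exact uncross h hm hs hno ih
    · rw [← h.det_mul_eps]
      refine uncross h.mul_eps hm ?_ hno ih
      rw [hs, h.chord_eps hm]
      rfl
  have cross' : ∀ {K : ℕ → ℕ → ℝ} {ε s : ℕ → ℕ → ℤˣ} (h : HasCriticalCycle n K ε s) {m : ℕ}
      (hf : IsChord n K 0 (m + 1)) (he : IsChord n K m (n - 1))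
      (hsfe : s 0 (m + 1) = -s m (n - 1))
      (ih : ∀ k < numNonzero n K, ∀ {K : ℕ → ℕ → ℝ} {ε s : ℕ → ℕ → ℤˣ},
        HasCriticalCycle n K ε s → numNonzero n K = k →
          (toMat n K).det ≠ (toMat n (signMul s K)).det),
      (toMat n K).det ≠ (toMat n (signMul s K)).det := by
    intro K ε s h m hf he hsfe ih
    rcases Int.units_eq_one_or (s m (n - 1)) with hs | hs
    · rw [← h.det_mul_eps]
      rw [hs] at hsfe
      refine cross h.mul_eps hf he ?_ ?_ ih
      · rw [hsfe, h.chord_eps hf]; rfl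
      · rw [hs, h.chord_eps he]; rfl
    · rw [hs] at hsfe
      exact cross h hf he hsfe hs ih
  by_cases hex : ∃ i j, IsChord n K i j
  swap
  · push Not at hex
    exact h.det_ne_of_no_chord hex
  by_cases hcr : ∃ i j k l, IsChord n K i j ∧ IsChord n K k l ∧ i < k ∧ k < j ∧ j < l
  · obtain ⟨i, j, k, l, hc, hc', h1, h2, h3⟩ := hcr
    have hjn := hc.lt_n
    have hln := hc'.lt_n
    by_cases hs : s i j = s k l
    -- Equal signs contradict the second crossing relation unless its cycle is Hamiltonian. Rotating
    -- by `i + 1` brings this pair to the standard position, where `rotSign` makes the signs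
    -- opposite.
    · have hadj : k = i + 1 ∧ l = j + 1 := by
        by_contra hne
        rw [h.chord_cross' hc hc' h1 h2 h3 hne] at hs
        rcases Int.units_eq_one_or (s k l) with h4 | h4 <;> rw [h4] at hs <;> revert hs <;> decide
      obtain ⟨rfl, rfl⟩ := hadj
      have hl1 := hc'.lt
      have hr : i + 1 < n := by omega
      rw [← det_rot K hr, ← det_rot_sgn K s hr]
      have e0 : rot n (i + 1) 0 = i + 1 := by rw [rot, if_pos (by omega)]; omega
      have e1 : rot n (i + 1) (j - i - 1) = j := by rw [rot, if_pos (by omega)]; omega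
      have e2 : rot n (i + 1) (j - i - 1 + 1) = j + 1 := by rw [rot, if_pos (by omega)]; omega
      have e3 : rot n (i + 1) (n - 1) = i := by rw [rot, if_neg (by omega)]; omega
      have f0 : rotSign n (i + 1) 0 = -1 := if_pos (by omega)
      have f1 : rotSign n (i + 1) (j - i - 1) = -1 := if_pos (by omega)
      have f2 : rotSign n (i + 1) (j - i - 1 + 1) = -1 := if_pos (by omega)
      have f3 : rotSign n (i + 1) (n - 1) = 1 := if_neg (by omega)
      refine cross' (h.rotate hr) (m := j - i - 1) ⟨by omega, by omega, by omega, ?_⟩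
        ⟨by omega, by omega, by omega, ?_⟩ ?_ ?_
      · rw [e0, e2]; exact hc'.ne_zero
      · rw [e1, e3]; exact h.ne_zero_symm (by omega) (by omega) hc.ne_zero
      · rw [e0, e1, e2, e3, f0, f1, f2, f3, ← hs, h.sgn_symm j i]
        simp
      · rw [numNonzero_rot K hr]
        exact ih
    -- Distinct signs contradict the first crossing relation unless its cycle is Hamiltonian, and
    -- then the pair is already in standard position.
    · have hpos : i = 0 ∧ k + 1 = j ∧ l = n - 1 := by
        by_contra hne
        exact hs (h.chord_cross hc hc' h1 h2 h3 hne)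
      obtain ⟨rfl, rfl, rfl⟩ := hpos
      refine cross' h hc hc' ?_ ih
      exact Int.units_ne_iff_eq_neg.1 hs
  · obtain ⟨i, j, hc⟩ := hex
    have hij := hc.lt
    have hjn := hc.lt_n
    have hin : i < n := by omega
    have hlast := hc.ne_last
    rw [← det_rot K hin, ← det_rot_sgn K s hin]
    have e0 : rot n i 0 = i := by rw [rot, if_pos (by omega)]; omega
    have e1 : rot n i (j - i) = j := by rw [rot, if_pos (by omega)]; omega
    refine uncross' (h.rotate hin) (m := j - i) ⟨by omega, by omega, by omega, ?_⟩ ?_ ?_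
    · rw [e0, e1]; exact hc.ne_zero
    · intro x y hx hxm hy hyn
      by_contra hK
      have ex : rot n i x = x + i := if_pos (by omega)
      simp only [ex] at hK
      apply hcr
      by_cases hyi : y + i < n
      · have ey : rot n i y = y + i := if_pos hyi
        rw [ey] at hK
        exact ⟨i, j, x + i, y + i, hc, ⟨by omega, by omega, by omega, hK⟩, by omega, by omega,
          by omega⟩
      · have ey : rot n i y = y + i - n := if_neg hyi
        rw [ey] at hK
        exact ⟨y + i - n, x + i, i, j, ⟨by omega, by omega, by omega,
          h.ne_zero_symm (by omega) (by omega) hK⟩, hc, by omega, by omega, by omega⟩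
    · rw [numNonzero_rot K hin]
      exact ih

end HasCriticalCycle

end CriticalCycle

/-! ### Cycles of charge 1 have trivial sign change. -/

section PositiveCycles

open Matrix

/-- `ε` records the symmetry type of the entries of `K`, and `s` the sign changes from `K` to
`K'`. -/
structure SignRelated {V : Type*} (K K' : V → V → ℝ) (ε s : V → V → ℤˣ) : Prop where
  eps_symm : ∀ i j, ε i j = ε j i
  sgn_symm : ∀ i j, s i j = s j i
  eps_diag : ∀ i, ε i i = 1
  sgn_diag : ∀ i, s i i = 1
  mag : ∀ i j, K j i = ((ε i j : ℤ) : ℝ) * K i j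
  rel : ∀ i j, K' i j = ((s i j : ℤ) : ℝ) * K i j

theorem pathProd_range_succ {M : Type*} [CommMonoid M] (F : ℕ → ℕ → M) (m : ℕ) :
    pathProd F (List.range (m + 1)) = ∏ j ∈ Finset.range m, F j (j + 1) := by
  induction m with
  | zero => rfl
  | succ m ih =>
    rw [List.range_succ, Finset.prod_range_succ, ← ih]
    rw [pathProd_append F (a := m) (b := m + 1) (by simp [List.range_succ]) rfl]
    simp

theorem abs_unit_cast (u : ℤˣ) : |((u : ℤ) : ℝ)| = 1 := by
  rcases Int.units_eq_one_or u with h | h <;> simp [h]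

theorem det_eq_principalMinor {N n : ℕ} (K : Matrix (Fin N) (Fin N) ℝ) (z : ℕ → Fin N)
    (S : Finset (Fin N)) (hz : ∀ i j, i < n → j < n → z i = z j → i = j)
    (hS : ∀ y, y ∈ S ↔ ∃ i < n, z i = y) :
    (toMat n fun i j => K (z i) (z j)).det = principalMinor K S := by
  have hbij : Function.Bijective fun i : Fin n => (⟨z i, (hS _).2 ⟨i, i.2, rfl⟩⟩ : S) := by
    constructor
    · intro i j hij
      exact Fin.ext (hz i j i.2 j.2 (congrArg Subtype.val hij))
    · rintro ⟨y, hy⟩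
      obtain ⟨i, hi, rfl⟩ := (hS y).1 hy
      exact ⟨⟨i, hi⟩, rfl⟩
  rw [principalMinor, ← det_submatrix_equiv_self (Equiv.ofBijective _ hbij)]
  congr 1

/-- A shortest violating cycle becomes a critical cycle after restriction to its vertices and a
change of gauge. The principal minors on its vertex set would then differ. -/
theorem IsCyc.pathProd_eq_one {N : ℕ} {K K' : Matrix (Fin N) (Fin N) ℝ}
    {ε s : Fin N → Fin N → ℤˣ} (hr : SignRelated K K' ε s) (hgen : IsGeneric K)
    (hdet : ∀ S : Finset (Fin N), principalMinor K S = principalMinor K' S) (x : Fin N)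
    (t : List (Fin N)) (hc : IsCyc (fun a b => K a b ≠ 0) x t)
    (hpos : pathProd ε (x :: (t ++ [x])) = 1) : pathProd s (x :: (t ++ [x])) = 1 := by
  induction hn : t.length using Nat.strong_induction_on generalizing x t with
  | _ m ih =>
  by_contra hbad
  obtain ⟨hnd, hlen, hchain⟩ := id hc
  let z : ℕ → Fin N := fun i => (x :: t).getD i x
  have hz0 : z 0 = x := rfl
  have hlist : x :: t = (List.range (m + 1)).map z := by
    apply List.ext_getElem
    · simp [hn]
    · intro i h1 h2
      simp [z]
      rw [List.getElem?_eq_getElem h1, Option.getD_some]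
  have hzinj : ∀ i j, i < m + 1 → j < m + 1 → z i = z j → i = j := by
    intro i j hi hj hij
    rw [hlist] at hnd
    exact List.inj_on_of_nodup_map hnd (List.mem_range.2 hi) (List.mem_range.2 hj) hij
  have hclosed : ∀ F : Fin N → Fin N → ℤˣ, pathProd F (x :: (t ++ [x])) =
      (∏ j ∈ Finset.range m, F (z j) (z (j + 1))) * F (z m) (z 0) := by
    intro F
    rw [← List.cons_append, pathProd_append F (a := z m) (b := x) _ rfl]
    · rw [hlist, pathProd_map, pathProd_range_succ]
      simp [hz0]
    · rw [hlist]
      simp [List.range_succ]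
  have hne : (∀ j < m, K (z j) (z (j + 1)) ≠ 0) ∧ K (z m) (z 0) ≠ 0 := by
    rw [← List.cons_append, hlist, List.range_succ, List.map_append, List.isChain_append] at hchain
    constructor
    · intro j hj
      have h1 := hchain.1
      rw [← List.map_append, ← List.range_succ, List.isChain_map,
        List.isChain_range_succ] at h1
      exact h1 j hj
    · have := hchain.2.2
      simpa [hz0] using this
  -- Partial products along the cycle serve as gauges. Scaling row `i` by `Δ i` makes `ε` trivial
  -- along the path `z 0, …, z m`, and conjugating by `δ` does the same for `s`. The closing edge
  -- then carries the full product around the cycle.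
  let Δ : ℕ → ℤˣ := fun i => ∏ j ∈ Finset.range i, ε (z j) (z (j + 1))
  let δ : ℕ → ℤˣ := fun i => ∏ j ∈ Finset.range i, s (z j) (z (j + 1))
  let K₂ : ℕ → ℕ → ℝ := fun i j => ((Δ i : ℤ) : ℝ) * K (z i) (z j)
  let ε₂ : ℕ → ℕ → ℤˣ := fun i j => ε (z i) (z j) * (Δ i * Δ j)
  let s₂ : ℕ → ℕ → ℤˣ := fun i j => s (z i) (z j) * (δ i * δ j)
  have hK₂ : ∀ i j, K₂ i j ≠ 0 ↔ K (z i) (z j) ≠ 0 := by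
    intro i j
    simp [K₂]
  have habs : ∀ i j, |K₂ i j| = |K (z i) (z j)| := by
    intro i j
    simp [K₂, abs_mul, abs_unit_cast]
  have hcancel : ∀ u v : ℤˣ, u * (v * (v * u)) = 1 := by decide
  have hcrit : HasCriticalCycle (m + 1) K₂ ε₂ s₂ := by
    refine ⟨by omega, ?_, ?_, ?_, ?_, ?_, ?_, ?_, ?_, ?_⟩
    · intro i j
      simp only [ε₂, hr.eps_symm (z i), mul_comm (Δ i)]
    · intro i j
      simp only [s₂, hr.sgn_symm (z i), mul_comm (δ i)]
    · intro i
      simp [ε₂, hr.eps_diag]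
    · intro i
      simp [s₂, hr.sgn_diag]
    · intro i j _ _
      simp only [K₂, ε₂, hr.mag (z i) (z j)]
      push_cast
      linear_combination (-(Δ j : ℤ) * ((ε (z i) (z j) : ℤ) : ℝ) * K (z i) (z j)) *
        unit_cast_mul_self (Δ i)
    · intro i hi
      refine ⟨(hK₂ _ _).2 (hne.1 i (by omega)), ?_, ?_⟩
      · simp only [ε₂, Δ, Finset.prod_range_succ]
        exact hcancel _ _
      · simp only [s₂, δ, Finset.prod_range_succ]
        exact hcancel _ _
    · rw [hclosed] at hpos hbad
      refine ⟨(hK₂ _ _).2 hne.2, ?_, ?_⟩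
      · simp only [ε₂, Δ, Nat.add_sub_cancel, Finset.range_zero, Finset.prod_empty, mul_one]
        rw [mul_comm]
        exact hpos
      · simp only [s₂, δ, Nat.add_sub_cancel, Finset.range_zero, Finset.prod_empty, mul_one]
        rw [mul_comm]
        exact Int.units_ne_iff_eq_neg.1 hbad
    · intro y r hyr hl hε
      have hmap : ∀ F : Fin N → Fin N → ℤˣ, pathProd (fun i j => F (z i) (z j))
          (y :: (r ++ [y])) = pathProd F (z y :: (r.map z ++ [z y])) := by
        intro F
        rw [← pathProd_map]
        simp
      have hlt : ∀ w ∈ y :: r, w < m + 1 := by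
        intro w hw
        have h1 := hyr.2.2
        rw [← List.cons_append, List.isChain_iff_forall_rel_of_append_cons_cons] at h1
        obtain ⟨l₁, l₂, h2⟩ := List.append_of_mem hw
        cases l₂ with
        | nil => exact (h1 (a := w) (b := y) (l₁ := l₁) (l₂ := []) (by rw [h2]; simp)).1
        | cons v l₂ =>
          exact (h1 (a := w) (b := v) (l₁ := l₁) (l₂ := l₂ ++ [y]) (by rw [h2]; simp)).1
      simp only [ε₂, s₂] at hε ⊢
      rw [pathProd_mul, pathProd_eq_one_of_coboundary, mul_one, hmap] at hε ⊢
      refine ih (r.map z).length (by simp; omega) (z y) (r.map z) ⟨?_, ?_, ?_⟩ hε rfl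
      · rw [← List.map_cons]
        exact hyr.1.map_on fun a ha b hb hab => hzinj a b (hlt a ha) (hlt b hb) hab
      · simpa using hyr.2.1
      · rw [show z y :: (r.map z ++ [z y]) = (y :: (r ++ [y])).map z by simp, List.isChain_map]
        exact hyr.2.2.imp fun a b hab => (hK₂ a b).1 hab.2.2
    · intro i j k l hi hj hk hl h1 h2 h3 h4 h5 h6 h7
      simp only [ne_eq, mul_eq_zero, not_or] at h7
      have hp : K (z i) (z j) * K (z j) (z k) * K (z k) (z l) * K (z l) (z i) ≠ 0 :=
        mul_ne_zero (mul_ne_zero (mul_ne_zero ((hK₂ _ _).1 h7.1.1.1) ((hK₂ _ _).1 h7.1.1.2))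
          ((hK₂ _ _).1 h7.1.2)) ((hK₂ _ _).1 h7.2)
      have := (hgen (z i) (z j) (z k) (z l) (fun e => h1 (hzinj _ _ hi hj e))
        (fun e => h2 (hzinj _ _ hi hk e)) (fun e => h3 (hzinj _ _ hi hl e))
        (fun e => h4 (hzinj _ _ hj hk e)) (fun e => h5 (hzinj _ _ hj hl e))
        (fun e => h6 (hzinj _ _ hk hl e)) hp).1
      rwa [abs_mul (K₂ i j), abs_mul (K₂ j k), habs, habs, habs, habs, ← abs_mul, ← abs_mul]
  apply hcrit.det_ne
  -- Row scaling multiplies both determinants by the same factor, and conjugation by `δ` changes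
  -- neither.
  have hrow : ∀ P : ℕ → ℕ → ℝ, (toMat (m + 1) fun i j => ((Δ i : ℤ) : ℝ) * P i j).det =
      (∏ i : Fin (m + 1), ((Δ i : ℤ) : ℝ)) * (toMat (m + 1) P).det :=
    fun P => det_mul_column (fun i : Fin (m + 1) => ((Δ i : ℤ) : ℝ)) (toMat (m + 1) P)
  have hsign : (toMat (m + 1) (signMul s₂ K₂)).det = (∏ i : Fin (m + 1), ((Δ i : ℤ) : ℝ)) *
      (toMat (m + 1) fun i j => K' (z i) (z j)).det := by
    rw [← hrow]
    refine Eq.trans ?_ (det_sign_conj _ (fun i : Fin (m + 1) => ((δ i : ℤ) : ℝ))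
      (fun i => unit_cast_mul_self _))
    congr 1
    ext i j
    simp only [toMat, signMul, of_apply, s₂, K₂, hr.rel]
    push_cast
    ring
  have hS : ∀ y, y ∈ (x :: t).toFinset ↔ ∃ i < m + 1, z i = y := by
    intro y
    rw [hlist]
    simp
  rw [hsign, show toMat (m + 1) K₂ = toMat (m + 1) fun i j => ((Δ i : ℤ) : ℝ) * K (z i) (z j)
    from rfl, hrow, det_eq_principalMinor K z _ hzinj hS, det_eq_principalMinor K' z _ hzinj hS,
    hdet]

end PositiveCycles

/-! ### Two-connected vertex sets and ears. -/

section ConnectedIn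

variable {V : Type*} {R : V → V → Prop}

/-- Any two vertices of `U` are joined by a path inside `U`. -/
def ConnectedIn (R : V → V → Prop) (U : Set V) : Prop :=
  ∀ x ∈ U, ∀ y ∈ U, Relation.ReflTransGen (fun a b => R a b ∧ a ∈ U ∧ b ∈ U) x y

theorem ConnectedIn.union {U W : Set V} (hU : ConnectedIn R U) (hW : ConnectedIn R W) {c : V}
    (hcU : c ∈ U) (hcW : c ∈ W) : ConnectedIn R (U ∪ W) := by
  have h1 : ∀ x ∈ U, ∀ y ∈ U,
      Relation.ReflTransGen (fun a b => R a b ∧ a ∈ U ∪ W ∧ b ∈ U ∪ W) x y := fun x hx y hy =>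
    Relation.ReflTransGen.mono (fun a b h => ⟨h.1, Or.inl h.2.1, Or.inl h.2.2⟩) _ _ (hU x hx y hy)
  have h2 : ∀ x ∈ W, ∀ y ∈ W,
      Relation.ReflTransGen (fun a b => R a b ∧ a ∈ U ∪ W ∧ b ∈ U ∪ W) x y := fun x hx y hy =>
    Relation.ReflTransGen.mono (fun a b h => ⟨h.1, Or.inr h.2.1, Or.inr h.2.2⟩) _ _ (hW x hx y hy)
  rintro x (hx | hx) y (hy | hy)
  · exact h1 x hx y hy
  · exact (h1 x hx c hcU).trans (h2 c hcW y hy)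
  · exact (h2 x hx c hcW).trans (h1 c hcU y hy)
  · exact h2 x hx y hy

theorem connectedIn_of_isChain (hR : ∀ x y, R x y → R y x) (l : List V) (hl : l.IsChain R) :
    ConnectedIn R {x | x ∈ l} := by
  induction l with
  | nil => intro x hx; simp at hx
  | cons a l ih =>
    cases l with
    | nil =>
      intro x hx y hy
      simp only [List.mem_singleton, Set.mem_ofPred_eq] at hx hy
      rw [hx, hy]
    | cons b l =>
      rw [List.isChain_cons_cons] at hl
      have h1 : ConnectedIn R ({a, b} : Set V) := by
        intro x hx y hy
        rcases hx with rfl | rfl <;> rcases hy with rfl | rfl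
        · rfl
        · exact .single ⟨hl.1, by simp, by simp⟩
        · exact .single ⟨hR _ _ hl.1, by simp, by simp⟩
        · rfl
      have h2 := h1.union (ih hl.2) (c := b) (by simp) (by simp)
      convert h2 using 1
      ext x
      simp only [List.mem_cons, Set.mem_ofPred_eq, Set.mem_union, Set.mem_insert_iff,
        Set.mem_singleton_iff]
      tauto

/-- The vertex set `U` induces a two-connected graph. -/
def TwoConnectedIn (R : V → V → Prop) (U : Set V) : Prop :=
  U.Nontrivial ∧ ConnectedIn R U ∧ ∀ v ∈ U, ConnectedIn R (U \ {v})

theorem TwoConnectedIn.diff {U : Set V} (hU : TwoConnectedIn R U) (v : V) :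
    ConnectedIn R (U \ {v}) := by
  by_cases hv : v ∈ U
  · exact hU.2.2 v hv
  · rw [Set.sdiff_singleton_eq_self hv]
    exact hU.2.1

/-- Whichever vertex is removed, one of `a`, `b` survives and links the two remainders. -/
theorem TwoConnectedIn.union {U W : Set V} (hU : TwoConnectedIn R U) (hW : TwoConnectedIn R W)
    {a b : V} (hab : a ≠ b) (ha : a ∈ U ∩ W) (hb : b ∈ U ∩ W) : TwoConnectedIn R (U ∪ W) := by
  refine ⟨hU.1.mono Set.subset_union_left, hU.2.1.union hW.2.1 ha.1 ha.2, fun v _ => ?_⟩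
  rw [Set.union_sdiff_distrib]
  by_cases hv : v = a
  · subst hv
    exact (hU.diff v).union (hW.diff v) (c := b) ⟨hb.1, hab.symm⟩ ⟨hb.2, hab.symm⟩
  · exact (hU.diff v).union (hW.diff v) (c := a) ⟨ha.1, Ne.symm hv⟩ ⟨ha.2, Ne.symm hv⟩

theorem IsCyc.twoConnectedIn (hR : ∀ x y, R x y → R y x) {x : V} {t : List V}
    (hc : IsCyc R x t) : TwoConnectedIn R {y | y ∈ x :: t} := by
  obtain ⟨hnd, hlen, hch⟩ := hc
  have hxt : (x :: t).IsChain R := by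
    rw [← List.cons_append] at hch
    exact hch.left_of_append
  refine ⟨?_, connectedIn_of_isChain hR _ hxt, ?_⟩
  · cases t with
    | nil => simp at hlen
    | cons y t =>
      refine ⟨x, by simp, y, by simp, ?_⟩
      rintro rfl
      simp at hnd
  · intro v hv
    rcases List.mem_cons.1 hv with rfl | hvt
    · convert connectedIn_of_isChain hR t hxt.of_cons using 1
      ext y
      have : v ∉ t := (List.nodup_cons.1 hnd).1
      simp only [List.mem_cons, Set.mem_sdiff, Set.mem_ofPred_eq, Set.mem_singleton_iff]
      constructor
      · tauto
      · intro hy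
        refine ⟨Or.inr hy, ?_⟩
        rintro rfl
        exact this hy
    · obtain ⟨A, B, rfl⟩ := List.append_of_mem hvt
      -- Removing `v` opens the cycle into a path, read off starting just after `v`.
      have h1 : (B ++ x :: A).IsChain R := by
        rw [List.isChain_split]
        constructor
        · have h2 : (x :: A ++ v :: (B ++ [x])).IsChain R := by simpa using hch
          exact (h2.right_of_append).of_cons
        · have h2 : (x :: A ++ v :: B).IsChain R := by simpa using hxt
          exact h2.left_of_append
      convert connectedIn_of_isChain hR _ h1 using 1
      ext y
      have hvn : v ≠ x ∧ v ∉ A ∧ v ∉ B := by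
        simp only [List.nodup_cons, List.mem_append, List.mem_cons, List.nodup_append] at hnd
        refine ⟨fun h => hnd.1 (Or.inr (Or.inl h.symm)), fun h => ?_, hnd.2.2.1.1⟩
        exact hnd.2.2.2 v h v (Or.inl rfl) rfl
      simp only [List.mem_cons, List.mem_append, Set.mem_sdiff, Set.mem_ofPred_eq,
        Set.mem_singleton_iff]
      constructor
      · tauto
      · intro hy
        refine ⟨by tauto, ?_⟩
        rintro rfl
        tauto

/-- A walk leaving a set contains a path up to its first vertex in the set. -/
theorem exists_path_to_set {U : Set V} {z y : V} (h : Relation.ReflTransGen R z y) (hz : z ∉ U)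
    (hy : y ∈ U) : ∃ (l : List V) (w : V), (z :: l).Nodup ∧ (∀ a ∈ z :: l, a ∉ U) ∧ w ∈ U ∧
      (z :: (l ++ [w])).IsChain R := by
  induction h using Relation.ReflTransGen.head_induction_on with
  | refl => exact absurd hy hz
  | head hab hbc ih =>
    rename_i a b
    by_cases hb : b ∈ U
    · exact ⟨[], b, by simp, by simpa using hz, hb, by simpa using hab⟩
    · obtain ⟨l, w, h1, h2, h3, h4⟩ := ih hb
      by_cases ha : a ∈ b :: l
      · obtain ⟨A, B, hAB⟩ := List.append_of_mem ha
        rw [← List.cons_append, hAB] at h4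
        rw [hAB] at h1 h2
        refine ⟨B, w, h1.of_append_right, fun c hc => h2 c (List.mem_append_right _ hc), h3, ?_⟩
        rw [List.append_assoc] at h4
        exact h4.right_of_append
      · exact ⟨b :: l, w, List.nodup_cons.2 ⟨ha, h1⟩, by
          intro c hc
          rcases List.mem_cons.1 hc with rfl | hc
          · exact hz
          · exact h2 c hc, h3, List.isChain_cons_cons.2 ⟨hab, h4⟩⟩

theorem exists_step_leaving {U : Set V} {x y : V} (h : Relation.ReflTransGen R x y) (hx : x ∈ U)
    (hy : y ∉ U) : ∃ a b, a ∈ U ∧ b ∉ U ∧ R a b := by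
  induction h using Relation.ReflTransGen.head_induction_on with
  | refl => exact absurd hx hy
  | head hab hbc ih =>
    rename_i a b
    by_cases hb : b ∈ U
    · exact ih hb
    · exact ⟨a, b, hx, hb, hab⟩

/-- A proper subset of a two-connected set has an ear. -/
theorem TwoConnectedIn.exists_ear {U W : Set V} (hU : TwoConnectedIn R U) (hWU : W ⊆ U)
    (hne : W ≠ U) (hW : W.Nontrivial) : ∃ (x y : V) (l : List V), x ∈ W ∧ y ∈ W ∧ x ≠ y ∧
      l ≠ [] ∧ l.Nodup ∧ (∀ z ∈ l, z ∈ U \ W) ∧ (x :: (l ++ [y])).IsChain R := by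
  obtain ⟨u, hu, huW⟩ : ∃ u ∈ U, u ∉ W := by
    by_contra! h
    exact hne (hWU.antisymm h)
  obtain ⟨w, hw⟩ := hW.nonempty
  obtain ⟨x, z, hx, hz, hxz⟩ := exists_step_leaving (hU.2.1 w (hWU hw) u hu) hw huW
  obtain ⟨y₀, hy₀, hyx⟩ := hW.exists_ne x
  have hzx : z ≠ x := by rintro rfl; exact hz hx
  -- The walk back to `W` avoids `x`, so the ear ends at a vertex other than `x`.
  obtain ⟨l, y, h1, h2, h3, h4⟩ := exists_path_to_set
    (hU.diff x z ⟨hxz.2.2, hzx⟩ y₀ ⟨hWU hy₀, hyx⟩) hz hy₀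
  have hmem : ∀ a ∈ z :: (l ++ [y]), a ∈ U \ {x} := by
    intro a ha
    have h5 := h4
    rw [List.isChain_iff_forall_rel_of_append_cons_cons] at h5
    obtain ⟨A, B, hAB⟩ := List.append_of_mem ha
    cases B with
    | cons b B => exact (h5 hAB).2.1
    | nil =>
      rcases List.eq_nil_or_concat A with rfl | ⟨A', b, rfl⟩
      · simp at hAB
      · rw [List.concat_eq_append, List.append_assoc, List.singleton_append] at hAB
        exact (h5 hAB).2.2
  refine ⟨x, y, z :: l, hx, h3, ?_, by simp, h1, ?_, ?_⟩
  · rintro rfl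
    exact (hmem x (by simp)).2 rfl
  · intro a ha
    refine ⟨(hmem a ?_).1, h2 a ha⟩
    rw [← List.cons_append]
    exact List.mem_append_left _ ha
  · rw [List.cons_append, List.isChain_cons_cons]
    exact ⟨hxz.1, h4.imp fun a b hab => hab.1⟩

end ConnectedIn

/-! ### Blocks as maximal two-connected vertex sets. -/

section Blocks

open SimpleGraph

variable {V : Type*} {G : SimpleGraph V}

theorem connectedIn_verts {H : G.Subgraph} (hH : H.Connected) : ConnectedIn G.Adj H.verts := by
  intro x hx y hy
  have h1 := (Subgraph.connected_iff'.1 hH).preconnected ⟨x, hx⟩ ⟨y, hy⟩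
  rw [reachable_iff_reflTransGen] at h1
  exact h1.lift Subtype.val fun a b hab => ⟨H.adj_sub hab, a.2, b.2⟩

theorem ConnectedIn.connected_induce {U : Set V} (hU : ConnectedIn G.Adj U) (hne : U.Nonempty) :
    ((⊤ : G.Subgraph).induce U).Connected := by
  rw [← connected_induce_iff]
  have : Nonempty U := hne.to_subtype
  refine ⟨fun x y => ?_⟩
  rw [reachable_iff_reflTransGen]
  have key : ∀ y : V, Relation.ReflTransGen (fun a b => G.Adj a b ∧ a ∈ U ∧ b ∈ U) x y →
      ∀ hy : y ∈ U, Relation.ReflTransGen (G.induce U).Adj x ⟨y, hy⟩ := by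
    intro y h
    induction h with
    | refl => intro _; rfl
    | tail _ hbc ih => exact fun hy => (ih hbc.2.1).tail hbc.1
  exact key y (hU x x.2 y y.2) y.2

theorem IsTwoConnected.twoConnectedIn {H : G.Subgraph} (hH : IsTwoConnected H) :
    TwoConnectedIn G.Adj H.verts :=
  ⟨hH.2.1, connectedIn_verts hH.1, fun v hv => by
    have := connectedIn_verts (hH.2.2 v hv)
    rwa [Subgraph.deleteVerts_verts] at this⟩

theorem TwoConnectedIn.isTwoConnected_induce {U : Set V} (hU : TwoConnectedIn G.Adj U) :
    IsTwoConnected ((⊤ : G.Subgraph).induce U) := by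
  refine ⟨hU.2.1.connected_induce hU.1.nonempty, hU.1, fun v _ => ?_⟩
  have h1 : ((⊤ : G.Subgraph).induce U).deleteVerts {v} = (⊤ : G.Subgraph).induce (U \ {v}) := by
    ext a b
    · simp
    · simp; tauto
  rw [h1]
  obtain ⟨w, hw, hwv⟩ := hU.1.exists_ne v
  exact (hU.diff v).connected_induce ⟨w, hw, hwv⟩

/-- Maximality among subgraphs passes to vertex sets, because the full induced subgraph on `W` is
two-connected and contains `H`. -/
theorem IsBlock.verts_maximal {H : G.Subgraph} (hH : IsBlock H) {W : Set V}
    (hW : TwoConnectedIn G.Adj W) (hHW : H.verts ⊆ W) : W ⊆ H.verts := by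
  have h1 : H ≤ (⊤ : G.Subgraph).induce W :=
    Subgraph.le_induce_top_verts.trans (Subgraph.induce_mono_right hHW)
  exact (hH.2 hW.isTwoConnected_induce h1).1

theorem IsBlock.subset_verts_of_isCyc {H : G.Subgraph} (hH : IsBlock H) {x : V} {t : List V}
    (hc : IsCyc G.Adj x t) {a b : V} (hab : a ≠ b) (ha : a ∈ x :: t) (hb : b ∈ x :: t)
    (haH : a ∈ H.verts) (hbH : b ∈ H.verts) : ∀ y ∈ x :: t, y ∈ H.verts := by
  have h1 := hH.1.twoConnectedIn.union (hc.twoConnectedIn fun _ _ h => h.symm) hab ⟨haH, ha⟩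
    ⟨hbH, hb⟩
  intro y hy
  exact hH.verts_maximal h1 Set.subset_union_left (Or.inr hy)

theorem TwoConnectedIn.exists_isBlock [Finite V] {W : Set V} (hW : TwoConnectedIn G.Adj W) :
    ∃ H : G.Subgraph, IsBlock H ∧ W ⊆ H.verts := by
  obtain ⟨H, hH1, hH2⟩ := Finite.exists_le_maximal hW.isTwoConnected_induce
  exact ⟨H, hH2, hH1.1⟩

end Blocks

/-! ### Paths of both charges, preserved by adding ears. -/

section Ears

variable {V : Type*} {R : V → V → Prop} {ε g : V → V → ℤˣ}

/-- There is a simple path for `R` inside `U` from `a` to `b` of total charge `p`. -/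
def HasPath (R : V → V → Prop) (ε : V → V → ℤˣ) (U : Set V) (a b : V) (p : ℤˣ) : Prop :=
  ∃ l : List V, l.head? = some a ∧ l.getLast? = some b ∧ l.Nodup ∧ (∀ z ∈ l, z ∈ U) ∧
    l.IsChain R ∧ pathProd ε l = p

theorem HasPath.mono {R' : V → V → Prop} {U W : Set V} {a b : V} {p : ℤˣ}
    (h : HasPath R ε U a b p) (hUW : U ⊆ W) (hR : ∀ x ∈ U, ∀ y ∈ U, R x y → R' x y) :
    HasPath R' ε W a b p := by
  obtain ⟨l, h1, h2, h3, h4, h5, h6⟩ := h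
  exact ⟨l, h1, h2, h3, fun z hz => hUW (h4 z hz),
    h5.imp_of_mem_imp fun x y hx hy => hR x (h4 x hx) y (h4 y hy), h6⟩

theorem HasPath.symm (hR : ∀ x y, R x y → R y x) (hε : ∀ x y, ε x y = ε y x) {U : Set V}
    {a b : V} {p : ℤˣ} (h : HasPath R ε U a b p) : HasPath R ε U b a p := by
  obtain ⟨l, h1, h2, h3, h4, h5, h6⟩ := h
  refine ⟨l.reverse, by rw [List.head?_reverse, h2], by rw [List.getLast?_reverse, h1],
    List.nodup_reverse.2 h3, fun z hz => h4 z (List.mem_reverse.1 hz), ?_, ?_⟩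
  · rw [List.isChain_reverse]
    exact h5.imp fun x y hxy => hR x y hxy
  · rw [pathProd_reverse hε, h6]

theorem HasPath.trans {U W : Set V} {a b c : V} {p q : ℤˣ} (h₁ : HasPath R ε U a b p)
    (h₂ : HasPath R ε W b c q) (hUW : ∀ z ∈ U, z ∈ W → z = b) :
    HasPath R ε (U ∪ W) a c (p * q) := by
  obtain ⟨l₁, h1, h2, h3, h4, h5, h6⟩ := h₁
  obtain ⟨l₂, k1, k2, k3, k4, k5, k6⟩ := h₂
  obtain ⟨A, rfl⟩ := List.getLast?_eq_some_iff.1 h2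
  obtain ⟨B, rfl⟩ := List.head?_eq_some_iff.1 k1
  refine ⟨A ++ b :: B, ?_, ?_, ?_, ?_, ?_, ?_⟩
  · cases A <;> simpa using h1
  · rw [List.getLast?_append, k2]; rfl
  · rw [List.nodup_append]
    refine ⟨h3.of_append_left, k3, ?_⟩
    rintro x hx y hy rfl
    have := hUW x (h4 x (List.mem_append_left _ hx)) (k4 x hy)
    subst this
    rw [List.nodup_append] at h3
    exact h3.2.2 x hx x (by simp) rfl
  · intro z hz
    rcases List.mem_append.1 hz with hz | hz
    · exact Or.inl (h4 z (List.mem_append_left _ hz))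
    · exact Or.inr (k4 z hz)
  · exact List.isChain_split.2 ⟨h5, k5⟩
  · rw [pathProd_append_cons, h6, k6]

/-- Distinct vertices of `U` are joined inside `U` by simple paths of both charges. -/
def Spread (R : V → V → Prop) (ε : V → V → ℤˣ) (U : Set V) : Prop :=
  ∀ x ∈ U, ∀ y ∈ U, x ≠ y → ∀ p, HasPath R ε U x y p

theorem hasPath_prefix {A : List V} {x b : V} (hx : (A ++ [b]).head? = some x)
    (hnd : (A ++ [b]).Nodup) (hch : (A ++ [b]).IsChain R) :
    HasPath R ε {z | z ∈ A ++ [b]} x b (pathProd ε (A ++ [b])) :=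
  ⟨A ++ [b], hx, by simp, hnd, fun _ hz => hz, hch, rfl⟩

theorem hasPath_suffix {B : List V} {b y : V} (hnd : (b :: (B ++ [y])).Nodup)
    (hch : (b :: (B ++ [y])).IsChain R) :
    HasPath R ε {z | z ∈ b :: (B ++ [y])} b y (pathProd ε (b :: (B ++ [y]))) :=
  ⟨b :: (B ++ [y]), rfl, List.getLast?_eq_some_iff.2 ⟨b :: B, rfl⟩, hnd, fun _ hz => hz, hch, rfl⟩

theorem units_mul_mul_cancel (p e : ℤˣ) : p * e * e = p := by
  rw [mul_assoc, Int.units_mul_self, mul_one]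

/-- A path to a vertex of the ear can be routed through a stretch inside `U` between distinct
vertices. That stretch may have either charge, so it compensates for the fixed charge of the rest.
-/
theorem Spread.ear (hR : ∀ x y, R x y → R y x) (hε : ∀ x y, ε x y = ε y x) {U : Set V}
    (hU : Spread R ε U) {x y : V} {l : List V} (hx : x ∈ U) (hy : y ∈ U) (hxy : x ≠ y)
    (hnd : l.Nodup) (hl : ∀ z ∈ l, z ∉ U) (hch : (x :: (l ++ [y])).IsChain R) :
    Spread R ε (U ∪ {z | z ∈ l}) := by
  have hnd' : (x :: (l ++ [y])).Nodup := by
    rw [List.nodup_cons, List.nodup_append]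
    refine ⟨?_, hnd, by simp, ?_⟩
    · simp only [List.mem_append, List.mem_singleton, not_or]
      exact ⟨fun h => hl x h hx, hxy⟩
    · rintro a ha b hb rfl
      rw [List.mem_singleton] at hb
      exact hl a ha (hb ▸ hy)
  have hsub : ∀ (W : Set V), (∀ z ∈ W, z = x ∨ z ∈ l ∨ z = y) → U ∪ W ⊆ U ∪ {z | z ∈ l} := by
    rintro W hW z (hz | hz)
    · exact Or.inl hz
    · rcases hW z hz with rfl | h | rfl
      · exact Or.inl hx
      · exact Or.inr h
      · exact Or.inl hy
  -- The ear is entered at `x`, unless `a = x`, when it is entered at `y` so that the stretch in `U`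
  -- is not degenerate.
  have huv : ∀ a ∈ U, ∀ b ∈ l, ∀ p, HasPath R ε (U ∪ {z | z ∈ l}) a b p := by
    intro a ha b hb p
    obtain ⟨A, B, rfl⟩ := List.append_of_mem hb
    by_cases hax : a = x
    · subst hax
      have h2 : HasPath R ε {z | z ∈ b :: (B ++ [y])} b y (pathProd ε (b :: (B ++ [y]))) := by
        apply hasPath_suffix
        · rw [List.append_assoc, List.cons_append, ← List.cons_append] at hnd'
          exact hnd'.of_append_right
        · rw [List.append_assoc, List.cons_append, ← List.cons_append] at hch
          exact hch.right_of_append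
      have h1 := hU a ha y hy hxy (p * pathProd ε (b :: (B ++ [y])))
      have h3 := h1.trans (h2.symm hR hε) ?_
      · rw [units_mul_mul_cancel] at h3
        refine h3.mono (hsub _ ?_) (fun _ _ _ _ h => h)
        intro z hz
        simp only [Set.mem_ofPred_eq, List.mem_cons, List.mem_append, List.not_mem_nil,
          or_false] at hz ⊢
        tauto
      · intro z hz hz'
        simp only [Set.mem_ofPred_eq, List.mem_cons, List.mem_append, List.not_mem_nil,
          or_false] at hz' hl
        rcases hz' with h | h | h
        · exact absurd hz (hl z (by tauto))
        · exact absurd hz (hl z (by tauto))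
        · exact h
    · have h2 : HasPath R ε {z | z ∈ x :: A ++ [b]} x b (pathProd ε (x :: A ++ [b])) := by
        apply hasPath_prefix rfl
        · have : (x :: A ++ [b] ++ (B ++ [y])).Nodup := by simpa using hnd'
          exact this.of_append_left
        · have : (x :: A ++ [b] ++ (B ++ [y])).IsChain R := by simpa using hch
          exact this.left_of_append
      have h1 := hU a ha x hx hax (p * pathProd ε (x :: A ++ [b]))
      have h3 := h1.trans h2 ?_
      · rw [units_mul_mul_cancel] at h3
        refine h3.mono (hsub _ ?_) (fun _ _ _ _ h => h)
        intro z hz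
        simp only [Set.mem_ofPred_eq, List.mem_cons, List.mem_append, List.not_mem_nil,
          or_false] at hz ⊢
        tauto
      · intro z hz hz'
        simp only [Set.mem_ofPred_eq, List.mem_cons, List.mem_append, List.not_mem_nil,
          or_false] at hz' hl
        rcases hz' with (h | h) | h
        · exact h
        · exact absurd hz (hl z (by tauto))
        · exact absurd hz (hl z (by tauto))
  -- For two vertices of the ear the path leaves outwards: from `a` back to `x`, through `U` to `y`,
  -- and back to `b`.
  have hvv : ∀ A B C : List V, ∀ a b, l = A ++ a :: B ++ b :: C → ∀ p,
      HasPath R ε (U ∪ {z | z ∈ l}) a b p := by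
    rintro A B C a b rfl p
    have h1 : HasPath R ε {z | z ∈ x :: A ++ [a]} x a (pathProd ε (x :: A ++ [a])) := by
      apply hasPath_prefix rfl
      · have : (x :: A ++ [a] ++ (B ++ b :: (C ++ [y]))).Nodup := by simpa using hnd'
        exact this.of_append_left
      · have : (x :: A ++ [a] ++ (B ++ b :: (C ++ [y]))).IsChain R := by simpa using hch
        exact this.left_of_append
    have h2 : HasPath R ε {z | z ∈ b :: (C ++ [y])} b y (pathProd ε (b :: (C ++ [y]))) := by
      apply hasPath_suffix
      · have : (x :: A ++ [a] ++ B ++ b :: (C ++ [y])).Nodup := by simpa using hnd'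
        exact this.of_append_right
      · have : (x :: A ++ [a] ++ B ++ b :: (C ++ [y])).IsChain R := by simpa using hch
        exact this.right_of_append
    have h3 := hU x hx y hy hxy
      (p * pathProd ε (x :: A ++ [a]) * pathProd ε (b :: (C ++ [y])))
    have hdis : ∀ z ∈ x :: A ++ [a], z ∉ b :: (C ++ [y]) := by
      have : (x :: A ++ [a] ++ B ++ b :: (C ++ [y])).Nodup := by simpa using hnd'
      rw [List.nodup_append] at this
      exact fun z hz hz' => this.2.2 z (List.mem_append_left _ hz) z hz' rfl
    have h4 := ((h1.symm hR hε).trans h3 ?_).trans (h2.symm hR hε) ?_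
    · have e : pathProd ε (x :: A ++ [a]) *
          (p * pathProd ε (x :: A ++ [a]) * pathProd ε (b :: (C ++ [y]))) *
          pathProd ε (b :: (C ++ [y])) = p := by
        rw [mul_assoc, mul_assoc _ (pathProd ε (b :: (C ++ [y]))), Int.units_mul_self, mul_one,
          mul_comm, units_mul_mul_cancel]
      rw [e] at h4
      refine h4.mono ?_ (fun _ _ _ _ h => h)
      rw [Set.union_comm _ U, Set.union_assoc]
      apply hsub
      intro z hz
      simp only [Set.mem_union, Set.mem_ofPred_eq, List.mem_cons, List.mem_append,
        List.not_mem_nil, or_false] at hz ⊢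
      tauto
    · intro z hz hz'
      simp only [Set.mem_ofPred_eq, List.mem_cons, List.mem_append, List.not_mem_nil,
        or_false] at hz hl
      rcases hz with (h | h) | h
      · exact h
      · exact absurd hz' (hl z (by tauto))
      · exact absurd hz' (hl z (by tauto))
    · rintro z (hz | hz) hz'
      · exact absurd hz' (hdis z hz)
      · simp only [Set.mem_ofPred_eq, List.mem_cons, List.mem_append, List.not_mem_nil,
          or_false] at hz' hl
        rcases hz' with h | h | h
        · exact absurd hz (hl z (by tauto))
        · exact absurd hz (hl z (by tauto))
        · exact h
  rintro a (ha | ha) b (hb | hb) hab p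
  · exact (hU a ha b hb hab p).mono Set.subset_union_left (fun _ _ _ _ h => h)
  · exact huv a ha b hb p
  · exact (huv b hb a ha p).symm hR hε
  · obtain ⟨A, B, hAB⟩ := List.append_of_mem (show a ∈ l from ha)
    have hb' : b ∈ A ++ a :: B := hAB ▸ hb
    rcases List.mem_append.1 hb' with h | h
    · obtain ⟨A₁, A₂, rfl⟩ := List.append_of_mem h
      exact (hvv A₁ A₂ B b a hAB p).symm hR hε
    · rcases List.mem_cons.1 h with h | h
      · exact absurd h.symm hab
      · obtain ⟨B₁, B₂, rfl⟩ := List.append_of_mem h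
        exact hvv A B₁ B₂ a b (by rw [hAB]; simp) p

/-- The two arcs between any two vertices of a cycle of charge -1 have opposite charges. -/
theorem IsCyc.spread (hR : ∀ x y, R x y → R y x) (hε : ∀ x y, ε x y = ε y x) {x : V} {t : List V}
    (hc : IsCyc R x t) (hneg : pathProd ε (x :: (t ++ [x])) = -1) :
    Spread R ε {z | z ∈ x :: t} := by
  obtain ⟨hnd, hlen, hch⟩ := hc
  have key : ∀ A B C : List V, ∀ a b, x :: t = A ++ a :: B ++ b :: C → ∀ p,
      HasPath R ε {z | z ∈ x :: t} a b p := by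
    intro A B C a b hl p
    rw [← List.cons_append, hl] at hch hneg
    rw [hl] at hnd ⊢
    have h1 : HasPath R ε {z | z ∈ a :: (B ++ [b])} a b (pathProd ε (a :: (B ++ [b]))) := by
      apply hasPath_suffix
      · have : (A ++ (a :: (B ++ [b]) ++ C)).Nodup := by simpa using hnd
        exact this.of_append_right.of_append_left
      · have : (A ++ (a :: (B ++ [b]) ++ (C ++ [x]))).IsChain R := by simpa using hch
        exact this.right_of_append.left_of_append
    have h2 : ∃ q, HasPath R ε {z | z ∈ A ++ a :: B ++ b :: C} b a q ∧
        q * pathProd ε (a :: (B ++ [b])) = -1 := by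
      cases A with
      | nil =>
        obtain rfl : x = a := by simpa using (List.cons.inj hl).1
        refine ⟨pathProd ε (b :: (C ++ [x])), ?_, ?_⟩
        · have h3 : HasPath R ε {z | z ∈ b :: (C ++ [x])} b x (pathProd ε (b :: (C ++ [x]))) := by
            apply hasPath_suffix
            · have h4 : (x :: B ++ (b :: C)).Nodup := by simpa using hnd
              rw [List.nodup_append] at h4
              rw [← List.cons_append, List.nodup_append]
              refine ⟨h4.2.1, by simp, ?_⟩
              intro u hu v hv
              rw [List.mem_singleton] at hv
              subst hv
              exact (h4.2.2 v (by simp) u hu).symm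
            · have : (x :: B ++ (b :: (C ++ [x]))).IsChain R := by simpa using hch
              exact this.right_of_append
          refine h3.mono ?_ (fun _ _ _ _ h => h)
          intro z hz
          simp only [Set.mem_ofPred_eq, List.mem_cons, List.mem_append, List.not_mem_nil,
            or_false, false_or] at hz ⊢
          tauto
        · have : pathProd ε (x :: B ++ b :: (C ++ [x])) = -1 := by simpa using hneg
          rw [pathProd_append_cons] at this
          rw [mul_comm]
          exact this
      | cons x' A =>
        obtain rfl : x = x' := by simpa using (List.cons.inj hl).1
        refine ⟨pathProd ε (b :: (C ++ x :: A ++ [a])), ?_, ?_⟩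
        · refine ⟨b :: (C ++ x :: A ++ [a]), rfl,
            List.getLast?_eq_some_iff.2 ⟨b :: (C ++ x :: A), rfl⟩, ?_, ?_, ?_, rfl⟩
          · have h4 : ((x :: A) ++ a :: B ++ (b :: C)).Nodup := by simpa using hnd
            have h5 : ((b :: C) ++ (x :: A ++ a :: B)).Nodup := List.nodup_append_comm.1 h4
            have h6 : ((b :: C ++ x :: A ++ [a]) ++ B).Nodup := by simpa using h5
            simpa using h6.of_append_left
          · intro z hz
            simp only [Set.mem_ofPred_eq, List.mem_cons, List.mem_append, List.not_mem_nil,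
              or_false] at hz ⊢
            tauto
          · have h4 : ((x :: A ++ a :: B) ++ b :: (C ++ [x])).IsChain R := by simpa using hch
            have h5 : ((x :: A ++ [a]) ++ (B ++ b :: (C ++ [x]))).IsChain R := by simpa using hch
            have h6 : ((b :: C) ++ x :: (A ++ [a])).IsChain R :=
              List.isChain_split.2 ⟨by simpa using h4.right_of_append,
                by simpa using h5.left_of_append⟩
            simpa using h6
        · have h4 : pathProd ε ((x :: A) ++ a :: (B ++ b :: (C ++ [x]))) = -1 := by
            simpa using hneg
          have h5 : pathProd ε ((b :: C) ++ x :: (A ++ [a])) =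
              pathProd ε (b :: C ++ [x]) * pathProd ε (x :: (A ++ [a])) :=
            pathProd_append_cons ε (b :: C) x (A ++ [a])
          have h6 := pathProd_append_cons ε (a :: B) b (C ++ [x])
          rw [pathProd_append_cons, ← List.cons_append, h6] at h4
          rw [show b :: (C ++ x :: A ++ [a]) = (b :: C) ++ x :: (A ++ [a]) by simp, h5, ← h4]
          simp only [List.cons_append]
          ac_rfl
    obtain ⟨q, h2, h3⟩ := h2
    have h1' : HasPath R ε {z | z ∈ A ++ a :: B ++ b :: C} a b (pathProd ε (a :: (B ++ [b]))) := by
      refine h1.mono ?_ (fun _ _ _ _ h => h)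
      intro z hz
      simp only [Set.mem_ofPred_eq, List.mem_cons, List.mem_append, List.not_mem_nil,
        or_false] at hz ⊢
      tauto
    by_cases hp : p = q
    · rw [hp]
      exact h2.symm hR hε
    · have : p = pathProd ε (a :: (B ++ [b])) := by
        rcases Int.units_eq_one_or p with h4 | h4 <;> rcases Int.units_eq_one_or q with h5 | h5 <;>
          rcases Int.units_eq_one_or (pathProd ε (a :: (B ++ [b]))) with h6 | h6 <;> simp_all
      rw [this]
      exact h1'
  intro a ha b hb hab p
  obtain ⟨A, B, hAB⟩ := List.append_of_mem (show a ∈ x :: t from ha)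
  have hb' : b ∈ A ++ a :: B := hAB ▸ hb
  rcases List.mem_append.1 hb' with h | h
  · obtain ⟨A₁, A₂, rfl⟩ := List.append_of_mem h
    exact (key A₁ A₂ B b a hAB p).symm hR hε
  · rcases List.mem_cons.1 h with h | h
    · exact absurd h.symm hab
    · obtain ⟨B₁, B₂, rfl⟩ := List.append_of_mem h
      exact key A B₁ B₂ a b (by rw [hAB]; simp) p

end Ears

/-! ### Trivial holonomy and potentials. -/

section Potentials

variable {V : Type*} {R : V → V → Prop} {ε g : V → V → ℤˣ}

/-- The edges of `R` on which `g` is the coboundary of `h`. -/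
def FlatEdge (R : V → V → Prop) (g : V → V → ℤˣ) (h : V → ℤˣ) (a b : V) : Prop :=
  R a b ∧ g a b = h a * h b

theorem FlatEdge.symm (hR : ∀ x y, R x y → R y x) (hg : ∀ x y, g x y = g y x) {h : V → ℤˣ}
    (a b : V) (hab : FlatEdge R g h a b) : FlatEdge R g h b a :=
  ⟨hR _ _ hab.1, by rw [hg, hab.2, mul_comm]⟩

/-- The edge relation determines the values successively along a simple path, starting from the
value at `x`. -/
theorem exists_potential (g : V → V → ℤˣ) (h : V → ℤˣ) (x : V) (l : List V)
    (hnd : (x :: l).Nodup) : ∃ h' : V → ℤˣ, (∀ z ∉ l, h' z = h z) ∧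
      (x :: l).IsChain fun a b => g a b = h' a * h' b := by
  classical
  induction l generalizing x h with
  | nil => exact ⟨h, fun _ _ => rfl, List.isChain_singleton _⟩
  | cons z l ih =>
    rw [List.nodup_cons] at hnd
    obtain ⟨h', h1, h2⟩ := ih (Function.update h z (g x z * h x)) z hnd.2
    have hz : z ∉ l := (List.nodup_cons.1 hnd.2).1
    have hxz : x ≠ z := fun e => hnd.1 (by simp [e])
    have hxl : x ∉ l := fun e => hnd.1 (by simp [e])
    refine ⟨h', fun w hw => ?_, List.isChain_cons_cons.2 ⟨?_, h2⟩⟩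
    · simp only [List.mem_cons, not_or] at hw
      rw [h1 w hw.2, Function.update_of_ne hw.1]
    · rw [h1 z hz, h1 x hxl, Function.update_self, Function.update_of_ne hxz, mul_comm,
        units_mul_mul_cancel]

/-- The closing edge of a path with trivial holonomy is flat. -/
theorem isChain_flat_of_pathProd {h : V → ℤˣ} {x y : V} {l : List V}
    (hch : (x :: l).IsChain fun a b => g a b = h a * h b)
    (hp : pathProd g (x :: (l ++ [y])) = h x * h y) :
    (x :: (l ++ [y])).IsChain fun a b => g a b = h a * h b := by
  rcases List.eq_nil_or_concat l with rfl | ⟨A, w, rfl⟩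
  · simpa using hp
  · rw [List.concat_eq_append] at *
    rw [← List.cons_append, List.isChain_append]
    refine ⟨hch, List.isChain_singleton _, ?_⟩
    have h1 := pathProd_coboundary x A w hch
    have h2 : pathProd g (x :: A ++ w :: [y]) = h x * h y := by simpa using hp
    rw [pathProd_append_cons, List.cons_append, h1] at h2
    have hl : (x :: (A ++ [w])).getLast? = some w :=
      List.getLast?_eq_some_iff.2 ⟨x :: A, rfl⟩
    simp only [hl, Option.mem_def, Option.some.injEq, List.head?_cons]
    rintro a rfl b rfl
    simp only [pathProd_cons_cons, pathProd_singleton, mul_one] at h2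
    rw [mul_assoc] at h2
    rw [← mul_left_cancel h2, ← mul_assoc, Int.units_mul_self, one_mul]

/-- An ear closed up by a flat path of the same charge has the holonomy of the flat path. -/
theorem pathProd_ear (hR : ∀ x y, R x y → R y x) (hε : ∀ x y, ε x y = ε y x)
    (hg : ∀ x y, g x y = g y x)
    (hcyc : ∀ x t, IsCyc R x t → pathProd ε (x :: (t ++ [x])) = 1 →
      pathProd g (x :: (t ++ [x])) = 1)
    {h : V → ℤˣ} {U : Set V} {x y : V} {l : List V} (hxy : x ≠ y) (hnd : l.Nodup)
    (hl : ∀ z ∈ l, z ∉ U) (hch : (x :: (l ++ [y])).IsChain R)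
    (hpath : HasPath (FlatEdge R g h) ε U x y (pathProd ε (x :: (l ++ [y])))) :
    pathProd g (x :: (l ++ [y])) = h x * h y := by
  obtain ⟨Q, h1, h2, h3, h4, h5, h6⟩ := hpath
  obtain ⟨q, rfl⟩ : ∃ q, Q = x :: (q ++ [y]) := by
    obtain ⟨A, rfl⟩ := List.getLast?_eq_some_iff.1 h2
    cases A with
    | nil => simp at h1; exact absurd h1.symm hxy
    | cons a A =>
      simp at h1
      exact ⟨A, by rw [h1]; rfl⟩
  have hflat : pathProd g (x :: (q ++ [y])) = h x * h y :=
    pathProd_coboundary x q y (h5.imp fun _ _ hab => hab.2)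
  by_cases hlen : q = [] ∧ l = []
  · obtain ⟨rfl, rfl⟩ := hlen
    exact hflat
  have hprod : ∀ F : V → V → ℤˣ, (∀ a b, F a b = F b a) →
      pathProd F (x :: ((q ++ y :: l.reverse) ++ [x])) =
        pathProd F (x :: (q ++ [y])) * pathProd F (x :: (l ++ [y])) := by
    intro F hF
    rw [← pathProd_reverse hF (x :: (l ++ [y]))]
    have := pathProd_append_cons F (x :: q) y (l.reverse ++ [x])
    simpa using this
  have hc : IsCyc R x (q ++ y :: l.reverse) := by
    refine ⟨?_, ?_, ?_⟩
    · have e : x :: (q ++ y :: l.reverse) = (x :: (q ++ [y])) ++ l.reverse := by simp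
      rw [e, List.nodup_append]
      refine ⟨h3, List.nodup_reverse.2 hnd, ?_⟩
      rintro a ha b hb rfl
      exact hl a (List.mem_reverse.1 hb) (h4 a ha)
    · have : 0 < q.length ∨ 0 < l.length := by
        by_contra! hcon
        exact hlen ⟨List.length_eq_zero_iff.1 (by omega), List.length_eq_zero_iff.1 (by omega)⟩
      simp only [List.length_append, List.length_cons, List.length_reverse]
      omega
    · have e : x :: ((q ++ y :: l.reverse) ++ [x]) = (x :: q) ++ y :: (l.reverse ++ [x]) := by simp
      rw [e]
      refine List.isChain_split.2 ⟨h5.imp fun _ _ hab => hab.1, ?_⟩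
      have h7 : (x :: (l ++ [y])).reverse.IsChain R := by
        rw [List.isChain_reverse]
        exact hch.imp fun a b => hR a b
      simpa using h7
  have h8 := hcyc x _ hc (by rw [hprod ε hε, h6, Int.units_mul_self])
  rw [hprod g hg, hflat] at h8
  rw [← one_mul (pathProd g _), ← Int.units_mul_self (h x * h y), mul_assoc, h8, mul_one]

/-- If all cycles of trivial charge have trivial holonomy, and there is a cycle of nontrivial
charge and trivial holonomy, then the holonomy is trivial on the two-connected set. -/
theorem exists_potential_of_twoConnectedIn [Finite V] (hR : ∀ x y, R x y → R y x)
    (hε : ∀ x y, ε x y = ε y x) (hg : ∀ x y, g x y = g y x)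
    (hcyc : ∀ x t, IsCyc R x t → pathProd ε (x :: (t ++ [x])) = 1 →
      pathProd g (x :: (t ++ [x])) = 1)
    {U : Set V} (hU : TwoConnectedIn R U) {x₀ : V} {t₀ : List V} (hc : IsCyc R x₀ t₀)
    (hcU : ∀ z ∈ x₀ :: t₀, z ∈ U) (hneg : pathProd ε (x₀ :: (t₀ ++ [x₀])) = -1)
    (hflat : pathProd g (x₀ :: (t₀ ++ [x₀])) = 1) :
    ∃ h : V → ℤˣ, ∀ a ∈ U, ∀ b ∈ U, a ≠ b → R a b → g a b = h a * h b := by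
  -- Flat paths of both charges are required so that any edge or ear between vertices of `W` closes
  -- up to a cycle of charge 1, to which `hcyc` applies. A maximal such `W` has no ear in `U`.
  let P : Set V → Prop := fun W => W ⊆ U ∧ W.Nontrivial ∧ ∃ h, Spread (FlatEdge R g h) ε W
  have hstart : P {z | z ∈ x₀ :: t₀} := by
    refine ⟨hcU, (hc.twoConnectedIn hR).1, ?_⟩
    obtain ⟨h, -, h1⟩ := exists_potential g 1 x₀ t₀ hc.1
    have h2 := isChain_flat_of_pathProd (y := x₀) h1 (by rw [hflat, Int.units_mul_self])
    refine ⟨h, IsCyc.spread (FlatEdge.symm hR hg) hε ⟨hc.1, hc.2.1, ?_⟩ hneg⟩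
    rw [List.isChain_iff_forall_rel_of_append_cons_cons] at h2 ⊢
    have h3 := hc.2.2
    rw [List.isChain_iff_forall_rel_of_append_cons_cons] at h3
    exact fun a b l₁ l₂ hab => ⟨h3 hab, h2 hab⟩
  obtain ⟨W, -, hWP, hWmax⟩ := Finite.exists_le_maximal hstart
  obtain ⟨hWU, hWnt, h, hspread⟩ := hWP
  by_cases hWeq : W = U
  · subst hWeq
    refine ⟨h, fun a ha b hb hab hRab => ?_⟩
    have := pathProd_ear hR hε hg hcyc (h := h) (U := W) (l := []) hab List.nodup_nil (by simp)
      (by simpa using hRab) (hspread a ha b hb hab _)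
    simpa using this
  · exfalso
    obtain ⟨x, y, l, hx, hy, hxy, hl0, hnd, hl, hch⟩ := hU.exists_ear hWU hWeq hWnt
    have hl' : ∀ z ∈ l, z ∉ W := fun z hz => (hl z hz).2
    have hprod := pathProd_ear hR hε hg hcyc hxy hnd hl' hch (hspread x hx y hy hxy _)
    have hxl : x ∉ l := fun e => hl' x e hx
    have hyl : y ∉ l := fun e => hl' y e hy
    obtain ⟨h', h1, h2⟩ := exists_potential g h x l (List.nodup_cons.2 ⟨hxl, hnd⟩)
    have h3 := isChain_flat_of_pathProd (y := y) h2 (by rw [hprod, h1 x hxl, h1 y hyl])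
    have hspread' : Spread (FlatEdge R g h') ε W := fun a ha b hb hab p =>
      (hspread a ha b hb hab p).mono subset_rfl fun u hu v hv huv => ⟨huv.1, by
        rw [huv.2, h1 u fun e => hl' u e hu, h1 v fun e => hl' v e hv]⟩
    have h4 : (x :: (l ++ [y])).IsChain (FlatEdge R g h') := by
      rw [List.isChain_iff_forall_rel_of_append_cons_cons] at h3 hch ⊢
      exact fun a b l₁ l₂ hab => ⟨hch hab, h3 hab⟩
    have h5 := hspread'.ear (FlatEdge.symm hR hg) hε hx hy hxy hnd hl' h4
    have h6 : P (W ∪ {z | z ∈ l}) :=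
      ⟨Set.union_subset hWU fun z hz => (hl z hz).1, hWnt.mono Set.subset_union_left, h', h5⟩
    obtain ⟨z, hz⟩ := List.exists_mem_of_ne_nil l hl0
    exact hl' z hz (hWmax h6 Set.subset_union_left (Or.inr hz))

/-- If all cycles have trivial holonomy, the holonomy is a coboundary. -/
theorem exists_potential_of_forall_cyc [Finite V] (hR : ∀ x y, R x y → R y x)
    (hg : ∀ x y, g x y = g y x)
    (hcyc : ∀ x t, IsCyc R x t → pathProd g (x :: (t ++ [x])) = 1) :
    ∃ h : V → ℤˣ, ∀ a b, a ≠ b → R a b → g a b = h a * h b := by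
  classical
  -- Grows a spanning forest of flat edges. The trivial charge lets `pathProd_ear` be applied to all
  -- cycles.
  let P : Set V → Prop := fun W => ∃ h, ∀ a ∈ W, ∀ b ∈ W, Relation.ReflTransGen R a b →
    HasPath (FlatEdge R g h) (fun _ _ => 1) W a b 1
  have hstart : P ∅ := ⟨1, by simp⟩
  have hone : ∀ l : List V, pathProd (fun _ _ => (1 : ℤˣ)) l = 1 := fun l =>
    pathProd_eq_one (by rw [List.isChain_iff_forall_rel_of_append_cons_cons]; intros; rfl)
  have hsymm : ∀ {a b}, Relation.ReflTransGen R a b → Relation.ReflTransGen R b a :=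
    fun {a b} hab => by
      induction hab with
      | refl => rfl
      | tail _ hbc ih => exact (Relation.ReflTransGen.single (hR _ _ hbc)).trans ih
  have hself : ∀ (h : V → ℤˣ) (W : Set V), ∀ z ∈ W,
      HasPath (FlatEdge R g h) (fun _ _ => 1) W z z 1 := fun h W z hz =>
    ⟨[z], rfl, rfl, by simp, by simpa using hz, List.isChain_singleton _, rfl⟩
  obtain ⟨W, -, ⟨h, hW⟩, hWmax⟩ := Finite.exists_le_maximal hstart
  have hclosed : ∀ a ∈ W, ∀ b, R a b → b ∈ W := by
    intro x hx z hxz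
    by_contra hz
    let h' := Function.update h z (g x z * h x)
    have hh' : ∀ a ∈ W, h' a = h a := fun a ha =>
      Function.update_of_ne (fun e : a = z => hz (e ▸ ha)) _ _
    have hxz' : FlatEdge R g h' x z := by
      refine ⟨hxz, ?_⟩
      rw [hh' x hx]
      simp only [h', Function.update_self]
      rw [mul_comm, units_mul_mul_cancel]
    have hWpath : ∀ a ∈ W, ∀ b ∈ W, Relation.ReflTransGen R a b →
        HasPath (FlatEdge R g h') (fun _ _ => 1) W a b 1 := fun a ha b hb hab =>
      (hW a ha b hb hab).mono subset_rfl fun u hu v hv huv => ⟨huv.1, by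
        rw [huv.2, hh' u hu, hh' v hv]⟩
    have hto : ∀ a ∈ W, Relation.ReflTransGen R a z →
        HasPath (FlatEdge R g h') (fun _ _ => 1) (W ∪ {z}) a z 1 := by
      intro a ha haz
      have h1 := hWpath a ha x hx (haz.tail (hR _ _ hxz))
      have h2 : HasPath (FlatEdge R g h') (fun _ _ => 1) {x, z} x z 1 :=
        ⟨[x, z], rfl, rfl, by simpa using fun e : x = z => hz (e ▸ hx), by simp,
          by simpa using hxz', hone _⟩
      refine (h1.trans h2 ?_).mono ?_ (fun _ _ _ _ e => e)
      · rintro u hu (rfl | rfl)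
        · rfl
        · exact absurd hu hz
      · rintro u (hu | rfl | rfl)
        · exact Or.inl hu
        · exact Or.inl hx
        · exact Or.inr rfl
    have hP : P (W ∪ {z}) := by
      refine ⟨h', ?_⟩
      rintro a (ha | rfl) b (hb | rfl) hab
      · exact (hWpath a ha b hb hab).mono Set.subset_union_left (fun _ _ _ _ e => e)
      · exact hto a ha hab
      · exact (hto b hb (hsymm hab)).symm (FlatEdge.symm hR hg) (fun _ _ => rfl)
      · exact hself _ _ _ (Or.inr rfl)
    exact hz (hWmax hP Set.subset_union_left (Or.inr rfl))
  have huniv : ∀ z, z ∈ W := by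
    intro z
    by_contra hz
    have hno : ∀ a ∈ W, ¬Relation.ReflTransGen R a z := by
      intro a ha haz
      obtain ⟨u, v, hu, hv, huv⟩ := exists_step_leaving haz ha hz
      exact hv (hclosed u hu v huv)
    have hP : P (W ∪ {z}) := by
      refine ⟨h, ?_⟩
      rintro a (ha | rfl) b (hb | rfl) hab
      · exact (hW a ha b hb hab).mono Set.subset_union_left (fun _ _ _ _ e => e)
      · exact absurd hab (hno a ha)
      · exact absurd (hsymm hab) (hno b hb)
      · exact hself _ _ _ (Or.inr rfl)
    exact hz (hWmax hP Set.subset_union_left (Or.inr rfl))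
  refine ⟨h, fun a b hab hRab => ?_⟩
  have := pathProd_ear (ε := fun _ _ => 1) hR (fun _ _ => rfl) hg (fun x t hc _ => hcyc x t hc)
    (h := h) (U := W) (l := []) hab List.nodup_nil (by simp) (by simpa using hRab)
    (by rw [hone]; exact hW a (huniv a) b (huniv b) (.single hRab))
  simpa using this

end Potentials

/-! ### Inverting orbits in the Leibniz expansion. -/

section PartialTranspose

open Equiv Equiv.Perm Matrix

variable {α : Type*}

theorem zpow_apply_eq_of_agree {p : α → Prop} {σ τ : Perm α} (hσ : ∀ x, p (σ x) ↔ p x)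
    (h : ∀ x, p x → τ x = σ x) (n : ℤ) : ∀ x, p x → (τ ^ n) x = (σ ^ n) x ∧ p ((σ ^ n) x) := by
  induction n with
  | zero => exact fun x hx => ⟨rfl, hx⟩
  | succ n ih =>
    intro x hx
    have h1 := ih (σ x) ((hσ x).2 hx)
    rw [_root_.zpow_add_one, _root_.zpow_add_one, mul_apply, mul_apply, h x hx]
    exact h1
  | pred n ih =>
    intro x hx
    have hp : p (σ⁻¹ x) := by
      rw [← hσ]
      simpa using hx
    have h1 := ih (σ⁻¹ x) hp
    have h2 : τ⁻¹ x = σ⁻¹ x := by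
      rw [inv_eq_iff_eq, h _ hp]
      simp
    rw [_root_.zpow_sub_one, _root_.zpow_sub_one, mul_apply, mul_apply, h2]
    exact h1

/-- The points whose `σ`-orbit is contained in `U`. -/
def orbitsWithin (U : Set α) (σ : Perm α) : Set α :=
  {x | ∀ y, σ.SameCycle x y → y ∈ U}

theorem apply_mem_orbitsWithin {U : Set α} {σ : Perm α} (x : α) :
    σ x ∈ orbitsWithin U σ ↔ x ∈ orbitsWithin U σ := by
  simp only [orbitsWithin, Set.mem_ofPred_eq, sameCycle_apply_left]

theorem inv_apply_mem_orbitsWithin {U : Set α} {σ : Perm α} (x : α) :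
    σ⁻¹ x ∈ orbitsWithin U σ ↔ x ∈ orbitsWithin U σ := by
  rw [← apply_mem_orbitsWithin]
  simp

open Classical in
/-- Invert the orbits of `σ` that are contained in `U`. -/
noncomputable def flipWithin (U : Set α) (σ : Perm α) : Perm α :=
  let ρ := ofSubtype (σ.subtypePerm (p := (· ∈ orbitsWithin U σ)) apply_mem_orbitsWithin)
  σ * ρ⁻¹ * ρ⁻¹

theorem flipWithin_of_mem {U : Set α} {σ : Perm α} {x : α} (hx : x ∈ orbitsWithin U σ) :
    flipWithin U σ x = σ⁻¹ x := by
  classical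
  have h : ∀ y ∈ orbitsWithin U σ,
      (ofSubtype (σ.subtypePerm (p := (· ∈ orbitsWithin U σ)) apply_mem_orbitsWithin))⁻¹ y =
        σ⁻¹ y := by
    intro y hy
    rw [inv_eq_iff_eq, ofSubtype_apply_of_mem _ ((inv_apply_mem_orbitsWithin y).2 hy)]
    simp
  simp only [flipWithin, mul_apply]
  rw [h x hx, h _ ((inv_apply_mem_orbitsWithin x).2 hx)]
  simp

theorem flipWithin_of_notMem {U : Set α} {σ : Perm α} {x : α} (hx : x ∉ orbitsWithin U σ) :
    flipWithin U σ x = σ x := by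
  classical
  have h : (ofSubtype (σ.subtypePerm (p := (· ∈ orbitsWithin U σ)) apply_mem_orbitsWithin))⁻¹ x =
      x := by
    rw [inv_eq_iff_eq, ofSubtype_apply_of_not_mem _ hx]
  simp only [flipWithin, mul_apply]
  rw [h, h]

theorem orbitsWithin_flipWithin (U : Set α) (σ : Perm α) :
    orbitsWithin U (flipWithin U σ) = orbitsWithin U σ := by
  ext x
  by_cases hx : x ∈ orbitsWithin U σ
  · refine iff_of_true ?_ hx
    rintro y ⟨n, rfl⟩
    rw [(zpow_apply_eq_of_agree (σ := σ⁻¹) (p := (· ∈ orbitsWithin U σ))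
      inv_apply_mem_orbitsWithin (fun z hz => flipWithin_of_mem hz) n x hx).1]
    exact hx _ ⟨-n, by simp⟩
  · refine iff_of_false (fun h => hx ?_) hx
    rintro y ⟨n, rfl⟩
    rw [← (zpow_apply_eq_of_agree (σ := σ) (p := (· ∉ orbitsWithin U σ))
      (fun z => not_congr (apply_mem_orbitsWithin z)) (fun z hz => flipWithin_of_notMem hz)
      n x hx).1]
    exact h _ ⟨n, rfl⟩

theorem flipWithin_flipWithin (U : Set α) (σ : Perm α) :
    flipWithin U (flipWithin U σ) = σ := by
  ext x
  by_cases hx : x ∈ orbitsWithin U σ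
  · rw [flipWithin_of_mem (by rwa [orbitsWithin_flipWithin]), inv_eq_iff_eq,
      flipWithin_of_mem ((apply_mem_orbitsWithin x).2 hx)]
    simp
  · rw [flipWithin_of_notMem (by rwa [orbitsWithin_flipWithin]), flipWithin_of_notMem hx]

/-- `σ` is corrected by the square of a permutation, which is even. -/
theorem sign_flipWithin [Fintype α] [DecidableEq α] (U : Set α) (σ : Perm α) :
    sign (flipWithin U σ) = sign σ := by
  classical
  simp only [flipWithin, Perm.sign_mul, sign_inv, mul_assoc, Int.units_mul_self, mul_one]

/-- Transposing the block of a matrix on `U` preserves the determinant if every permutation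
supported on nonzero entries moves points within `U` only along orbits contained in `U`. -/
theorem det_eq_of_transposed_within [Fintype α] [DecidableEq α] {R : Type*} [CommRing R]
    {A B : Matrix α α R} (U : Set α) (hin : ∀ i ∈ U, ∀ j ∈ U, B i j = A j i)
    (hout : ∀ i j, ¬(i ∈ U ∧ j ∈ U) → B i j = A i j) (hsymm : ∀ i j, A i j ≠ 0 → A j i ≠ 0)
    (hU : ∀ σ : Perm α, (∀ y, A (σ y) y ≠ 0) → ∀ x ∈ U, σ x ∈ U → σ x ≠ x →
      x ∈ orbitsWithin U σ) : A.det = B.det := by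
  classical
  have hmem : ∀ {σ : Perm α} {x}, x ∈ orbitsWithin U σ → x ∈ U := fun h => h _ SameCycle.rfl
  have hB : ∀ i j, B i j ≠ 0 → A i j ≠ 0 := by
    intro i j h
    by_cases hij : i ∈ U ∧ j ∈ U
    · rw [hin i hij.1 j hij.2] at h
      exact hsymm _ _ h
    · rwa [hout i j hij] at h
  let e : Perm (Perm α) := Function.Involutive.toPerm (flipWithin U) (flipWithin_flipWithin U)
  rw [det_apply, det_apply, ← Equiv.sum_comp e fun σ => sign σ • ∏ i, B (σ i) i]
  refine Finset.sum_congr rfl fun σ _ => ?_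
  change _ = sign (flipWithin U σ) • ∏ i, B (flipWithin U σ i) i
  rw [sign_flipWithin]
  congr 1
  by_cases hσ : ∀ y, A (σ y) y ≠ 0
  · have h1 : ∀ i, B (flipWithin U σ i) i =
        (if i ∈ orbitsWithin U σ then A (σ (σ⁻¹ i)) (σ⁻¹ i) else 1) *
          (if i ∈ orbitsWithin U σ then 1 else A (σ i) i) := by
      intro i
      by_cases hi : i ∈ orbitsWithin U σ
      · rw [flipWithin_of_mem hi,
          hin _ (hmem ((inv_apply_mem_orbitsWithin i).2 hi)) _ (hmem hi)]
        simp [hi]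
      · rw [flipWithin_of_notMem hi]
        simp only [hi, if_false, one_mul]
        by_cases hfix : σ i = i
        · by_cases hiU : i ∈ U
          · rw [hfix, hin i hiU i hiU]
          · exact hout _ _ fun h => hiU h.2
        · exact hout _ _ fun h => hi (hU σ hσ i h.2 h.1 hfix)
    simp_rw [h1]
    rw [Finset.prod_mul_distrib,
      -- On the inverted orbits the factors are those of `σ` shifted by one step; reindexing by `σ`
      -- realigns them.
      ← Equiv.prod_comp σ fun i => if i ∈ orbitsWithin U σ then A (σ (σ⁻¹ i)) (σ⁻¹ i) else 1,
      ← Finset.prod_mul_distrib]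
    refine Finset.prod_congr rfl fun i _ => ?_
    by_cases hi : i ∈ orbitsWithin U σ <;> simp [hi, apply_mem_orbitsWithin]
  · push Not at hσ
    obtain ⟨y, hy⟩ := hσ
    refine (Finset.prod_eq_zero (f := fun i => A (σ i) i) (Finset.mem_univ y) hy).trans ?_
    by_cases hyT : y ∈ orbitsWithin U σ
    · refine (Finset.prod_eq_zero (Finset.mem_univ (σ y)) ?_).symm
      rw [flipWithin_of_mem ((apply_mem_orbitsWithin y).2 hyT), show σ⁻¹ (σ y) = y by simp]
      by_contra h
      exact hsymm _ _ (hB _ _ h) hy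
    · refine (Finset.prod_eq_zero (Finset.mem_univ y) ?_).symm
      rw [flipWithin_of_notMem hyT]
      by_contra h
      exact hB _ _ h hy

/-- An orbit of length at least three along edges is a cycle of the graph. -/
theorem isCyc_orbit [Fintype α] [DecidableEq α] {R : α → α → Prop} {σ : Perm α} {x : α}
    (hstep : ∀ y, σ y ≠ y → R y (σ y)) (h1 : σ x ≠ x) (h2 : σ (σ x) ≠ x) :
    ∃ t, IsCyc R x t ∧ ∀ y, y ∈ x :: t ↔ σ.SameCycle x y := by
  have hx : x ∈ σ.support := mem_support.2 h1
  have hlen := length_toList (p := σ) (x := x)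
  have hclose : (σ ^ (toList σ x).length) x = x := by
    rw [hlen]
    exact (isCycleOn_support_cycleOf σ x).pow_card_apply (by simpa using h1)
  have hlist : toList σ x = (List.range (toList σ x).length).map fun i => (σ ^ i) x := by
    apply List.ext_getElem
    · simp
    · intro i hi hi'
      rw [getElem_toList]
      simp
  have hmem : ∀ y, y ∈ toList σ x ↔ σ.SameCycle x y := fun y => by
    rw [mem_toList_iff, and_iff_left hx]
  have h2l : 2 ≤ (toList σ x).length := two_le_length_toList_iff_mem_support.2 hx
  have h3 : (toList σ x).length ≠ 2 := fun e => h2 (by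
    rw [e] at hclose
    exact hclose)
  have hnd := nodup_toList σ x
  have hchain : (toList σ x ++ [x]).IsChain R := by
    rw [hlist]
    have : (List.range (toList σ x).length).map (fun i => (σ ^ i) x) ++ [x] =
        (List.range ((toList σ x).length + 1)).map fun i => (σ ^ i) x := by
      rw [List.range_succ, List.map_append, List.map_singleton, hclose]
    rw [this, List.isChain_map, List.isChain_range_succ]
    intro i _
    rw [pow_succ', mul_apply]
    apply hstep
    rw [← mul_apply, ← pow_succ', pow_succ, mul_apply]
    exact fun e => h1 ((σ ^ i).injective e)
  obtain ⟨t, ht⟩ : ∃ t, toList σ x = x :: t := by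
    cases hl : toList σ x with
    | nil => simp [hl] at h2l
    | cons a t =>
      have h0 : (toList σ x)[0]'(by omega) = x := by rw [getElem_toList]; rfl
      simp only [hl, List.getElem_cons_zero] at h0
      exact ⟨t, by rw [h0]⟩
  rw [ht] at hnd hchain hmem h2l h3
  simp only [List.length_cons] at h2l h3
  exact ⟨t, ⟨hnd, by omega, hchain⟩, hmem⟩

end PartialTranspose

/-! ### The operations preserve magnitudes and minors. -/

section Operations

open Matrix Equiv.Perm

variable {N : ℕ} {A K : Matrix (Fin N) (Fin N) ℝ}

theorem IsCyc.map {α β : Type*} {R : α → α → Prop} {S : β → β → Prop} {f : α → β}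
    (hf : f.Injective) (hRS : ∀ a b, R a b → S (f a) (f b)) {x : α} {t : List α}
    (hc : IsCyc R x t) : IsCyc S (f x) (t.map f) := by
  refine ⟨?_, by simpa using hc.2.1, ?_⟩
  · rw [← List.map_cons]
    exact hc.1.map hf
  · rw [show f x :: (t.map f ++ [f x]) = (x :: (t ++ [x])).map f by simp, List.isChain_map]
    exact hc.2.2.imp hRS

theorem exists_sign_mul_eq {a b φ : ℝ} (h : |a| = |b|) (hφ : φ = -1 ∨ φ = 1) :
    ∃ ψ : ℝ, (ψ = -1 ∨ ψ = 1) ∧ φ * a = ψ * b := by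
  rcases abs_eq_abs.1 h with rfl | rfl
  · exact ⟨φ, hφ, rfl⟩
  · refine ⟨-φ, ?_, by ring⟩
    rcases hφ with rfl | rfl <;> simp

theorem sparsityGraph_congr (h : ∀ i j, |A i j| = |K i j|) : sparsityGraph A = sparsityGraph K := by
  have h' : ∀ i j, A i j ≠ 0 ↔ K i j ≠ 0 := fun i j => by rw [← abs_ne_zero, h, abs_ne_zero]
  simp only [sparsityGraph, h']

/-- Sign changes of the four-cycle products are absorbed by the arbitrary signs `φ₁`, `φ₂`, `φ₃`. -/
theorem IsGeneric.of_abs_eq (hK : IsGeneric K) (h : ∀ i j, |A i j| = |K i j|) : IsGeneric A := by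
  intro i j k l h1 h2 h3 h4 h5 h6 h7
  have h8 : K i j * K j k * K k l * K l i ≠ 0 := by
    rw [← abs_ne_zero] at h7 ⊢
    simpa only [abs_mul, h] using h7
  obtain ⟨h9, h10⟩ := hK i j k l h1 h2 h3 h4 h5 h6 h8
  refine ⟨by simpa only [abs_mul, h] using h9, fun φ₁ φ₂ φ₃ hφ₁ hφ₂ hφ₃ => ?_⟩
  have hprod : ∀ p q r s t u v w : Fin N, |A p q * A r s * A t u * A v w| =
      |K p q * K r s * K t u * K v w| := fun p q r s t u v w => by simp only [abs_mul, h]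
  obtain ⟨ψ₁, hψ₁, e₁⟩ := exists_sign_mul_eq (hprod i j j k k l l i) hφ₁
  obtain ⟨ψ₂, hψ₂, e₂⟩ := exists_sign_mul_eq (hprod i j j l l k k i) hφ₂
  obtain ⟨ψ₃, hψ₃, e₃⟩ := exists_sign_mul_eq (hprod i k k j j l l i) hφ₃
  rw [e₁, e₂, e₃]
  exact h10 ψ₁ ψ₂ ψ₃ hψ₁ hψ₂ hψ₃

theorem genericClass_of_abs_eq (hK : K ∈ genericClass N) (h : ∀ i j, |A i j| = |K i j|) :
    A ∈ genericClass N :=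
  ⟨fun i j => by rw [h, h, hK.1 i j], hK.2.of_abs_eq h⟩

theorem sparsityGraph_adj_iff (hK : IsMagnitudeSymmetric K) {i j : Fin N} :
    (sparsityGraph K).Adj i j ↔ i ≠ j ∧ K i j ≠ 0 := by
  rw [sparsityGraph_adj hK, abs_ne_zero]

theorem IsMagnitudeSymmetric.ne_zero (hK : IsMagnitudeSymmetric K) {i j : Fin N}
    (h : K i j ≠ 0) : K j i ≠ 0 := by
  rwa [← abs_ne_zero, ← hK, abs_ne_zero]

theorem SignSimilarityStep.abs_eq {B : Matrix (Fin N) (Fin N) ℝ} (h : SignSimilarityStep A B)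
    (i j : Fin N) : |B i j| = |A i j| := by
  obtain ⟨d, hd, rfl⟩ := h
  have h1 : ∀ i, |d i| = 1 := fun i => by rcases hd i with e | e <;> simp [e]
  rw [mul_diagonal, diagonal_mul, abs_mul, abs_mul, h1, h1, one_mul, mul_one]

theorem SignSimilarityStep.principalMinor_eq {B : Matrix (Fin N) (Fin N) ℝ}
    (h : SignSimilarityStep A B) (S : Finset (Fin N)) : principalMinor B S = principalMinor A S := by
  obtain ⟨d, hd, rfl⟩ := h
  rw [principalMinor, principalMinor, ← det_sign_conj (A.submatrix _ _) (fun i : S => d i)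
    (fun i => by rcases hd i with e | e <;> simp [e])]
  congr 1
  ext i j
  simp [mul_diagonal, diagonal_mul]

theorem transposeOn_of_mem {U : Set (Fin N)} {i j : Fin N} (hi : i ∈ U) (hj : j ∈ U) :
    transposeOn U A i j = A j i := by
  simp [transposeOn, hi, hj]

theorem transposeOn_of_not {U : Set (Fin N)} {i j : Fin N} (h : ¬(i ∈ U ∧ j ∈ U)) :
    transposeOn U A i j = A i j := by
  simp only [transposeOn, of_apply, if_neg h]

theorem abs_transposeOn (hA : IsMagnitudeSymmetric A) (U : Set (Fin N)) (i j : Fin N) :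
    |transposeOn U A i j| = |A i j| := by
  by_cases h : i ∈ U ∧ j ∈ U
  · rw [transposeOn_of_mem h.1 h.2, hA]
  · rw [transposeOn_of_not h]

/-- An orbit taking a step inside the block is either a transposition of two block vertices or a
cycle of the graph with two vertices in the block. Both lie in the block. -/
theorem principalMinor_transposeOn (hA : IsMagnitudeSymmetric A)
    {H : (sparsityGraph A).Subgraph} (hH : IsBlock H) (S : Finset (Fin N)) :
    principalMinor (transposeOn H.verts A) S = principalMinor A S := by
  refine (det_eq_of_transposed_within {i : S | (i : Fin N) ∈ H.verts}
    (fun i hi j hj => transposeOn_of_mem hi hj) (fun i j hij => transposeOn_of_not hij)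
    (fun i j h => hA.ne_zero h) ?_).symm
  intro σ hσ x hx hσx hne y hxy
  by_cases h2 : σ (σ x) = x
  · obtain ⟨n, rfl⟩ := hxy
    have := (zpow_apply_eq_of_agree (σ := σ) (τ := σ) (p := fun z => z = x ∨ z = σ x) (fun z => ?_)
      (fun _ _ => rfl) n x (Or.inl rfl)).2
    · rcases this with h | h <;> rw [h]
      exacts [hx, hσx]
    · have h3 : σ z = x ↔ z = σ x := by rw [← σ.injective.eq_iff (b := σ x), h2]
      rw [h3, σ.injective.eq_iff, or_comm]
  · obtain ⟨t, hc, ht⟩ := isCyc_orbit (R := fun a b : S => (sparsityGraph A).Adj a b) (σ := σ)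
      (fun y hy => (sparsityGraph_adj_iff hA).2
        ⟨fun e => hy (Subtype.ext e.symm), hA.ne_zero (hσ y)⟩) hne h2
    have hmem : ∀ z : S, σ.SameCycle x z → (z : Fin N) ∈ (x : Fin N) :: t.map Subtype.val := by
      intro z hz
      rw [← List.map_cons]
      exact List.mem_map_of_mem ((ht z).2 hz)
    exact hH.subset_verts_of_isCyc (hc.map Subtype.val_injective fun _ _ h => h)
      (fun e => hne (Subtype.ext e.symm)) (hmem x SameCycle.rfl) (hmem (σ x) ⟨1, rfl⟩) hx hσx _
      (hmem y hxy)

theorem generatedSet_subset (hK : K ∈ genericClass N) {K' : Matrix (Fin N) (Fin N) ℝ}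
    (h : K' ∈ generatedSet K) : (∀ i j, |K' i j| = |K i j|) ∧
      ∀ S : Finset (Fin N), principalMinor K S = principalMinor K' S := by
  induction h with
  | refl => exact ⟨fun _ _ => rfl, fun _ => rfl⟩
  | @tail A B _ hAB ih =>
    obtain ⟨ih1, ih2⟩ := ih
    have hA := genericClass_of_abs_eq hK ih1
    rcases hAB with hAB | ⟨H, hH, rfl⟩
    · exact ⟨fun i j => (hAB.abs_eq i j).trans (ih1 i j),
        fun S => (ih2 S).trans (hAB.principalMinor_eq S).symm⟩
    · refine ⟨fun i j => (abs_transposeOn hA.1 _ i j).trans (ih1 i j), fun S => ?_⟩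
      -- Blocks refer to the graph of `K`, which is also the graph of every intermediate matrix.
      have hg := sparsityGraph_congr ih1
      revert H
      rw [← hg]
      intro H hH
      exact (ih2 S).trans (principalMinor_transposeOn hA.1 hH S).symm

end Operations

/-! ### Recovering the operations from the principal minors. -/

section Reconstruction

open Matrix

variable {N : ℕ} {A K K' : Matrix (Fin N) (Fin N) ℝ}

open Classical in
/-- The sign `u` with `b = u * a`, for real numbers of equal magnitude. -/
noncomputable def relSign (a b : ℝ) : ℤˣ := if b = a then 1 else -1

theorem eq_relSign_mul {a b : ℝ} (h : |b| = |a|) : b = ((relSign a b : ℤ) : ℝ) * a := by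
  unfold relSign
  split_ifs with h1
  · simpa using h1
  · simpa using (abs_eq_abs.1 h).resolve_left h1

theorem relSign_self (a : ℝ) : relSign a a = 1 := if_pos rfl

theorem relSign_eq_mul {a b c : ℝ} (ha : a ≠ 0) (hb : |b| = |a|) (hc : |c| = |a|) :
    relSign b c = relSign a c * relSign a b := by
  have h1 : -a ≠ a := fun e => ha (by linarith)
  rcases abs_eq_abs.1 hb with rfl | rfl <;> rcases abs_eq_abs.1 hc with rfl | rfl <;>
    simp [relSign, h1, h1.symm]

theorem diag_eq_of_principalMinor
    (h : ∀ S : Finset (Fin N), principalMinor K S = principalMinor K' S) (i : Fin N) :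
    K i i = K' i i := by
  have hS : ∀ y, y ∈ ({i} : Finset (Fin N)) ↔ ∃ k < 1, (fun _ : ℕ => i) k = y := by
    intro y
    simp [eq_comm]
  have hz : ∀ a b : ℕ, a < 1 → b < 1 → (fun _ : ℕ => i) a = (fun _ : ℕ => i) b → a = b :=
    fun a b _ _ _ => by omega
  have h1 := h {i}
  rw [← det_eq_principalMinor K _ _ hz hS, ← det_eq_principalMinor K' _ _ hz hS] at h1
  simpa [toMat] using h1

theorem mul_eq_of_principalMinor
    (h : ∀ S : Finset (Fin N), principalMinor K S = principalMinor K' S) (i j : Fin N) :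
    K i j * K j i = K' i j * K' j i := by
  by_cases hij : i = j
  · rw [hij, diag_eq_of_principalMinor h]
  have hS : ∀ y, y ∈ ({i, j} : Finset (Fin N)) ↔
      ∃ k < 2, (fun k : ℕ => if k = 0 then i else j) k = y := by
    intro y
    constructor
    · rw [Finset.mem_insert, Finset.mem_singleton]
      rintro (rfl | rfl)
      exacts [⟨0, by simp⟩, ⟨1, by simp⟩]
    · rintro ⟨k, -, rfl⟩
      dsimp only
      split_ifs <;> simp
  have hz : ∀ a b : ℕ, a < 2 → b < 2 → (fun k : ℕ => if k = 0 then i else j) a =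
      (fun k : ℕ => if k = 0 then i else j) b → a = b := by
    intro a b ha hb hab
    dsimp only at hab
    split_ifs at hab <;> omega
  have h1 := h {i, j}
  rw [← det_eq_principalMinor K _ _ hz hS, ← det_eq_principalMinor K' _ _ hz hS] at h1
  simp only [toMat, det_fin_two, of_apply, Fin.coe_ofNat_eq_mod, Nat.zero_mod,
    Nat.one_mod, if_true, one_ne_zero, if_false] at h1
  rw [diag_eq_of_principalMinor h i, diag_eq_of_principalMinor h j] at h1
  linarith

theorem abs_eq_of_principalMinor (hK : IsMagnitudeSymmetric K) (hK' : IsMagnitudeSymmetric K')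
    (h : ∀ S : Finset (Fin N), principalMinor K S = principalMinor K' S) (i j : Fin N) :
    |K' i j| = |K i j| := by
  have h1 := congrArg abs (mul_eq_of_principalMinor h i j)
  rw [abs_mul, abs_mul, ← hK i j, ← hK' i j, abs_mul_abs_self, abs_mul_abs_self] at h1
  exact abs_eq_abs.2 (sq_eq_sq_iff_eq_or_eq_neg.1 (by linarith))

/-- Symmetry of the sign change comes from the 2×2 minors: since the products of opposite entries
agree, both entries of a nonzero pair change sign or neither does. -/
theorem signRelated_relSign (hK : IsMagnitudeSymmetric K) (hK' : IsMagnitudeSymmetric K')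
    (h : ∀ S : Finset (Fin N), principalMinor K S = principalMinor K' S) :
    SignRelated K K' (fun i j => relSign (K i j) (K j i))
      (fun i j => relSign (K i j) (K' i j)) where
  eps_symm i j := by simp only [relSign, eq_comm]
  sgn_symm i j := by
    have habs := abs_eq_of_principalMinor hK hK' h
    by_cases h0 : K i j = 0
    · have h1 : K j i = 0 := by rw [← abs_eq_zero, ← hK, h0, abs_zero]
      have h2 : K' i j = 0 := by rw [← abs_eq_zero, habs, h0, abs_zero]
      have h3 : K' j i = 0 := by rw [← abs_eq_zero, habs, h1, abs_zero]
      rw [h0, h1, h2, h3]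
    · have h1 := hK.ne_zero h0
      have hp := mul_eq_of_principalMinor h i j
      have : K' i j = K i j ↔ K' j i = K j i := by
        constructor
        · intro e
          rw [e] at hp
          exact (mul_left_cancel₀ h0 hp).symm
        · intro e
          rw [e] at hp
          exact (mul_right_cancel₀ h1 hp).symm
      simp only [relSign, this]
  eps_diag i := relSign_self _
  sgn_diag i := by
    rw [diag_eq_of_principalMinor h]
    exact relSign_self _
  mag i j := eq_relSign_mul (hK i j).symm
  rel i j := eq_relSign_mul (abs_eq_of_principalMinor hK hK' h i j)

/-- The pairs of distinct vertices lying on a common cycle with an odd number of sign changes from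
`A` to `B`. -/
def oddPairs (A B : Matrix (Fin N) (Fin N) ℝ) : Set (Fin N × Fin N) :=
  {p | p.1 ≠ p.2 ∧ ∃ x t, IsCyc (sparsityGraph A).Adj x t ∧
    pathProd (fun i j => relSign (A i j) (B i j)) (x :: (t ++ [x])) ≠ 1 ∧
    p.1 ∈ x :: t ∧ p.2 ∈ x :: t}

theorem signSimilarityStep_of_forall_cyc (hA : IsMagnitudeSymmetric A)
    (hK' : IsMagnitudeSymmetric K')
    (h : ∀ S : Finset (Fin N), principalMinor A S = principalMinor K' S)
    (hcyc : ∀ x t, IsCyc (sparsityGraph A).Adj x t →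
      pathProd (fun i j => relSign (A i j) (K' i j)) (x :: (t ++ [x])) = 1) :
    SignSimilarityStep A K' := by
  have hr := signRelated_relSign hA hK' h
  obtain ⟨d, hd⟩ := exists_potential_of_forall_cyc (fun _ _ e => e.symm) hr.sgn_symm hcyc
  refine ⟨fun i => ((d i : ℤ) : ℝ), fun i => ?_, ?_⟩
  · rcases Int.units_eq_one_or (d i) with e | e <;> simp [e]
  · ext i j
    rw [mul_diagonal, diagonal_mul]
    by_cases hij : i = j
    · rw [hij, diag_eq_of_principalMinor h, mul_right_comm, unit_cast_mul_self, one_mul]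
    rw [hr.rel i j]
    by_cases h0 : A i j = 0
    · simp [h0]
    · rw [hd i j hij ((sparsityGraph_adj_iff hA).2 ⟨hij, h0⟩)]
      push_cast
      ring

/-- The block containing a bad cycle is transposed. Every cycle inside it becomes even, and a cycle
not contained in it has no edge inside, hence is unaffected. -/
theorem oddPairs_transposeOn_ssubset (hA : A ∈ genericClass N)
    (hK' : IsMagnitudeSymmetric K')
    (h : ∀ S : Finset (Fin N), principalMinor A S = principalMinor K' S) {x : Fin N}
    {t : List (Fin N)} (hc : IsCyc (sparsityGraph A).Adj x t)
    (hbad : pathProd (fun i j => relSign (A i j) (K' i j)) (x :: (t ++ [x])) ≠ 1) :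
    ∃ H : (sparsityGraph A).Subgraph, IsBlock H ∧
      oddPairs (transposeOn H.verts A) K' ⊂ oddPairs A K' := by
  have hr := signRelated_relSign hA.1 hK' h
  have hadj : ∀ a b, (sparsityGraph A).Adj a b → A a b ≠ 0 := fun a b e =>
    ((sparsityGraph_adj_iff hA.1).1 e).2
  have hpos : ∀ y r, IsCyc (sparsityGraph A).Adj y r →
      pathProd (fun i j => relSign (A i j) (A j i)) (y :: (r ++ [y])) = 1 →
      pathProd (fun i j => relSign (A i j) (K' i j)) (y :: (r ++ [y])) = 1 :=
    fun y r hyr => IsCyc.pathProd_eq_one hr hA.2 h y r (hyr.mono hadj)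
  obtain ⟨H, hH, hxH⟩ := (hc.twoConnectedIn fun _ _ e => e.symm).exists_isBlock
  refine ⟨H, hH, ?_⟩
  have hneg : pathProd (fun i j => relSign (A i j) (A j i)) (x :: (t ++ [x])) = -1 :=
    Int.units_ne_iff_eq_neg.1 fun e => hbad (hpos x t hc e)
  -- This product is the sign change measured from the transpose of `A`. Around the bad cycle both
  -- factors multiply to -1.
  obtain ⟨d, hd⟩ := exists_potential_of_twoConnectedIn
    (g := fun i j => relSign (A i j) (K' i j) * relSign (A i j) (A j i))
    (fun _ _ e => e.symm) hr.eps_symm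
    (fun i j => by rw [hr.sgn_symm i j, hr.eps_symm i j])
    (fun y r hyr e => by rw [pathProd_mul, e, hpos y r hyr e, mul_one])
    hH.1.twoConnectedIn hc hxH hneg
    (by rw [pathProd_mul, hneg, Int.units_ne_iff_eq_neg.1 hbad]; rfl)
  have hgraph : sparsityGraph (transposeOn H.verts A) = sparsityGraph A :=
    sparsityGraph_congr (abs_transposeOn hA.1 _)
  have hin : ∀ y r, IsCyc (sparsityGraph A).Adj y r → (∀ z ∈ y :: r, z ∈ H.verts) →
      pathProd (fun i j => relSign (transposeOn H.verts A i j) (K' i j)) (y :: (r ++ [y])) = 1 := by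
    intro y r hyr hall
    rw [← pathProd_eq_one_of_coboundary d y r]
    apply pathProd_congr
    have h1 := hyr.2.2
    rw [List.isChain_iff_forall_rel_of_append_cons_cons] at h1 ⊢
    intro a b l₁ l₂ hl
    have hab := h1 hl
    have hmem : ∀ z ∈ y :: (r ++ [y]), z ∈ H.verts := by
      intro z hz
      refine hall z ?_
      simp only [List.mem_cons, List.mem_append, List.not_mem_nil, or_false] at hz ⊢
      tauto
    have ha : a ∈ H.verts := hmem a (by rw [hl]; simp)
    have hb : b ∈ H.verts := hmem b (by rw [hl]; simp)
    rw [transposeOn_of_mem ha hb, ← hd a ha b hb hab.ne hab]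
    exact relSign_eq_mul (hadj a b hab) (hA.1 a b).symm (abs_eq_of_principalMinor hA.1 hK' h a b)
  have hout : ∀ y r, IsCyc (sparsityGraph A).Adj y r → (¬∀ z ∈ y :: r, z ∈ H.verts) →
      pathProd (fun i j => relSign (transposeOn H.verts A i j) (K' i j)) (y :: (r ++ [y])) =
        pathProd (fun i j => relSign (A i j) (K' i j)) (y :: (r ++ [y])) := by
    intro y r hyr hall
    apply pathProd_congr
    have h1 := hyr.2.2
    rw [List.isChain_iff_forall_rel_of_append_cons_cons] at h1 ⊢
    intro a b l₁ l₂ hl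
    have hmem : ∀ z ∈ y :: (r ++ [y]), z ∈ y :: r := by
      intro z hz
      simp only [List.mem_cons, List.mem_append, List.not_mem_nil, or_false] at hz ⊢
      tauto
    rw [transposeOn_of_not fun hab => hall (hH.subset_verts_of_isCyc hyr (h1 hl).ne
      (hmem a (by rw [hl]; simp)) (hmem b (by rw [hl]; simp)) hab.1 hab.2)]
  refine ⟨?_, fun hsub => ?_⟩
  · rintro ⟨a, b⟩ ⟨hab, y, r, hyr, hodd, ha, hb⟩
    rw [hgraph] at hyr
    by_cases hall : ∀ z ∈ y :: r, z ∈ H.verts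
    · exact absurd (hin y r hyr hall) hodd
    · exact ⟨hab, y, r, hyr, by rwa [← hout y r hyr hall], ha, hb⟩
  -- Strictness: any cycle through two vertices of the bad cycle lies in the block, so none of them
  -- remains odd.
  · obtain ⟨a, ha, b, hb, hab⟩ := (hc.twoConnectedIn fun _ _ e => e.symm).1
    obtain ⟨-, y, r, hyr, hodd, hay, hby⟩ :=
      hsub (show (a, b) ∈ oddPairs A K' from ⟨hab, x, t, hc, hbad, ha, hb⟩)
    rw [hgraph] at hyr
    exact hodd (hin y r hyr
      (hH.subset_verts_of_isCyc hyr hab hay hby (hxH ha) (hxH hb)))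

theorem mem_generatedSet_of_principalMinor (hA : A ∈ genericClass N)
    (hK' : IsMagnitudeSymmetric K')
    (h : ∀ S : Finset (Fin N), principalMinor A S = principalMinor K' S) :
    K' ∈ generatedSet A := by
  induction hn : (oddPairs A K').ncard using Nat.strong_induction_on generalizing A with
  | _ n ih =>
  by_cases hcyc : ∀ x t, IsCyc (sparsityGraph A).Adj x t →
      pathProd (fun i j => relSign (A i j) (K' i j)) (x :: (t ++ [x])) = 1
  · exact .single (Or.inl (signSimilarityStep_of_forall_cyc hA.1 hK' h hcyc))
  · push Not at hcyc
    obtain ⟨x, t, hc, hbad⟩ := hcyc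
    obtain ⟨H, hH, hlt⟩ := oddPairs_transposeOn_ssubset hA hK' h hc hbad
    have habs := abs_transposeOn hA.1 H.verts
    have h1 := ih _ (hn ▸ Set.ncard_lt_ncard hlt) (genericClass_of_abs_eq hA habs)
      (fun S => (principalMinor_transposeOn hA.1 hH S).trans (h S)) rfl
    simp only [generatedSet, Set.mem_ofPred_eq, sparsityGraph_congr habs] at h1
    exact .head (Or.inr ⟨H, hH, rfl⟩) h1

end Reconstruction

theorem mainTheorem2 (N : ℕ) (K : Matrix (Fin N) (Fin N) ℝ) (hK : K ∈ genericClass N) :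
    {K' : Matrix (Fin N) (Fin N) ℝ | K' ∈ genericClass N ∧
      ∀ S : Finset (Fin N), principalMinor K S = principalMinor K' S} = generatedSet K := by
  ext K'
  constructor
  · rintro ⟨hK', h⟩
    exact mem_generatedSet_of_principalMinor hK hK'.1 h
  · intro h
    obtain ⟨h1, h2⟩ := generatedSet_subset hK h
    exact ⟨genericClass_of_abs_eq hK h1, h2⟩
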